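/- **Model.** Base stations of two tiers, MBS ($m$) and SBS ($s$), form independent homogeneous Poisson point processes in $\mathbb R^2$ with densities $\lambda_m,\lambda_s>0$ and transmit powers $P_m,P_s>0$. The user is at the origin, $r_{i,j}$ is the distance of the $j$-th closest station of tier $i$, and $r_m=r_{m,1}$. The path loss exponent is $\alpha>2$ and the noise variance is $\sigma^2\ge 0$. Fading is Rayleigh: the channel coefficients $g_{i,j}$ are i.i.d. standard circularly symmetric complex Gaussians (so $h_{i,j}=|g_{i,j}|^2\sim\exp(1)$), independent of the positions. When a finite set $\mathcal B$ of stations serves the user, $$\mathrm{SINR}(\mathcal B)=\frac{\bigl|\sum_{(i,j)\in\mathcal B}P_i^{1/2}g_{i,j}r_{i,j}^{-\alpha/2}\bigr|^2}{\sum_{(i,j)\notin\mathcal B}P_i h_{i,j}r_{i,j}^{-\alpha}+\sigma^2}.$$ Let $k\ge1$. The user is served jointly by the $k$ closest SBSs on the event $B_s=\{\sum_{j\le k}P_sr_{s,j}^{-\alpha}>P_mr_m^{-\alpha}\}$, and by the closest MBS on $B_m=\{\sum_{j\le k}P_sr_{s,j}^{-\alpha}<P_mr_m^{-\alpha}\}$.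 For a threshold $\theta>0$ let $\mathcal P_n(B_s)=\mathbb P(\mathrm{SINR}>\theta\mid B_s)$ and $\mathcal P_n(B_m)=\mathbb P(\mathrm{SINR}>\theta\mid B_m)$ with the respective serving set. **Notation.** $\mathcal P_{\rm sbs\_co}=\mathbb P(B_s)$, $\omega=\sqrt{P_m/P_s}$, $\mathcal F(y,\alpha)=\int_y^\infty\frac{\mu}{1+\mu^\alpha}\,d\mu$ and $$\mathcal L_I(s;d_m,d_s)=\prod_{i\in\{s,m\}}\ell_i(s;d_i),\qquad \ell_i(s;d)=\exp\!\bigl(-2\pi\lambda_i(sP_i)^{2/\alpha}\mathcal F((sP_i)^{-1/\alpha}d,\alpha)\bigr).$$ Further, $f_{Rcm}(r)=\dfrac{2\pi\lambda_m r e^{-\pi\lambda_m r^2}g(r)}{1-\mathcal P_{\rm sbs\_co}}$ with $g(r)=\mathbb P\bigl(\sum_{j\le k}r_{s,j}^{-\alpha}<P_mr^{-\alpha}/P_s\bigr)$. For $\mathbf r=(r_1,\dots,r_k)$ put $\eta=P_m/(P_s\sum_j r_j^{-\alpha})$ and $$f_{Rcs}(\mathbf r)=\frac{1}{\mathcal P_{\rm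 sbs\_co}}e^{-\pi\lambda_m\eta^{2/\alpha}}(2\pi\lambda_s)^ke^{-\lambda_s\pi r_k^2}\prod_j r_j.$$ **Theorem.** $0<\mathcal P_{\rm sbs\_co}<1$, $\mathbb P(B_m)=1-\mathcal P_{\rm sbs\_co}$, and the integrals below converge absolutely. (1) *SBS cluster user:* with $d_m=\eta^{1/\alpha}$ and $d_s=r_k$, $$\mathcal P_n(B_s)=\int_{0<r_1<\dots<r_k<\infty}\exp\!\Bigl(\frac{-\theta\sigma^2}{\sum_jP_sr_j^{-\alpha}}\Bigr)\mathcal L_I\!\Bigl(\frac{\theta}{\sum_jP_sr_j^{-\alpha}};d_m,d_s\Bigr)f_{Rcs}(\mathbf r)\,d\mathbf r .$$ Almost surely on $B_s$, no interfering MBS is closer to the user than $d_m$ and no interfering SBS closer than $d_s$, evaluated at $r_j=r_{s,j}$. (2) *MBS user:* almost surely on $B_m$, no interfering MBS is closer than $r_m$ and no interfering SBS is closer than $\omega^{-2/\alpha}r_m$. With $d_m=r$ and some measurable function $d_s=d_s(r)\approx\omega^{-2/\alpha}r$, $$\mathcal P_n(B_m)=\int_0^\infty e^{-P_m^{-1}\theta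 r^\alpha\sigma^2}\,\mathcal L_I\bigl(P_m^{-1}\theta r^\alpha;d_m,d_s\bigr)f_{Rcm}(r)\,dr ,$$ and for every Borel set $A$ the integral over $A\cap(0,\infty)$ equals $\mathbb P(\mathrm{SINR}>\theta,\ r_m\in A\mid B_m)$. Here $\approx$ means the following. One has $d_s(r)\ge\omega^{-2/\alpha}r$ for all $r>0$, with equality if $k=1$, and $d_s(r)/(\omega^{-2/\alpha}r)\to1$ as $r\to0^+$. Moreover, with $s=P_m^{-1}\theta r^\alpha$ and $\rho=\omega^{-2/\alpha}r$, for all $r>0$ $$\ell_s(s;d_s(r))\le e^{\pi\lambda_s(k^{2/\alpha}-1)\rho^2}\,\ell_s(s;\rho).$$ -/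

import Mathlib

open MeasureTheory ProbabilityTheory Filter Topology
open scoped ENNReal NNReal

namespace CoopNet

noncomputable section

/-- The two tiers of base stations: macro (MBS) and small cell (SBS). -/
inductive Tier where
  | mbs : Tier
  | sbs : Tier

/-- The plane; the typical user sits at the origin. -/
abbrev Plane : Type := EuclideanSpace ℝ (Fin 2)

/-- The deterministic parameters of the two-tier network. -/
structure Params where
  /-- densities of the two Poisson processes -/
  lam : Tier → ℝ
  /-- transmit powers -/
  pow : Tier → ℝ
  /-- path loss exponent -/
  α : ℝ
  /-- variance `σ²` of the additive white noise -/
  noise : ℝ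
  lam_pos : ∀ i, 0 < lam i
  pow_pos : ∀ i, 0 < pow i
  two_lt_α : 2 < α
  noise_nonneg : 0 ≤ noise

section Model

variable {Ω : Type*} [MeasurableSpace Ω]

/-- The number of points of the enumerated pattern `X` that lie in `A`. -/
def pointCount (X : ℕ → Ω → Plane) (A : Set Plane) (ω : Ω) : ℕ∞ :=
  {j : ℕ | X j ω ∈ A}.encard

/-- The random points `X 0, X 1, …` form a homogeneous Poisson point process of density `lam`. -/
structure IsPoissonProcess (X : ℕ → Ω → Plane) (lam : ℝ) (P : Measure Ω) : Prop where
  measurable : ∀ j, Measurable (X j)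
  poisson : ∀ A : Set Plane, MeasurableSet A → volume A ≠ ∞ →
    HasLaw (pointCount X A)
      ((poissonMeasure (lam * (volume A).toReal).toNNReal).map (Nat.cast : ℕ → ℕ∞)) P
  indep : ∀ (n : ℕ) (A : Fin n → Set Plane), (∀ i, MeasurableSet (A i)) →
    Pairwise (fun i j => Disjoint (A i) (A j)) → iIndepFun (fun i => pointCount X (A i)) P

/-- The standard circularly symmetric complex Gaussian law: independent centred real and imaginary
parts of variance `1/2`. Its squared modulus is exponential with mean `1` (Rayleigh fading). -/
def complexGaussian : Measure ℂ :=
  ((gaussianReal 0 (1 / 2)).prod (gaussianReal 0 (1 / 2))).map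
    (fun p : ℝ × ℝ => (p.1 : ℂ) + (p.2 : ℂ) * Complex.I)

/-- The random network: `X i j` is the position of the `j`-th closest (counted from `0`) base
station of tier `i` to the user, and `g i j` is the complex Rayleigh fading coefficient of its
channel, so that `|g i j|²` is exponential with mean `1`. -/
structure IsNetwork (N : Params) (X : Tier → ℕ → Ω → Plane) (g : Tier → ℕ → Ω → ℂ)
    (P : Measure Ω) : Prop where
  poisson : ∀ i, IsPoissonProcess (X i) (N.lam i) P
  ordered : ∀ i, ∀ᵐ ω ∂P, Monotone (fun j => ‖X i j ω‖)
  tiers_indep : IndepFun (fun ω j => X Tier.mbs j ω) (fun ω j => X Tier.sbs j ω) P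
  fading_measurable : ∀ i j, Measurable (g i j)
  fading_law : ∀ i j, HasLaw (g i j) complexGaussian P
  fading_indep : iIndepFun (fun x : Tier × ℕ => g x.1 x.2) P
  fading_indep_positions : IndepFun (fun ω i j => X i j ω) (fun ω i j => g i j ω) P

/-- The received signal strength of the cluster of the `k` closest SBSs. -/
def clusterRSS (N : Params) (k : ℕ) (X : Tier → ℕ → Ω → Plane) (ω : Ω) : ℝ :=
  ∑ j ∈ Finset.range k, N.pow Tier.sbs * ‖X Tier.sbs j ω‖ ^ (-N.α)

/-- The received signal strength of the closest MBS. -/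
def macroRSS (N : Params) (X : Tier → ℕ → Ω → Plane) (ω : Ω) : ℝ :=
  N.pow Tier.mbs * ‖X Tier.mbs 0 ω‖ ^ (-N.α)

/-- The event `B_m`: the user associates with the closest MBS. -/
def assocM (N : Params) (k : ℕ) (X : Tier → ℕ → Ω → Plane) : Set Ω :=
  {ω | clusterRSS N k X ω < macroRSS N X ω}

/-- The event `B_s`: the user associates with the SBS cluster. -/
def assocS (N : Params) (k : ℕ) (X : Tier → ℕ → Ω → Plane) : Set Ω :=
  {ω | macroRSS N X ω < clusterRSS N k X ω}

/-- The power of the signal jointly transmitted by the stations in `B`: amplitudes add up. -/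
def signalPower (N : Params) (X : Tier → ℕ → Ω → Plane) (g : Tier → ℕ → Ω → ℂ)
    (B : Finset (Tier × ℕ)) (ω : Ω) : ℝ :=
  ‖∑ x ∈ B, ((√(N.pow x.1) * ‖X x.1 x.2 ω‖ ^ (-N.α / 2) : ℝ) : ℂ) * g x.1 x.2 ω‖ ^ 2

/-- The interference from all stations outside `B`: these send different symbols, so that
their powers add up. -/
def interference (N : Params) (X : Tier → ℕ → Ω → Plane) (g : Tier → ℕ → Ω → ℂ)
    (B : Finset (Tier × ℕ)) (ω : Ω) : ℝ≥0∞ :=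
  ∑' x : {x : Tier × ℕ // x ∉ B}, ENNReal.ofReal
    (N.pow x.1.1 * ‖g x.1.1 x.1.2 ω‖ ^ 2 * ‖X x.1.1 x.1.2 ω‖ ^ (-N.α))

/-- The SINR of a user that is served by the set `B` of base stations. -/
def sinr (N : Params) (X : Tier → ℕ → Ω → Plane) (g : Tier → ℕ → Ω → ℂ)
    (B : Finset (Tier × ℕ)) (ω : Ω) : ℝ≥0∞ :=
  ENNReal.ofReal (signalPower N X g B ω) / (interference N X g B ω + ENNReal.ofReal N.noise)

/-- The closest MBS, as a serving set. -/
def macroSet : Finset (Tier × ℕ) := {(Tier.mbs, 0)}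

/-- The `k` closest SBSs, as a serving set. -/
def clusterSet (k : ℕ) : Finset (Tier × ℕ) := {Tier.sbs} ×ˢ Finset.range k

/-- The event that the SINR exceeds the threshold `θ`, when the user is served by `B`. -/
def covered (N : Params) (θ : ℝ) (X : Tier → ℕ → Ω → Plane) (g : Tier → ℕ → Ω → ℂ)
    (B : Finset (Tier × ℕ)) : Set Ω :=
  {ω | ENNReal.ofReal θ < sinr N X g B ω}

/-- `P_n(B_m)`: the coverage probability of a user associated with an MBS. -/
def coverageM (N : Params) (θ : ℝ) (k : ℕ) (X : Tier → ℕ → Ω → Plane) (g : Tier → ℕ → Ω → ℂ)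
    (P : Measure Ω) : ℝ :=
  (cond P (assocM N k X)).real (covered N θ X g macroSet)

/-- `P_n(B_s)`: the coverage probability of a user associated with the SBS cluster. -/
def coverageS (N : Params) (θ : ℝ) (k : ℕ) (X : Tier → ℕ → Ω → Plane) (g : Tier → ℕ → Ω → ℂ)
    (P : Measure Ω) : ℝ :=
  (cond P (assocS N k X)).real (covered N θ X g (clusterSet k))

/-- `P_sbs_co`: the probability that the user associates with the SBS cluster. -/
def probS (N : Params) (k : ℕ) (X : Tier → ℕ → Ω → Plane) (P : Measure Ω) : ℝ :=
  P.real (assocS N k X)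

end Model

/-- `F(y, α) = ∫_y^∞ μ / (1 + μ^α) dμ`. -/
def F (y α : ℝ) : ℝ := ∫ μ in Set.Ioi y, μ / (1 + μ ^ α)

/-- The factor of one tier in the Laplace transform of the interference, when the interferers of
tier `i` are distributed outside the disc of radius `d`. -/
def tierLaplace (N : Params) (i : Tier) (d s : ℝ) : ℝ :=
  Real.exp (-2 * Real.pi * N.lam i * (s * N.pow i) ^ (2 / N.α) *
    F ((s * N.pow i) ^ (-1 / N.α) * d) N.α)

/-- The Laplace transform `L_I(s)` for the exclusion radii `dm`, `ds`. -/
def laplaceI (N : Params) (dm ds s : ℝ) : ℝ :=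
  tierLaplace N Tier.mbs dm s * tierLaplace N Tier.sbs ds s

/-- `ω = √(P_m / P_s)`. -/
def omega (N : Params) : ℝ := √(N.pow Tier.mbs / N.pow Tier.sbs)

/-- The exclusion radius `ω^(-2/α) r`. -/
def exclRadius (N : Params) (r : ℝ) : ℝ := omega N ^ (-2 / N.α) * r

/-- The density of the distance to the closest MBS. -/
def macroPDF (N : Params) (r : ℝ) : ℝ :=
  2 * Real.pi * N.lam Tier.mbs * r * Real.exp (-Real.pi * N.lam Tier.mbs * r ^ 2)

/-- `g(r)`: the probability that the cluster of the `k` closest SBSs offers less received power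
than an MBS at distance `r`. -/
def gFun {Ω : Type*} [MeasurableSpace Ω] (N : Params) (k : ℕ) (X : Tier → ℕ → Ω → Plane)
    (P : Measure Ω) (r : ℝ) : ℝ :=
  P.real {ω | ∑ j ∈ Finset.range k, ‖X Tier.sbs j ω‖ ^ (-N.α) <
    N.pow Tier.mbs * r ^ (-N.α) / N.pow Tier.sbs}

/-- `f_Rcm`: the density of the distance of the serving MBS, given `B_m`. -/
def fRcm {Ω : Type*} [MeasurableSpace Ω] (N : Params) (k : ℕ) (X : Tier → ℕ → Ω → Plane)
    (P : Measure Ω) (r : ℝ) : ℝ :=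
  macroPDF N r * gFun N k X P r / (1 - probS N k X P)

/-- The domain `0 < r₁ < ⋯ < r_k` of the `k`-fold integral. -/
def orderedRadii (k : ℕ) : Set (Fin k → ℝ) := {r | (∀ j, 0 < r j) ∧ StrictMono r}

/-- `r_k`, the largest entry of an ordered vector of radii. -/
def lastRadius {k : ℕ} [NeZero k] (r : Fin k → ℝ) : ℝ :=
  r ⟨k - 1, Nat.sub_one_lt (NeZero.ne k)⟩

/-- `∑ⱼ P_s rⱼ^(-α)`. -/
def clusterPower (N : Params) {k : ℕ} (r : Fin k → ℝ) : ℝ :=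
  ∑ j, N.pow Tier.sbs * r j ^ (-N.α)

/-- `η = P_m / (P_s ∑ⱼ rⱼ^(-α))`. -/
def eta (N : Params) {k : ℕ} (r : Fin k → ℝ) : ℝ :=
  N.pow Tier.mbs / (N.pow Tier.sbs * ∑ j, r j ^ (-N.α))

/-- `f_Γ`: the joint density of the distances of the `k` closest SBSs. -/
def fGamma (N : Params) {k : ℕ} [NeZero k] (r : Fin k → ℝ) : ℝ :=
  (2 * Real.pi * N.lam Tier.sbs) ^ k *
    Real.exp (-N.lam Tier.sbs * Real.pi * lastRadius r ^ 2) * ∏ j, r j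

/-- `f_Rcs`: the joint density of the distances of the cooperating SBSs, given `B_s`. -/
def fRcs {Ω : Type*} [MeasurableSpace Ω] (N : Params) {k : ℕ} [NeZero k]
    (X : Tier → ℕ → Ω → Plane) (P : Measure Ω) (r : Fin k → ℝ) : ℝ :=
  1 / probS N k X P *
    Real.exp (-Real.pi * N.lam Tier.mbs * eta N r ^ (2 / N.α)) * fGamma N r

/-- The integrand for an MBS user: noise term, Laplace term with exclusion radii `r` and `ds`, and
the density `f_Rcm`. -/
def integrandM {Ω : Type*} [MeasurableSpace Ω] (N : Params) (θ : ℝ) (k : ℕ)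
    (X : Tier → ℕ → Ω → Plane) (P : Measure Ω) (ds r : ℝ) : ℝ :=
  Real.exp (-((N.pow Tier.mbs)⁻¹ * θ * r ^ N.α * N.noise)) *
    laplaceI N r ds ((N.pow Tier.mbs)⁻¹ * θ * r ^ N.α) * fRcm N k X P r

/-- The integrand for an SBS cluster user: noise term, Laplace term with exclusion radii
`η^(1/α)` and `r_k`, and the density `f_Rcs`. -/
def integrandS {Ω : Type*} [MeasurableSpace Ω] (N : Params) (θ : ℝ) {k : ℕ} [NeZero k]
    (X : Tier → ℕ → Ω → Plane) (P : Measure Ω) (r : Fin k → ℝ) : ℝ :=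
  Real.exp (-θ * N.noise / clusterPower N r) *
    laplaceI N (eta N r ^ (1 / N.α)) (lastRadius r) (θ / clusterPower N r) * fRcs N X P r

end

end CoopNet

/-! Fix the positions. The jointly transmitted signal is a weighted sum of independent complex
Gaussians, hence Gaussian, and its power is exponential with mean `C`, the sum of the mean received
powers of the serving stations. So coverage has conditional probability exp(-s(I + σ²)) with s =
θ/C, and averaging over the fading of the interferers turns exp(-sI) into the product of the factors
1/(1 + s P r^(-α)) (`measure_covered_fading`). All infinite sums and products are handled through
`nexp` on `ℝ≥0∞`, where divergence costs nothing.

The positions enter only through distances. The squared distances of a tier, multiplied by πλ, are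
the arrival times of a unit rate Poisson process on the half-line. This is extracted from the
counting axioms: they give the Laplace functional, the Laplace functional determines the law of a
monotone sequence, and therefore the renewal property holds: the first arrival is exponential and
the rest is an independent delayed copy. Iterating renewal gives the joint density of the k nearest
distances together with an independent process beyond; conditioning on an empty initial interval is
again a delay. The Laplace functional of the process delayed to radius d is exactly the factor
ℓ_i(s; d).

For the cluster user, fix the small cells: `B_s` says that the disc of radius η^(1/α) contains no
MBS. This gives a void probability times ℓ_m, and integration over the k radii gives the formula.

For the MBS user at distance r, the event that the cluster is weak is more than emptiness of a disc,
so the small cells contribute a conditional Laplace transform ψ(r) that is not itself a factor ℓ_s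
with the obvious radius ρ = ω^(-2/α) r. The radius d_s is defined by ℓ_s(s; d_s) = ψ(r). This needs
ℓ_s(s; ρ) ≤ ψ(r) < 1. A weak cluster forces the disc of radius ρ to be empty; on the process delayed
beyond ρ, both the weak-cluster indicator and exp(-sI) increase with the arrival times, so they are
positively correlated (`IsUnitPoisson.lintegral_mul_lintegral_le`), which is the lower bound. Since
`F` decreases continuously and strictly to 0, d_s exists and is at least ρ.

The estimates on d_s come from lower bounds for the probability of a weak cluster, with a = πλ_s ρ².
It suffices that all small cells lie beyond k^(1/α) ρ, which gives the uniform bound and equality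
for k = 1. As r tends to 0, an empty disc of radius ρ yields a weak cluster up to probability o(a),
which gives d_s/ρ → 1. -/

namespace CoopNet

/-! ### The exponential `nexp` and the Laplace functional of a planar Poisson process -/

/-- `exp (-x)` for an extended nonnegative number `x`. -/
noncomputable def nexp (x : ℝ≥0∞) : ℝ≥0∞ := EReal.exp (-(x : EReal))

lemma nexp_zero : nexp 0 = 1 := by simp [nexp]

lemma nexp_top : nexp ∞ = 0 := by simp [nexp]

lemma nexp_ofReal {x : ℝ} (hx : 0 ≤ x) : nexp (.ofReal x) = .ofReal (Real.exp (-x)) := by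
  rw [nexp, EReal.coe_ennreal_ofReal, max_eq_left hx, ← EReal.coe_neg, EReal.exp_coe]

lemma nexp_add (x y : ℝ≥0∞) : nexp (x + y) = nexp x * nexp y := by
  rw [nexp, EReal.coe_ennreal_add, EReal.neg_add, sub_eq_add_neg, EReal.exp_add, nexp, nexp]
  · exact .inl (by simp)
  · exact .inr (by simp)

lemma antitone_nexp : Antitone nexp := fun x y h => by
  simpa [nexp] using h

lemma strictAnti_nexp : StrictAnti nexp := fun x y h => by
  simpa [nexp] using h

lemma continuous_nexp : Continuous nexp :=
  ENNReal.continuous_exp.comp (continuous_neg.comp continuous_coe_ennreal_ereal)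

@[fun_prop]
lemma measurable_nexp : Measurable nexp := continuous_nexp.measurable

lemma nexp_le_one (x : ℝ≥0∞) : nexp x ≤ 1 := nexp_zero ▸ antitone_nexp bot_le

lemma nexp_ne_top (x : ℝ≥0∞) : nexp x ≠ ∞ := ((nexp_le_one x).trans_lt ENNReal.one_lt_top).ne

lemma nexp_sum {ι : Type*} (s : Finset ι) (f : ι → ℝ≥0∞) :
    nexp (∑ i ∈ s, f i) = ∏ i ∈ s, nexp (f i) := by
  classical
  induction s using Finset.induction_on with
  | empty => simp [nexp_zero]
  | insert a s ha ih => rw [Finset.sum_insert ha, Finset.prod_insert ha, nexp_add, ih]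

lemma nexp_nat_mul (n : ℕ) (x : ℝ≥0∞) : nexp (n * x) = nexp x ^ n := by
  simpa using nexp_sum (Finset.range n) fun _ => x

lemma nexp_eq_ofReal {x : ℝ≥0∞} (hx : x ≠ ∞) : nexp x = .ofReal (Real.exp (-x.toReal)) := by
  rw [← nexp_ofReal ENNReal.toReal_nonneg, ENNReal.ofReal_toReal hx]

/-- The generating function of the Poisson law, E q^n = exp(-a(1 - q)), at q = exp(-c). -/
lemma lintegral_poisson_nexp (a : ℝ≥0) (c : ℝ≥0∞) (hc : c ≠ ∞) :
    ∫⁻ n : ℕ, nexp (c * n) ∂(poissonMeasure a) = nexp (a * (1 - nexp c)) := by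
  rw [lintegral_countable']
  simp_rw [poissonMeasure_singleton, mul_comm c, nexp_nat_mul, nexp_eq_ofReal hc]
  set q := Real.exp (-c.toReal) with hq
  have hq0 : 0 ≤ q := (Real.exp_pos _).le
  have hq1 : q ≤ 1 := Real.exp_le_one_iff.2 (by simp)
  have h1 : (a : ℝ≥0∞) * (1 - .ofReal q) = .ofReal (a * (1 - q)) := by
    rw [ENNReal.ofReal_mul a.coe_nonneg, ENNReal.ofReal_sub _ hq0]; simp
  rw [h1, nexp_ofReal (mul_nonneg a.coe_nonneg (sub_nonneg.2 hq1))]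
  have h2 : ∀ n : ℕ, ENNReal.ofReal q ^ n * .ofReal (Real.exp (-a) * a ^ n / n.factorial) =
      .ofReal (Real.exp (-a) * ((a * q) ^ n / n.factorial)) := by
    intro n
    rw [← ENNReal.ofReal_pow hq0, ← ENNReal.ofReal_mul (by positivity)]
    congr 1; rw [mul_pow]; ring
  simp_rw [h2]
  have h3 : HasSum (fun n : ℕ => Real.exp (-a) * ((a * q) ^ n / n.factorial))
      (Real.exp (-a) * Real.exp (a * q)) := by
    rw [Real.exp_eq_exp_ℝ]
    exact (NormedSpace.expSeries_div_hasSum_exp (a * q : ℝ)).mul_left _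
  rw [← ENNReal.ofReal_tsum_of_nonneg (fun n => by positivity) h3.summable, h3.tsum_eq,
    ← Real.exp_add]
  congr 2; ring

section Laplace

variable {Ω : Type*} [MeasurableSpace Ω] {P : Measure Ω} {X : ℕ → Ω → Plane} {lam : ℝ}

lemma tsum_indicator_eq_pointCount {Ω : Type*} {X : ℕ → Ω → Plane} (A : Set Plane) (c : ℝ≥0∞) (ω : Ω) :
    ∑' j, A.indicator (fun _ => c) (X j ω) = c * (pointCount X A ω : ℝ≥0∞) := by
  have : ∀ j, A.indicator (fun _ => c) (X j ω) = {j | X j ω ∈ A}.indicator (fun _ => c) j :=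
    fun j => rfl
  simp_rw [this]
  rw [← tsum_subtype {j | X j ω ∈ A} (fun _ => c), ENNReal.tsum_set_const, mul_comm]
  rfl

lemma lintegral_nexp_pointCount (hX : IsPoissonProcess X lam P) (hl : 0 < lam) {A : Set Plane}
    (hA : MeasurableSet A) (hA' : volume A ≠ ∞) {c : ℝ≥0∞} (hc : c ≠ ∞) :
    ∫⁻ ω, nexp (c * (pointCount X A ω : ℝ≥0∞)) ∂P =
      nexp (.ofReal lam * (volume A * (1 - nexp c))) := by
  have h := hX.poisson A hA hA'
  have h1 := h.lintegral_comp (f := fun n : ℕ∞ => nexp (c * (n : ℝ≥0∞)))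
    (measurable_of_countable _).aemeasurable
  rw [h1, lintegral_map (measurable_of_countable _) (measurable_of_countable _)]
  simp only [ENat.toENNReal_coe]
  rw [lintegral_poisson_nexp _ _ hc]
  congr 1
  rw [← mul_assoc]
  congr 1
  rw [← ENNReal.ofReal_toReal hA', ← ENNReal.ofReal_mul hl.le, ENNReal.ofReal_toReal hA']
  rfl

/-- The level sets of `f` are disjoint, so their counts are independent Poisson variables and the
expectation is a product of generating functions. Finite volume of the support makes every count
finite in mean. -/
lemma laplace_simpleFunc [IsProbabilityMeasure P] (hX : IsPoissonProcess X lam P) (hl : 0 < lam)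
    (f : SimpleFunc Plane ℝ≥0∞) (hf : ∀ x, f x ≠ ∞) (hfs : volume (Function.support f) ≠ ∞) :
    ∫⁻ ω, nexp (∑' j, f (X j ω)) ∂P =
      nexp (.ofReal lam * ∫⁻ x, (1 - nexp (f x))) := by
  classical
  -- The value 0 is discarded: its level set may have infinite volume, and it does not contribute to
  -- the sum.
  set s := f.range.filter (· ≠ 0) with hs
  set e := s.equivFin with he
  set c : Fin s.card → ℝ≥0∞ := fun i => (e.symm i : ℝ≥0∞) with hc
  set A : Fin s.card → Set Plane := fun i => f ⁻¹' {c i} with hA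
  have hcinj : Function.Injective c := fun i j h => e.symm.injective (Subtype.ext h)
  have hc0 : ∀ i, c i ≠ 0 := fun i => (Finset.mem_filter.1 (e.symm i).2).2
  have hctop : ∀ i, c i ≠ ∞ := fun i => by
    obtain ⟨x, hx⟩ := SimpleFunc.mem_range.1 (Finset.mem_filter.1 (e.symm i).2).1
    have := hf x; rw [hx] at this; exact this
  have hAm : ∀ i, MeasurableSet (A i) := fun i => f.measurableSet_preimage _
  have hAd : Pairwise fun i j => Disjoint (A i) (A j) := fun i j hij =>
    Disjoint.preimage _ (by simpa using hcinj.ne hij)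
  have hAv : ∀ i, volume (A i) ≠ ∞ := fun i => by
    refine ne_top_of_le_ne_top hfs (measure_mono fun x hx => ?_)
    have : f x = c i := hx
    simpa [this] using hc0 i
  -- Used twice: with `φ = id` for the sum over the points, and with `φ y = 1 - nexp y` for the
  -- integral over the plane.
  have key : ∀ (φ : ℝ≥0∞ → ℝ≥0∞), φ 0 = 0 → ∀ x,
      φ (f x) = ∑ i, (A i).indicator (fun _ => φ (c i)) x := by
    intro φ hφ x
    by_cases hx : f x = 0
    · rw [hx, hφ, eq_comm]
      refine Finset.sum_eq_zero fun i _ => Set.indicator_of_notMem ?_ _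
      intro h
      have : f x = c i := h
      exact hc0 i (this ▸ hx)
    · have hxs : f x ∈ s := Finset.mem_filter.2 ⟨f.mem_range_self x, hx⟩
      have hxc : c (e ⟨f x, hxs⟩) = f x := by simp [hc]
      rw [Finset.sum_eq_single (e ⟨f x, hxs⟩)]
      · rw [Set.indicator_of_mem, hxc]; exact hxc.symm
      · intro i _ hi
        refine Set.indicator_of_notMem (fun h => hi (hcinj ?_)) _
        have : f x = c i := h
        rw [hxc, this]
      · simp
  have hsum : ∀ ω, ∑' j, f (X j ω) = ∑ i, c i * (pointCount X (A i) ω : ℝ≥0∞) := by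
    intro ω
    have h1 : ∑' j, f (X j ω) = ∑' j, ∑ i, (A i).indicator (fun _ => c i) (X j ω) :=
      tsum_congr fun j => key id rfl (X j ω)
    rw [h1, Summable.tsum_finsetSum fun _ _ => ENNReal.summable]
    simp [tsum_indicator_eq_pointCount]
  simp only [hsum, nexp_sum]
  have hind := (hX.indep _ A hAm hAd).comp (fun i (n : ℕ∞) => nexp (c i * (n : ℝ≥0∞)))
    fun i => measurable_of_countable _
  have hmeas : ∀ i, Measurable (fun ω => nexp (c i * (pointCount X (A i) ω : ℝ≥0∞))) := by
    intro i
    simp_rw [← tsum_indicator_eq_pointCount]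
    exact measurable_nexp.comp (Measurable.tsum fun j =>
      (measurable_const.indicator (hAm i)).comp (hX.measurable j))
  have h2 := lintegral_prod_eq_prod_lintegral_of_indepFun Finset.univ _ hind hmeas
  simp only [Function.comp_def] at h2
  rw [h2]
  rw [Finset.prod_congr rfl fun i _ =>
    lintegral_nexp_pointCount hX hl (hAm i) (hAv i) (hctop i), ← nexp_sum, ← Finset.mul_sum]
  congr 2
  rw [lintegral_congr (key (fun y => 1 - nexp y) (by simp [nexp_zero])), lintegral_finsetSum _ fun i _ => measurable_const.indicator (hAm i)]
  refine Finset.sum_congr rfl fun i _ => ?_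
  rw [lintegral_indicator (hAm i), setLIntegral_const, mul_comm]

/-- The Laplace functional of a Poisson process. -/
theorem IsPoissonProcess.lintegral_nexp_tsum [IsProbabilityMeasure P]
    (hX : IsPoissonProcess X lam P) (hl : 0 < lam)
    {u : Plane → ℝ≥0∞} (hu : Measurable u) :
    ∫⁻ ω, nexp (∑' j, u (X j ω)) ∂P = nexp (.ofReal lam * ∫⁻ x, (1 - nexp (u x))) := by
  -- The cut-off to a growing ball gives each simple approximation a support of finite volume.
  set v : ℕ → SimpleFunc Plane ℝ≥0∞ := fun n =>
    (SimpleFunc.eapprox u n).restrict (Metric.closedBall 0 n) with hv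
  have hvapp : ∀ n x, v n x =
      (Metric.closedBall (0 : Plane) n).indicator (SimpleFunc.eapprox u n) x := fun n x => by
    rw [hv, SimpleFunc.restrict_apply _ measurableSet_closedBall]
  have hmono : ∀ x, Monotone fun n => v n x := by
    intro x m n hmn
    simp only [hvapp]
    refine (Set.indicator_le_indicator (SimpleFunc.monotone_eapprox u hmn x)).trans ?_
    exact Set.indicator_le_indicator_of_subset
      (Metric.closedBall_subset_closedBall (by exact_mod_cast hmn)) (fun _ => bot_le) _
  have hsup : ∀ x, ⨆ n, v n x = u x := by
    intro x
    rw [← SimpleFunc.iSup_eapprox_apply hu x]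
    refine le_antisymm (iSup_mono fun n => ?_) (iSup_le fun n => ?_)
    · rw [hvapp]; exact Set.indicator_le_self _ _ _
    · obtain ⟨m, hm⟩ := exists_nat_ge ‖x‖
      refine le_trans ?_ (le_iSup _ (max m n))
      rw [hvapp, Set.indicator_of_mem]
      · exact SimpleFunc.monotone_eapprox u (le_max_right m n) x
      · simp only [Metric.mem_closedBall, dist_zero_right]
        exact hm.trans (by simp)
  have hlap : ∀ n, ∫⁻ ω, nexp (∑' j, v n (X j ω)) ∂P =
      nexp (.ofReal lam * ∫⁻ x, (1 - nexp (v n x))) := by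
    intro n
    refine laplace_simpleFunc hX hl _ (fun x => ?_) ?_
    · rw [hvapp]
      refine ((Set.indicator_le_self _ _ _).trans_lt (SimpleFunc.eapprox_lt_top u n x)).ne
    · refine ne_top_of_le_ne_top (measure_closedBall_lt_top (x := (0 : Plane)) (r := n)).ne
        (measure_mono fun x hx => ?_)
      by_contra h
      exact hx (by rw [hvapp, Set.indicator_of_notMem h])
  have hvt : ∀ x, Tendsto (fun n => v n x) atTop (𝓝 (u x)) := fun x =>
    hsup x ▸ tendsto_atTop_iSup (hmono x)
  have hL : Tendsto (fun n => ∫⁻ ω, nexp (∑' j, v n (X j ω)) ∂P) atTop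
      (𝓝 (∫⁻ ω, nexp (∑' j, u (X j ω)) ∂P)) := by
    refine tendsto_lintegral_of_dominated_convergence (fun _ => 1) (fun n => ?_)
      (fun n => ae_of_all _ fun ω => nexp_le_one _) (by simp) (ae_of_all _ fun ω => ?_)
    · exact measurable_nexp.comp (Measurable.tsum fun j =>
        (v n).measurable.comp (hX.measurable j))
    · refine (continuous_nexp.tendsto _).comp ?_
      -- Monotone convergence for the counting measure on the indices.
      have : ∑' j, u (X j ω) = ⨆ n, ∑' j, v n (X j ω) := by
        simp_rw [← lintegral_count, ← hsup]
        exact lintegral_iSup (fun n => measurable_of_countable _) fun m n hmn j => hmono _ hmn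
      rw [this]
      exact tendsto_atTop_iSup fun m n hmn => ENNReal.tsum_le_tsum fun j => hmono _ hmn
  have hR : Tendsto (fun n => nexp (.ofReal lam * ∫⁻ x, (1 - nexp (v n x)))) atTop
      (𝓝 (nexp (.ofReal lam * ∫⁻ x, (1 - nexp (u x))))) := by
    refine (continuous_nexp.tendsto _).comp
      (ENNReal.Tendsto.const_mul ?_ (.inr ENNReal.ofReal_ne_top))
    refine lintegral_tendsto_of_tendsto_of_monotone
      (fun n => (measurable_const.sub (measurable_nexp.comp (v n).measurable)).aemeasurable)
      (ae_of_all _ fun x m n hmn => tsub_le_tsub_left (antitone_nexp (hmono x hmn)) _)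
      (ae_of_all _ fun x => ?_)
    exact ENNReal.Tendsto.sub tendsto_const_nhds ((continuous_nexp.tendsto _).comp (hvt x))
      (.inl ENNReal.one_ne_top)
  exact tendsto_nhds_unique (by simpa only [hlap] using hL) hR

end Laplace
-- Passage from the plane to squared radii
-- The area of a disc is linear in its squared radius, so density `lam` in the plane becomes density
-- 1 in the variable πλ‖x‖². The space is left general because the same computation serves the
-- positions in `Plane` and the Gaussian density on `ℂ`.
lemma map_const_mul_norm_sq {E : Type*} [NormedAddCommGroup E] [MeasureSpace E] [BorelSpace E]
    (hball : ∀ r : ℝ, 0 ≤ r → volume (Metric.closedBall (0 : E) r) = .ofReal (Real.pi * r ^ 2))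
    {lam : ℝ} (hl : 0 < lam) :
    (ENNReal.ofReal lam • (volume : Measure E)).map (fun x => Real.pi * lam * ‖x‖ ^ 2) =
      volume.restrict (Set.Ioi 0) := by
  have hm : Measurable fun x : E => Real.pi * lam * ‖x‖ ^ 2 := by fun_prop
  have hb : 0 < Real.pi * lam := by positivity
  have hIic : ∀ c : ℝ, (ENNReal.ofReal lam • (volume : Measure E)).map
      (fun x => Real.pi * lam * ‖x‖ ^ 2) (Set.Iic c) = .ofReal c := by
    intro c
    rw [Measure.map_apply hm measurableSet_Iic, Measure.smul_apply, smul_eq_mul]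
    rcases lt_or_ge c 0 with hc | hc
    · have : (fun x : E => Real.pi * lam * ‖x‖ ^ 2) ⁻¹' Set.Iic c = ∅ := by
        ext x
        simp only [Set.mem_preimage, Set.mem_Iic, Set.mem_empty_iff_false, iff_false, not_le]
        exact hc.trans_le (by positivity)
      rw [this, ENNReal.ofReal_of_nonpos hc.le]; simp
    · have : (fun x : E => Real.pi * lam * ‖x‖ ^ 2) ⁻¹' Set.Iic c =
          Metric.closedBall 0 (√(c / (Real.pi * lam))) := by
        ext x
        simp only [Set.mem_preimage, Set.mem_Iic, Metric.mem_closedBall, dist_zero_right]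
        rw [Real.le_sqrt (norm_nonneg x) (by positivity), le_div_iff₀ hb, mul_comm]
      rw [this, hball _ (Real.sqrt_nonneg _), Real.sq_sqrt (by positivity),
        ← ENNReal.ofReal_mul hl.le]
      congr 1; field_simp
  have key : ∀ a b : ℝ, a < b → (ENNReal.ofReal lam • (volume : Measure E)).map
      (fun x => Real.pi * lam * ‖x‖ ^ 2) (Set.Ioc a b) = .ofReal (b - max a 0) := by
    intro a b hab
    have h1 : Set.Ioc a b = Set.Iic b \ Set.Iic a := by ext; simp [and_comm]
    have h2 : ENNReal.ofReal a = .ofReal (max a 0) := by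
      rcases le_total a 0 with h | h <;> simp [h, ENNReal.ofReal_of_nonpos]
    rw [h1, measure_sdiff (Set.Iic_subset_Iic.2 hab.le)
      measurableSet_Iic.nullMeasurableSet (by rw [hIic]; exact ENNReal.ofReal_ne_top), hIic, hIic,
      h2, ← ENNReal.ofReal_sub _ (le_max_right _ _)]
  refine Measure.ext_of_Ioc' _ _ (fun a b hab => ?_) fun a b hab => ?_
  · rw [key a b hab]; exact ENNReal.ofReal_ne_top
  · rw [key a b hab, Measure.restrict_apply measurableSet_Ioc, Set.Ioc_inter_Ioi, Real.volume_Ioc]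

lemma volume_closedBall_plane (r : ℝ) (hr : 0 ≤ r) :
    volume (Metric.closedBall (0 : Plane) r) = .ofReal (Real.pi * r ^ 2) := by
  rw [EuclideanSpace.volume_closedBall_fin_two, ← ENNReal.ofReal_pow hr, mul_comm,
    ENNReal.ofReal_mul Real.pi_pos.le]

lemma volume_closedBall_complex (r : ℝ) (hr : 0 ≤ r) :
    volume (Metric.closedBall (0 : ℂ) r) = .ofReal (Real.pi * r ^ 2) := by
  rw [Complex.volume_closedBall, ← ENNReal.ofReal_pow hr, mul_comm,
    ENNReal.ofReal_mul Real.pi_pos.le]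
  simp [ENNReal.ofReal, ← NNReal.coe_real_pi]

/-! ### The Laplace functional determines the law of a monotone sequence -/

/-- A probability measure on a cube is determined by its moments. -/
theorem ext_of_moments {ι : Type*} [Fintype ι] {P Q : Measure (ι → unitInterval)}
    [IsFiniteMeasure P] [IsFiniteMeasure Q]
    (h : ∀ c : ι → ℕ, ∫ x, ∏ i, (x i : ℝ) ^ c i ∂P = ∫ x, ∏ i, (x i : ℝ) ^ c i ∂Q) : P = Q := by
  classical
  let coord : ι → BoundedContinuousFunction (ι → unitInterval) ℝ := fun i =>
    BoundedContinuousFunction.mkOfCompact ⟨fun x => (x i : ℝ), by fun_prop⟩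
  -- Stone-Weierstrass in disguise: polynomials in the coordinates form a point-separating
  -- subalgebra, and monomials span it.
  let A : StarSubalgebra ℝ (BoundedContinuousFunction (ι → unitInterval) ℝ) :=
    { Algebra.adjoin ℝ (Set.range coord) with
      star_mem' := fun {f} hf => by
        have : star f = f := by ext x; simp
        rwa [this] }
  have hmon : ∀ f ∈ Submonoid.closure (Set.range coord), ∃ c : ι → ℕ, ∀ x,
      f x = ∏ i, (x i : ℝ) ^ c i := by
    intro f hf
    induction hf using Submonoid.closure_induction with
    | mem f hf =>
      obtain ⟨i, rfl⟩ := hf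
      refine ⟨Pi.single i 1, fun x => ?_⟩
      rw [Finset.prod_eq_single i] <;> simp +contextual [coord]
    | one => exact ⟨0, fun x => by simp⟩
    | mul f g _ _ hf hg =>
      obtain ⟨c, hc⟩ := hf
      obtain ⟨d, hd⟩ := hg
      exact ⟨c + d, fun x => by simp [hc, hd, pow_add, Finset.prod_mul_distrib]⟩
  refine ext_of_forall_mem_subalgebra_integral_eq_of_polish (𝕜 := ℝ) (A := A) ?_ ?_
  · intro x y hxy
    obtain ⟨i, hi⟩ := Function.ne_iff.1 hxy
    refine ⟨fun x => (x i : ℝ), ⟨(coord i).toContinuousMap, ⟨coord i, ?_, rfl⟩, rfl⟩, ?_⟩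
    · exact Algebra.subset_adjoin ⟨i, rfl⟩
    · simpa [Subtype.ext_iff] using hi
  · intro f hf
    have hf' : f ∈ Submodule.span ℝ (Submonoid.closure (Set.range coord) : Set _) := by
      rw [← Algebra.adjoin_eq_span]; exact hf
    clear hf
    induction hf' using Submodule.span_induction with
    | mem f hf =>
      obtain ⟨c, hc⟩ := hmon f hf
      simp_rw [hc]; exact h c
    | zero => simp
    | add f g _ _ hf hg =>
      simp only [BoundedContinuousFunction.coe_add, Pi.add_apply]
      rw [integral_add (f.integrable _) (g.integrable _),
        integral_add (f.integrable _) (g.integrable _), hf, hg]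
    | smul a f _ hf =>
      simp only [BoundedContinuousFunction.coe_smul, smul_eq_mul]
      rw [integral_const_mul, integral_const_mul, hf]

lemma isPiSystem_initial_boxes :
    IsPiSystem {S : Set (ℕ → ℝ) | ∃ (n : ℕ) (t : ℕ → ℝ), S = {T | ∀ i < n, T i ≤ t i}} := by
  rintro _ ⟨n, t, rfl⟩ _ ⟨m, s, rfl⟩ -
  refine ⟨max n m, fun i => if i < n then (if i < m then min (t i) (s i) else t i) else s i, ?_⟩
  ext T
  simp only [Set.mem_inter_iff, Set.mem_ofPred_eq]
  constructor
  · rintro ⟨h1, h2⟩ i hi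
    split_ifs with h h' <;> grind
  · intro h
    refine ⟨fun i hi => ?_, fun i hi => ?_⟩
    · have := h i (by omega)
      grind
    · have := h i (by omega)
      grind

/-- Boxes that constrain all coordinates up to `n` are preferred to single half-spaces, since they
are closed under intersection and, for monotone sequences, translate into events about counts. -/
lemma generateFrom_initial_boxes :
    (MeasurableSpace.pi : MeasurableSpace (ℕ → ℝ)) = MeasurableSpace.generateFrom
      {S : Set (ℕ → ℝ) | ∃ (n : ℕ) (t : ℕ → ℝ), S = {T | ∀ i < n, T i ≤ t i}} := by
  refine le_antisymm ?_ ?_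
  · refine iSup_le fun j => ?_
    have hb : Real.measurableSpace = MeasurableSpace.generateFrom (Set.range Set.Iic) := by
      rw [BorelSpace.measurable_eq (α := ℝ), borel_eq_generateFrom_Iic]
    change MeasurableSpace.comap (fun T : ℕ → ℝ => T j) Real.measurableSpace ≤ _
    rw [hb, MeasurableSpace.comap_generateFrom]
    refine MeasurableSpace.generateFrom_le ?_
    rintro _ ⟨_, ⟨a, rfl⟩, rfl⟩
    -- The earlier coordinates are bounded by an arbitrary `m`, which is then removed by a countable
    -- union.
    have : (fun T : ℕ → ℝ => T j) ⁻¹' Set.Iic a =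
        ⋃ m : ℕ, {T | ∀ i < j + 1, T i ≤ if i = j then a else (m : ℝ)} := by
      ext T
      simp only [Set.mem_preimage, Set.mem_Iic, Set.mem_iUnion, Set.mem_ofPred_eq]
      constructor
      · intro h
        obtain ⟨m, hm⟩ := exists_nat_ge (∑ i ∈ Finset.range j, |T i|)
        refine ⟨m, fun i hi => ?_⟩
        split_ifs with hij
        · rwa [hij]
        · refine (le_abs_self _).trans (le_trans ?_ hm)
          exact Finset.single_le_sum (f := fun i => |T i|) (fun _ _ => abs_nonneg _)
            (Finset.mem_range.2 (by omega))
      · rintro ⟨m, h⟩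
        simpa using h j (by omega)
    rw [this]
    exact MeasurableSet.iUnion fun m => MeasurableSpace.measurableSet_generateFrom
      ⟨j + 1, fun i => if i = j then a else (m : ℝ), rfl⟩
  · refine MeasurableSpace.generateFrom_le ?_
    rintro _ ⟨n, t, rfl⟩
    simp only [Set.ofPred_forall]
    exact MeasurableSet.iInter fun i => MeasurableSet.iInter fun _ =>
      measurableSet_le (measurable_pi_apply i) measurable_const

/-- The number of arrivals of the sequence `T` up to time `t`. -/
noncomputable def arrivals (T : ℕ → ℝ) (t : ℝ) : ℝ≥0∞ := ∑' j, (Set.Iic t).indicator 1 (T j)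

lemma measurable_arrivals (t : ℝ) : Measurable fun T => arrivals T t :=
  Measurable.tsum fun j => (measurable_one.indicator measurableSet_Iic).comp (measurable_pi_apply j)

/-- The dictionary between arrival times and counts. Indices start at 0, hence the `i + 1`. -/
lemma le_iff_arrivals {T : ℕ → ℝ} (hT : Monotone T) (i : ℕ) (t : ℝ) :
    T i ≤ t ↔ ((i + 1 : ℕ) : ℝ≥0∞) ≤ arrivals T t := by
  constructor
  · intro h
    refine le_trans ?_ (ENNReal.sum_le_tsum (Finset.range (i + 1)))
    rw [Finset.sum_congr rfl (g := fun _ => 1) fun j hj => Set.indicator_of_mem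
      (show T j ∈ Set.Iic t from (hT (by simpa [Nat.lt_succ_iff] using hj)).trans h) _]
    simp
  · intro h
    by_contra! hlt
    have : arrivals T t = ∑ j ∈ Finset.range i, (Set.Iic t).indicator 1 (T j) := by
      refine tsum_eq_sum fun j hj => Set.indicator_of_notMem ?_ _
      simp only [Set.mem_Iic, not_le]
      exact hlt.trans_le (hT (by simpa using hj))
    have h2 : arrivals T t ≤ i := by
      rw [this]
      refine (Finset.sum_le_card_nsmul _ _ 1 fun j _ => ?_).trans (by simp)
      exact Set.indicator_le_self _ _ _
    have := h.trans h2
    rw [Nat.cast_le] at this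
    omega

/-- The law of a monotone random sequence is determined by its Laplace functional. -/
theorem ext_of_lintegral_nexp_arrivals {μ ν : Measure (ℕ → ℝ)} [IsProbabilityMeasure μ]
    [IsProbabilityMeasure ν] (hμ : ∀ᵐ T ∂μ, Monotone T) (hν : ∀ᵐ T ∂ν, Monotone T)
    (h : ∀ (n : ℕ) (t : Fin n → ℝ) (c : Fin n → ℕ),
      ∫⁻ T, nexp (∑ i, c i * arrivals T (t i)) ∂μ =
        ∫⁻ T, nexp (∑ i, c i * arrivals T (t i)) ∂ν) : μ = ν := by
  refine ext_of_generate_finite _ generateFrom_initial_boxes isPiSystem_initial_boxes ?_ (by simp)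
  rintro _ ⟨n, t, rfl⟩
  -- Passing to exp(-count) keeps the values in [0, 1] even for infinite counts, and makes the given
  -- Laplace values with integer coefficients the moments of `V`.
  let V : (ℕ → ℝ) → Fin n → unitInterval := fun T i =>
    ⟨(nexp (arrivals T (t i))).toReal, ENNReal.toReal_nonneg, by
      simpa using ENNReal.toReal_mono ENNReal.one_ne_top (nexp_le_one (arrivals T (t i)))⟩
  have hV : Measurable V := measurable_pi_lambda _ fun i =>
    (measurable_nexp.comp (measurable_arrivals (t i))).ennreal_toReal.subtype_mk
  have hprod : ∀ (c : Fin n → ℕ) T, ∏ i, (V T i : ℝ) ^ c i =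
      (nexp (∑ i, c i * arrivals T (t i))).toReal := by
    intro c T
    simp [V, nexp_sum, nexp_nat_mul, ENNReal.toReal_prod]
  have hVm : μ.map V = ν.map V := by
    have := Measure.isProbabilityMeasure_map (μ := μ) hV.aemeasurable
    have := Measure.isProbabilityMeasure_map (μ := ν) hV.aemeasurable
    refine ext_of_moments fun c => ?_
    have hc : Continuous fun x : Fin n → unitInterval => ∏ i, (x i : ℝ) ^ c i := by fun_prop
    rw [integral_map hV.aemeasurable hc.aestronglyMeasurable,
      integral_map hV.aemeasurable hc.aestronglyMeasurable]
    simp_rw [hprod]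
    have hm : Measurable fun T => nexp (∑ i, c i * arrivals T (t i)) := by
      have := fun i => measurable_arrivals (t i)
      fun_prop
    rw [integral_toReal hm.aemeasurable (ae_of_all _ fun T => (nexp_ne_top _).lt_top),
      integral_toReal hm.aemeasurable (ae_of_all _ fun T => (nexp_ne_top _).lt_top), h]
  -- The condition that at least `i + 1` arrivals occur by time `t i`, read through the decreasing
  -- map `nexp`.
  set B : Set (Fin n → unitInterval) :=
    {x | ∀ i, (x i : ℝ) ≤ (nexp ((i + 1 : ℕ) : ℝ≥0∞)).toReal} with hB
  have hBm : MeasurableSet B := by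
    simp only [hB, Set.ofPred_forall]
    exact MeasurableSet.iInter fun i => measurableSet_le (by fun_prop) measurable_const
  have key : ∀ T : ℕ → ℝ, Monotone T → ((∀ i < n, T i ≤ t i) ↔ V T ∈ B) := by
    intro T hT
    simp only [hB, Set.mem_ofPred_eq, V, ENNReal.toReal_le_toReal (nexp_ne_top _) (nexp_ne_top _),
      strictAnti_nexp.le_iff_ge]
    constructor
    · intro h i; exact (le_iff_arrivals hT i _).1 (h i i.2)
    · intro h i hi; exact (le_iff_arrivals hT i _).2 (h ⟨i, hi⟩)
  have hmeas : ∀ {ρ : Measure (ℕ → ℝ)}, (∀ᵐ T ∂ρ, Monotone T) →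
      ρ {T | ∀ i < n, T i ≤ t i} = ρ.map V B := by
    intro ρ hρ
    rw [Measure.map_apply hV hBm]
    refine measure_congr ?_
    filter_upwards [hρ] with T hT
    exact propext (key T hT)
  rw [hmeas hμ, hmeas hν, hVm]

/-! ### Unit rate Poisson arrivals and the renewal property -/

/-- If the hazard rate `h` takes values in `[0, 1]` and is eventually `1`, then
`h t * exp (-∫₀ᵗ h)` is a probability density. -/
lemma lintegral_hazard {h : ℝ → ℝ} (hm : Measurable h) (h0 : ∀ x, 0 ≤ h x) (h1 : ∀ x, h x ≤ 1)
    {M : ℝ} (hM : ∀ x, M < x → h x = 1) :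
    ∫⁻ t in Set.Ioi 0, .ofReal (h t * Real.exp (-∫ x in (0 : ℝ)..t, h x)) = 1 := by
  set H : ℝ → ℝ := fun t => ∫ x in (0 : ℝ)..t, h x with hH
  have hint : ∀ a b, IntervalIntegrable h volume a b := fun a b =>
    (intervalIntegrable_const (c := (1 : ℝ))).mono_fun hm.aestronglyMeasurable
      (ae_of_all _ fun x => by simpa [abs_of_nonneg (h0 x)] using h1 x)
  have hHsub : ∀ a b, H b - H a = ∫ x in a..b, h x := fun a b =>
    intervalIntegral.integral_interval_sub_left (hint _ _) (hint _ _)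
  have hHmono : ∀ a b, a ≤ b → 0 ≤ H b - H a := fun a b hab => by
    rw [hHsub]; exact intervalIntegral.integral_nonneg hab fun x _ => h0 x
  have hHlip : ∀ a b, a ≤ b → H b - H a ≤ b - a := fun a b hab => by
    rw [hHsub]
    simpa using intervalIntegral.integral_mono_on hab (hint a b) (intervalIntegrable_const (c := (1 : ℝ)))
      fun x _ => h1 x
  have hH0 : H 0 = 0 := by simp [hH]
  -- The density is the derivative of `φ` only almost everywhere, as `h` is merely measurable. The
  -- bounds on `h` make `φ` Lipschitz on the positive half-line, so the fundamental theorem of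
  -- calculus for absolutely continuous functions applies.
  set φ : ℝ → ℝ := fun t => -Real.exp (-H t) with hφ
  have hφstep : ∀ a b, 0 ≤ a → a ≤ b → |φ b - φ a| ≤ b - a := by
    intro a b ha hab
    have e1 : φ b - φ a = Real.exp (-H a) * (1 - Real.exp (-(H b - H a))) := by
      have : -H b = -H a + -(H b - H a) := by ring
      simp only [hφ]; rw [this, Real.exp_add]; ring
    have e2 : Real.exp (-H a) ≤ 1 := by
      have := hHmono 0 a ha
      rw [Real.exp_le_one_iff]; linarith
    have e3 := Real.add_one_le_exp (-(H b - H a))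
    have e4 : Real.exp (-(H b - H a)) ≤ 1 := by
      rw [Real.exp_le_one_iff]; linarith [hHmono a b hab]
    have e5 := hHlip a b hab
    have e6 := Real.exp_pos (-H a)
    rw [e1, abs_of_nonneg (mul_nonneg e6.le (by linarith))]
    nlinarith
  have hac : ∀ R : ℝ, 0 ≤ R → AbsolutelyContinuousOnInterval φ 0 R := by
    intro R hR
    refine LipschitzOnWith.absolutelyContinuousOnInterval (K := 1)
      (LipschitzOnWith.of_dist_le_mul fun x hx y hy => ?_)
    rw [Set.uIcc_of_le hR] at hx hy
    rw [NNReal.coe_one, one_mul, Real.dist_eq, Real.dist_eq]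
    rcases le_total x y with hxy | hxy
    · rw [abs_sub_comm, abs_sub_comm x, abs_of_nonneg (sub_nonneg.2 hxy)]
      exact hφstep x y hx.1 hxy
    · rw [abs_of_nonneg (sub_nonneg.2 hxy)]
      exact hφstep y x hy.1 hxy
  have hloc : LocallyIntegrable h volume := by
    refine (locallyIntegrable_const (1 : ℝ)).mono hm.aestronglyMeasurable
      (ae_of_all _ fun x => by simpa [abs_of_nonneg (h0 x)] using h1 x)
  have hderiv : ∀ᵐ x, deriv φ x = h x * Real.exp (-H x) := by
    filter_upwards [_root_.LocallyIntegrable.ae_hasDerivAt_integral hloc] with x hx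
    have h2 : HasDerivAt H (h x) x := hx 0
    have h3 : HasDerivAt φ (-(Real.exp (-H x) * -h x)) x := h2.fun_neg.exp.fun_neg
    rw [h3.deriv]; ring
  have hHc : Continuous H := by
    exact intervalIntegral.continuous_primitive hint 0
  have hfm : Measurable fun t => h t * Real.exp (-H t) := by
    have := hHc.measurable; fun_prop
  have hfin : ∀ R : ℝ, 0 ≤ R → ∫⁻ t in Set.Ioc 0 R, .ofReal (h t * Real.exp (-H t)) =
      .ofReal (1 - Real.exp (-H R)) := by
    intro R hR
    have e := (hac R hR).integral_deriv_eq_sub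
    rw [intervalIntegral.integral_congr_ae (g := fun t => h t * Real.exp (-H t))
      (hderiv.mono fun x hx _ => hx), intervalIntegral.integral_of_le hR] at e
    rw [← ofReal_integral_eq_lintegral_ofReal, e]
    · simp [hφ, hH0]; ring_nf
    · have : IntegrableOn (fun _ : ℝ => (1 : ℝ)) (Set.Ioc 0 R) := by simp
      refine this.mono' hfm.aestronglyMeasurable ((ae_restrict_iff' measurableSet_Ioc).2
        (ae_of_all _ fun t ht => ?_))
      have := hHmono 0 t ht.1.le
      have e4 : Real.exp (-H t) ≤ 1 := by
        rw [Real.exp_le_one_iff]; linarith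
      rw [Real.norm_of_nonneg (mul_nonneg (h0 t) (Real.exp_pos _).le)]
      exact mul_le_one₀ (h1 t) (Real.exp_pos _).le e4
    · exact ae_of_all _ fun t => mul_nonneg (h0 t) (Real.exp_pos _).le
  -- Beyond `M` the primitive has slope 1, so the total mass 1 - exp(-H) tends to 1.
  have hHtop : Tendsto H atTop atTop := by
    set M' := max M 0
    refine tendsto_atTop_mono' atTop (f₁ := fun t => t - M') ?_
      (tendsto_atTop_add_const_right _ _ tendsto_id)
    filter_upwards [eventually_ge_atTop M'] with t ht
    have : H t - H M' = t - M' := by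
      rw [hHsub, intervalIntegral.integral_of_le ht,
        setIntegral_congr_fun measurableSet_Ioc (g := fun _ => (1 : ℝ))
          fun x hx => hM x ((le_max_left _ _).trans_lt hx.1)]
      simpa [M'] using ht
    have := hHmono 0 M' (le_max_right _ _)
    linarith
  have hcov : AECover (volume.restrict (Set.Ioi (0 : ℝ))) atTop fun R : ℝ => Set.Iic R :=
    aecover_Iic tendsto_id
  refine hcov.lintegral_eq_of_tendsto 1 hfm.ennreal_ofReal.aemeasurable ?_
  have hlim : Tendsto (fun R => ENNReal.ofReal (1 - Real.exp (-H R))) atTop (𝓝 1) := by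
    have : Tendsto (fun R => 1 - Real.exp (-H R)) atTop (𝓝 (1 - 0)) :=
      tendsto_const_nhds.sub (Real.tendsto_exp_neg_atTop_nhds_zero.comp hHtop)
    simpa using ENNReal.tendsto_ofReal this
  refine hlim.congr' ?_
  filter_upwards [eventually_ge_atTop 0] with R hR
  rw [← hfin R hR, Measure.restrict_restrict measurableSet_Iic, Set.Iic_inter_Ioi]

/-- `a` followed by the sequence `T`. -/
def seqCons (a : ℝ) (T : ℕ → ℝ) : ℕ → ℝ
  | 0 => a
  | j + 1 => T j

@[simp] lemma seqCons_zero (a : ℝ) (T : ℕ → ℝ) : seqCons a T 0 = a := rfl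
@[simp] lemma seqCons_succ (a : ℝ) (T : ℕ → ℝ) (j : ℕ) : seqCons a T (j + 1) = T j := rfl

lemma measurable_seqCons : Measurable fun p : ℝ × (ℕ → ℝ) => seqCons p.1 p.2 := by
  refine measurable_pi_lambda _ fun j => ?_
  cases j with
  | zero => exact measurable_fst
  | succ j => exact (measurable_pi_apply j).comp measurable_snd

/-- The sequence `T` delayed by `a`. -/
def delay (a : ℝ) (T : ℕ → ℝ) : ℕ → ℝ := fun j => a + T j

lemma measurable_delay : Measurable fun p : ℝ × (ℕ → ℝ) => delay p.1 p.2 :=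
  measurable_pi_lambda _ fun j => measurable_fst.add ((measurable_pi_apply j).comp measurable_snd)

lemma delay_delay (a b : ℝ) (T : ℕ → ℝ) : delay a (delay b T) = delay (a + b) T := by
  ext j; simp [delay, add_assoc]

/-- The law of the arrival times of a Poisson process of unit rate on the half-line. -/
structure IsUnitPoisson (μ : Measure (ℕ → ℝ)) : Prop where
  isProbabilityMeasure : IsProbabilityMeasure μ
  monotone : ∀ᵐ T ∂μ, Monotone T
  laplace : ∀ u : ℝ → ℝ≥0∞, Measurable u →
    ∫⁻ T, nexp (∑' j, u (T j)) ∂μ = nexp (∫⁻ t in Set.Ioi 0, (1 - nexp (u t)))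

lemma measurable_nexp_tsum {u : ℝ → ℝ≥0∞} (hu : Measurable u) :
    Measurable fun T : ℕ → ℝ => nexp (∑' j, u (T j)) :=
  measurable_nexp.comp (Measurable.tsum fun j => hu.comp (measurable_pi_apply j))

lemma measurableSet_monotone_seq : MeasurableSet {T : ℕ → ℝ | Monotone T} := by
  have : {T : ℕ → ℝ | Monotone T} = ⋂ n, {T | T n ≤ T (n + 1)} := by
    ext T
    simp only [Set.mem_ofPred_eq, Set.mem_iInter]
    exact ⟨fun h n => h n.le_succ, monotone_nat_of_le_succ⟩
  rw [this]
  exact MeasurableSet.iInter fun n =>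
    measurableSet_le (measurable_pi_apply n) (measurable_pi_apply (n + 1))

/-- The mapping theorem on the level of Laplace functionals: a test function of the time is a test
function of the position, and `map_const_mul_norm_sq` transports the intensity. -/
theorem IsPoissonProcess.isUnitPoisson {Ω : Type*} [MeasurableSpace Ω] {P : Measure Ω}
    [IsProbabilityMeasure P] {X : ℕ → Ω → Plane} {lam : ℝ} (hX : IsPoissonProcess X lam P)
    (hl : 0 < lam) (hord : ∀ᵐ ω ∂P, Monotone fun j => ‖X j ω‖) :
    IsUnitPoisson (P.map fun ω j => Real.pi * lam * ‖X j ω‖ ^ 2) := by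
  have hm : Measurable fun ω (j : ℕ) => Real.pi * lam * ‖X j ω‖ ^ 2 :=
    measurable_pi_lambda _ fun j => by have := hX.measurable j; fun_prop
  have hb : 0 < Real.pi * lam := by positivity
  refine ⟨Measure.isProbabilityMeasure_map hm.aemeasurable, ?_, fun u hu => ?_⟩
  · rw [ae_map_iff hm.aemeasurable measurableSet_monotone_seq]
    filter_upwards [hord] with ω hω i j hij
    have := hω hij
    dsimp only at this ⊢
    gcongr
  · rw [lintegral_map (measurable_nexp_tsum hu) hm]
    have hr : Measurable fun x : Plane => Real.pi * lam * ‖x‖ ^ 2 := by fun_prop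
    rw [hX.lintegral_nexp_tsum hl (u := fun x => u (Real.pi * lam * ‖x‖ ^ 2)) (hu.comp hr),
      ← map_const_mul_norm_sq volume_closedBall_plane hl,
      lintegral_map (f := fun t => 1 - nexp (u t)) (by fun_prop) hr, lintegral_smul_measure,
      smul_eq_mul]

/-- The exponential distribution of mean `1`. -/
noncomputable def expLaw : Measure ℝ :=
  (volume.restrict (Set.Ioi 0)).withDensity fun t => nexp (.ofReal t)

lemma lintegral_expLaw {f : ℝ → ℝ≥0∞} (hf : Measurable f) :
    ∫⁻ t, f t ∂expLaw = ∫⁻ t in Set.Ioi 0, nexp (.ofReal t) * f t := by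
  rw [expLaw, lintegral_withDensity_eq_lintegral_mul _ (by fun_prop) hf]; rfl

instance : IsProbabilityMeasure expLaw := by
  refine ⟨?_⟩
  rw [← lintegral_one, lintegral_expLaw measurable_const]
  refine Eq.trans ?_ (lintegral_hazard (h := fun _ => 1)
    measurable_const (by simp) (by simp) (M := 0) (by simp))
  refine setLIntegral_congr_fun measurableSet_Ioi fun t ht => ?_
  simp [nexp_ofReal (Set.mem_Ioi.1 ht).le]

namespace IsUnitPoisson

variable {μ : Measure (ℕ → ℝ)}

lemma laplace_delay (hμ : IsUnitPoisson μ) {u : ℝ → ℝ≥0∞} (hu : Measurable u) (a : ℝ) :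
    ∫⁻ T, nexp (∑' j, u (delay a T j)) ∂μ = nexp (∫⁻ t in Set.Ioi a, (1 - nexp (u t))) := by
  have := hμ.laplace (fun t => u (a + t)) (hu.comp (by fun_prop))
  rw [show (∫⁻ T, nexp (∑' j, u (delay a T j)) ∂μ) = _ from this]
  congr 1
  have h2 := (measurePreserving_add_left volume a).setLIntegral_comp_preimage (s := Set.Ioi a)
    measurableSet_Ioi (f := fun t => 1 - nexp (u t)) (by fun_prop)
  rw [← h2]
  simp

/-- Test with `u = ∞` on nonpositive times and 0 elsewhere: the Laplace functional equals 1, whereas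
a single nonpositive arrival would make the integrand 0. Time 0 is excluded as well. -/
lemma ae_pos (hμ : IsUnitPoisson μ) : ∀ᵐ T ∂μ, ∀ j, 0 < T j := by
  have := hμ.isProbabilityMeasure
  set u : ℝ → ℝ≥0∞ := (Set.Iic 0).indicator fun _ => ∞ with hu
  have hum : Measurable u := measurable_const.indicator measurableSet_Iic
  have h := hμ.laplace u hum
  have h0 : ∫⁻ t in Set.Ioi 0, (1 - nexp (u t)) = 0 := by
    rw [setLIntegral_congr_fun measurableSet_Ioi (g := fun _ => 0)]
    · simp
    · intro t ht
      have : t ∉ Set.Iic (0 : ℝ) := by simpa using ht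
      simp [hu, this, nexp_zero]
  rw [h0, nexp_zero] at h
  have h1 : ∫⁻ T, (1 - nexp (∑' j, u (T j))) ∂μ = 0 := by
    rw [lintegral_sub (measurable_nexp_tsum hum) (by simp [h]) (ae_of_all _ fun _ => nexp_le_one _),
      h]
    simp
  have hm1 : Measurable fun T : ℕ → ℝ => 1 - nexp (∑' j, u (T j)) :=
    measurable_const.sub (measurable_nexp_tsum hum)
  rw [lintegral_eq_zero_iff hm1] at h1
  filter_upwards [h1] with T hT j
  by_contra hj
  have hmem : T j ∈ Set.Iic (0 : ℝ) := not_lt.1 hj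
  have : ∑' j, u (T j) = ∞ := by
    refine top_unique (le_trans ?_ (ENNReal.le_tsum j))
    simp [hu, Set.indicator_of_mem hmem]
  simp [this, nexp_top] at hT

/-- The renewal property: the first arrival time is exponential, and the arrivals after it form
an independent copy of the whole process. -/
theorem renewal (hμ : IsUnitPoisson μ) :
    (expLaw.prod μ).map (fun p => seqCons p.1 (delay p.1 p.2)) = μ := by
  have := hμ.isProbabilityMeasure
  have hm : Measurable fun p : ℝ × (ℕ → ℝ) => seqCons p.1 (delay p.1 p.2) :=
    measurable_seqCons.comp (measurable_fst.prodMk measurable_delay)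
  have := Measure.isProbabilityMeasure_map (μ := expLaw.prod μ) hm.aemeasurable
  refine ext_of_lintegral_nexp_arrivals ?_ hμ.monotone fun n t c => ?_
  · rw [ae_map_iff hm.aemeasurable measurableSet_monotone_seq]
    filter_upwards [Measure.quasiMeasurePreserving_snd.ae hμ.monotone,
      Measure.quasiMeasurePreserving_snd.ae hμ.ae_pos] with p hp hp'
    refine monotone_nat_of_le_succ fun j => ?_
    cases j with
    | zero => simpa [delay] using (hp' 0).le
    | succ j => simpa [delay] using hp j.le_succ
  set u : ℝ → ℝ≥0∞ := fun x => ∑ i, c i * (Set.Iic (t i)).indicator 1 x with hu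
  have hum : Measurable u := Finset.measurable_sum _ fun i _ =>
    measurable_const.mul (measurable_one.indicator measurableSet_Iic)
  have hsum : ∀ T : ℕ → ℝ, ∑ i, c i * arrivals T (t i) = ∑' j, u (T j) := by
    intro T
    simp only [hu, arrivals]
    rw [Summable.tsum_finsetSum fun _ _ => ENNReal.summable]
    simp [ENNReal.tsum_mul_left]
  simp_rw [hsum]
  rw [hμ.laplace u hum, lintegral_map (measurable_nexp_tsum hum) hm,
    lintegral_prod (fun p : ℝ × (ℕ → ℝ) => nexp (∑' j, u (seqCons p.1 (delay p.1 p.2) j)))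
      ((measurable_nexp_tsum hum).comp hm).aemeasurable]
  have hin : ∀ x : ℝ, ∫⁻ T, nexp (∑' j, u (seqCons x (delay x T) j)) ∂μ =
      nexp (u x) * nexp (∫⁻ t in Set.Ioi x, (1 - nexp (u t))) := by
    intro x
    have e : ∀ T, nexp (∑' j, u (seqCons x (delay x T) j)) =
        nexp (u x) * nexp (∑' j, u (delay x T j)) := fun T => by
      rw [tsum_eq_zero_add' ENNReal.summable, nexp_add]; rfl
    rw [lintegral_congr e, lintegral_const_mul, hμ.laplace_delay hum]
    exact (measurable_nexp_tsum hum).comp (measurable_delay.comp measurable_prodMk_left)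
  simp_rw [hin]
  set Λ : ℝ → ℝ≥0∞ := fun x => ∫⁻ t in Set.Ioi x, (1 - nexp (u t)) with hΛ
  have hΛm : Measurable Λ :=
    Antitone.measurable fun x y hxy => lintegral_mono_set (Set.Ioi_subset_Ioi hxy)
  change ∫⁻ x, nexp (u x) * nexp (Λ x) ∂expLaw = nexp (Λ 0)
  rw [lintegral_expLaw (by fun_prop)]
  -- exp(-u) acts as a hazard rate. It equals 1 beyond all thresholds `t i`, where `u` vanishes.
  set h : ℝ → ℝ := fun x => (nexp (u x)).toReal with hh
  have hhm : Measurable h := by fun_prop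
  have hh0 : ∀ x, 0 ≤ h x := fun x => ENNReal.toReal_nonneg
  have hh1 : ∀ x, h x ≤ 1 := fun x => by
    simpa using ENNReal.toReal_mono ENNReal.one_ne_top (nexp_le_one (u x))
  have hhu : ∀ x, ENNReal.ofReal (h x) = nexp (u x) := fun x => ENNReal.ofReal_toReal (nexp_ne_top _)
  have hM : ∀ x, ∑ i, |t i| < x → h x = 1 := by
    intro x hx
    have : u x = 0 := by
      refine Finset.sum_eq_zero fun i _ => ?_
      have : x ∉ Set.Iic (t i) := by
        rw [Set.mem_Iic, not_le]
        refine lt_of_le_of_lt ((le_abs_self _).trans ?_) hx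
        exact Finset.single_le_sum (f := fun i => |t i|) (fun _ _ => abs_nonneg _)
          (Finset.mem_univ i)
      simp [Set.indicator_of_notMem this]
    simp [hh, this, nexp_zero]
  -- Both x and Λ(0) - Λ(x) contain the integral of 1 - h over (0, x], and the remainder of x is the
  -- integral of h. Hence x + Λ(x) = Λ(0) + ∫₀ˣ h, and the integrand is a constant times the
  -- probability density of `lintegral_hazard`.
  have hkey : ∀ x ∈ Set.Ioi (0 : ℝ), nexp (.ofReal x) * (nexp (u x) * nexp (Λ x)) =
      nexp (Λ 0) * .ofReal (h x * Real.exp (-∫ y in (0 : ℝ)..x, h y)) := by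
    intro x hx
    have hx0 : (0 : ℝ) ≤ x := (Set.mem_Ioi.1 hx).le
    have e1 : Λ 0 = (∫⁻ t in Set.Ioc 0 x, (1 - nexp (u t))) + Λ x := by
      rw [hΛ, ← lintegral_union measurableSet_Ioi (Set.Ioc_disjoint_Ioi le_rfl),
        Set.Ioc_union_Ioi_eq_Ioi hx0]
    have e2 : ENNReal.ofReal (∫ y in (0 : ℝ)..x, h y) = ∫⁻ t in Set.Ioc 0 x, nexp (u t) := by
      rw [intervalIntegral.integral_of_le hx0, ofReal_integral_eq_lintegral_ofReal
        _ (ae_of_all _ hh0)]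
      · simp_rw [hhu]
      · have : IntegrableOn (fun _ : ℝ => (1 : ℝ)) (Set.Ioc 0 x) := by simp
        exact this.mono' hhm.aestronglyMeasurable
          (ae_of_all _ fun y => by simpa [abs_of_nonneg (hh0 y)] using hh1 y)
    have e3 : ENNReal.ofReal x = (∫⁻ t in Set.Ioc 0 x, (1 - nexp (u t))) +
        ∫⁻ t in Set.Ioc 0 x, nexp (u t) := by
      rw [← lintegral_add_right (fun t => 1 - nexp (u t)) (g := fun t => nexp (u t)) (by fun_prop)]
      simp [tsub_add_cancel_of_le (nexp_le_one _)]
    have e4 : 0 ≤ ∫ y in (0 : ℝ)..x, h y := intervalIntegral.integral_nonneg hx0 fun y _ => hh0 y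
    rw [ENNReal.ofReal_mul (hh0 x), hhu, ← nexp_ofReal e4, e2, e1, e3, nexp_add, nexp_add]
    ring
  rw [setLIntegral_congr_fun measurableSet_Ioi hkey, lintegral_const_mul _ ?_,
    lintegral_hazard hhm hh0 hh1 hM, mul_one]
  have hc : Continuous fun x => ∫ y in (0 : ℝ)..x, h y :=
    intervalIntegral.continuous_primitive (fun a b =>
      (intervalIntegrable_const (c := (1 : ℝ))).mono_fun hhm.aestronglyMeasurable
        (ae_of_all _ fun x => by simpa [abs_of_nonneg (hh0 x)] using hh1 x)) 0
  have := hc.measurable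
  fun_prop

end IsUnitPoisson

/-! ### Consequences of renewal: delays, the first `k` radii, positive association -/

/-- The finite sequence `r` followed by the sequence `T`. -/
def seqPrepend {k : ℕ} (r : Fin k → ℝ) (T : ℕ → ℝ) (j : ℕ) : ℝ :=
  if h : j < k then r ⟨j, h⟩ else T (j - k)

lemma seqPrepend_of_lt {k : ℕ} (r : Fin k → ℝ) (T : ℕ → ℝ) {j : ℕ} (h : j < k) :
    seqPrepend r T j = r ⟨j, h⟩ := dif_pos h

lemma seqPrepend_add {k : ℕ} (r : Fin k → ℝ) (T : ℕ → ℝ) (j : ℕ) :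
    seqPrepend r T (j + k) = T j := by simp [seqPrepend]

lemma seqPrepend_zero (r : Fin 0 → ℝ) (T : ℕ → ℝ) : seqPrepend r T = T := by
  ext j; simp [seqPrepend]

lemma seqPrepend_cons {k : ℕ} (x : ℝ) (r : Fin k → ℝ) (T : ℕ → ℝ) :
    seqPrepend (Fin.cons x r : Fin (k + 1) → ℝ) T = seqCons x (seqPrepend r T) := by
  ext j
  cases j with
  | zero => simp [seqPrepend]
  | succ j =>
    simp only [seqPrepend, seqCons_succ, Nat.add_lt_add_iff_right, Nat.add_sub_add_right]
    rfl

lemma measurable_seqPrepend {k : ℕ} :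
    Measurable fun p : (Fin k → ℝ) × (ℕ → ℝ) => seqPrepend p.1 p.2 := by
  refine measurable_pi_lambda _ fun j => ?_
  by_cases h : j < k
  · simp only [seqPrepend, h, dite_true]
    exact (measurable_pi_apply _).comp measurable_fst
  · simp only [seqPrepend, h, dite_false]
    exact (measurable_pi_apply _).comp measurable_snd

lemma delay_seqCons (a t : ℝ) (T : ℕ → ℝ) : delay a (seqCons t T) = seqCons (a + t) (delay a T) := by
  ext j; cases j <;> rfl

/-- Chebyshev's association inequality. -/
lemma lintegral_mul_lintegral_le_of_monotone {ρ : Measure ℝ} [IsProbabilityMeasure ρ]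
    {f g : ℝ → ℝ≥0∞} (hf : Monotone f) (hg : Monotone g) :
    (∫⁻ x, f x ∂ρ) * ∫⁻ x, g x ∂ρ ≤ ∫⁻ x, f x * g x ∂ρ := by
  have hfm := hf.measurable
  have hgm := hg.measurable
  -- This is (f x - f y)(g x - g y) ≥ 0 without subtraction; integrating it over two independent
  -- copies gives the inequality.
  have hle : ∀ x y, x ≤ y → f x * g y + f y * g x ≤ f x * g x + f y * g y := by
    intro x y hxy
    obtain ⟨c, hc⟩ := exists_add_of_le (hf hxy)
    obtain ⟨d, hd⟩ := exists_add_of_le (hg hxy)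
    rw [hc, hd]
    calc f x * (g x + d) + (f x + c) * g x = f x * g x + (f x + c) * g x + f x * d := by ring
      _ ≤ f x * g x + (f x + c) * g x + (f x + c) * d := by gcongr; exact le_self_add
      _ = f x * g x + (f x + c) * (g x + d) := by ring
  have hle' : ∀ x y, f x * g y + f y * g x ≤ f x * g x + f y * g y := by
    intro x y
    rcases le_total x y with h | h
    · exact hle x y h
    · rw [add_comm, add_comm (f x * g x)]; exact hle y x h
  have h1 : ∫⁻ x, ∫⁻ y, (f x * g y + f y * g x) ∂ρ ∂ρ =
      2 * ((∫⁻ x, f x ∂ρ) * ∫⁻ x, g x ∂ρ) := by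
    have : ∀ x, ∫⁻ y, (f x * g y + f y * g x) ∂ρ =
        f x * (∫⁻ y, g y ∂ρ) + (∫⁻ y, f y ∂ρ) * g x := fun x => by
      rw [lintegral_add_left (by fun_prop), lintegral_const_mul _ hgm, lintegral_mul_const _ hfm]
    simp_rw [this]
    rw [lintegral_add_left (by fun_prop), lintegral_mul_const _ hfm, lintegral_const_mul _ hgm,
      two_mul]
  have h2 : ∫⁻ x, ∫⁻ y, (f x * g x + f y * g y) ∂ρ ∂ρ = 2 * ∫⁻ x, f x * g x ∂ρ := by
    have : ∀ x, ∫⁻ y, (f x * g x + f y * g y) ∂ρ = f x * g x + ∫⁻ y, f y * g y ∂ρ := fun x => by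
      rw [lintegral_add_left (by fun_prop), lintegral_const, measure_univ, mul_one]
    simp_rw [this]
    rw [lintegral_add_left (by fun_prop), lintegral_const, measure_univ, mul_one, two_mul]
  have h3 := lintegral_mono (μ := ρ) fun x => lintegral_mono (μ := ρ) fun y => hle' x y
  rw [h1, h2] at h3
  exact (ENNReal.mul_le_mul_iff_right (by simp) (by simp)).1 h3

lemma lintegral_Ioi_mul_sq {b a : ℝ} (hb : 0 < b) (ha : 0 ≤ a) (f : ℝ → ℝ≥0∞) :
    ∫⁻ t in Set.Ioi (b * a ^ 2), f t =
      ∫⁻ r in Set.Ioi a, .ofReal (2 * b * r) * f (b * r ^ 2) := by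
  have himg : (fun r : ℝ => b * r ^ 2) '' Set.Ioi a = Set.Ioi (b * a ^ 2) := by
    ext t
    simp only [Set.mem_image, Set.mem_Ioi]
    constructor
    · rintro ⟨r, hr, rfl⟩
      gcongr
    · intro ht
      have h1 : a ^ 2 < t / b := by rw [lt_div_iff₀ hb]; linarith
      refine ⟨√(t / b), Real.lt_sqrt_of_sq_lt h1, ?_⟩
      rw [Real.sq_sqrt ((sq_nonneg a).trans h1.le)]
      field_simp
  rw [← himg, lintegral_image_eq_lintegral_deriv_mul_of_monotoneOn measurableSet_Ioi
    (f' := fun r => 2 * b * r)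
    (fun r _ => by
      have : HasDerivAt (fun r : ℝ => b * r ^ 2) (b * (2 * r)) r := by
        simpa using (hasDerivAt_pow 2 r).const_mul b
      rw [show 2 * b * r = b * (2 * r) by ring]
      exact this.hasDerivWithinAt)
    (fun x hx y hy hxy => by
      have : 0 ≤ x := ha.trans (Set.mem_Ioi.1 hx).le
      gcongr)]

namespace IsUnitPoisson

variable {μ : Measure (ℕ → ℝ)} {Ψ : (ℕ → ℝ) → ℝ≥0∞}

lemma measurable_lintegral_seqCons (hμ : IsUnitPoisson μ) (hΨ : Measurable Ψ) :
    Measurable fun t => ∫⁻ T, Ψ (seqCons t (delay t T)) ∂μ := by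
  have := hμ.isProbabilityMeasure
  exact Measurable.lintegral_prod_right'
    (f := fun p : ℝ × (ℕ → ℝ) => Ψ (seqCons p.1 (delay p.1 p.2)))
    (hΨ.comp (measurable_seqCons.comp (measurable_fst.prodMk measurable_delay)))

lemma lintegral_delay_expLaw (hμ : IsUnitPoisson μ) (hΨ : Measurable Ψ) (a : ℝ) :
    ∫⁻ T, Ψ (delay a T) ∂μ =
      ∫⁻ t, ∫⁻ T, Ψ (seqCons (a + t) (delay (a + t) T)) ∂μ ∂expLaw := by
  have := hμ.isProbabilityMeasure
  have hm : Measurable fun p : ℝ × (ℕ → ℝ) => seqCons p.1 (delay p.1 p.2) :=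
    measurable_seqCons.comp (measurable_fst.prodMk measurable_delay)
  have hΨa : Measurable fun T => Ψ (delay a T) :=
    hΨ.comp (measurable_delay.comp measurable_prodMk_left)
  conv_lhs => rw [← hμ.renewal]
  rw [lintegral_map hΨa hm, lintegral_prod
    (fun p : ℝ × (ℕ → ℝ) => Ψ (delay a (seqCons p.1 (delay p.1 p.2)))) (hΨa.comp hm).aemeasurable]
  simp_rw [delay_seqCons, delay_delay]

lemma lintegral_delay (hμ : IsUnitPoisson μ) (hΨ : Measurable Ψ) (a : ℝ) :
    ∫⁻ T, Ψ (delay a T) ∂μ = ∫⁻ t in Set.Ioi a, nexp (.ofReal (t - a)) *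
      ∫⁻ T, Ψ (seqCons t (delay t T)) ∂μ := by
  have hm := hμ.measurable_lintegral_seqCons hΨ
  rw [hμ.lintegral_delay_expLaw hΨ, lintegral_expLaw
    (f := fun t => ∫⁻ T, Ψ (seqCons (a + t) (delay (a + t) T)) ∂μ) (hm.comp (by fun_prop))]
  have h2 := (measurePreserving_add_left volume a).setLIntegral_comp_preimage (s := Set.Ioi a)
    measurableSet_Ioi (f := fun t => nexp (.ofReal (t - a)) *
      ∫⁻ T, Ψ (seqCons t (delay t T)) ∂μ) (by fun_prop)
  rw [← h2]
  simp

lemma lintegral_eq_lintegral_Ioi (hμ : IsUnitPoisson μ) (hΨ : Measurable Ψ) :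
    ∫⁻ T, Ψ T ∂μ = ∫⁻ t in Set.Ioi 0, nexp (.ofReal t) *
      ∫⁻ T, Ψ (seqCons t (delay t T)) ∂μ := by
  have := hμ.lintegral_delay hΨ 0
  have hd : ∀ T, delay 0 T = T := fun T => by ext; simp [delay]
  simpa only [hd, sub_zero] using this

/-- Conditioning on no arrival before `a` delays the process by `a`. -/
lemma setLIntegral_lt (hμ : IsUnitPoisson μ) (hΨ : Measurable Ψ) {a : ℝ} (ha : 0 ≤ a) :
    ∫⁻ T in {T | a < T 0}, Ψ T ∂μ = nexp (.ofReal a) * ∫⁻ T, Ψ (delay a T) ∂μ := by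
  have hS : MeasurableSet {T : ℕ → ℝ | a < T 0} :=
    measurableSet_lt measurable_const (measurable_pi_apply 0)
  have hm := hμ.measurable_lintegral_seqCons hΨ
  rw [← lintegral_indicator hS, hμ.lintegral_eq_lintegral_Ioi (hΨ.indicator hS),
    hμ.lintegral_delay hΨ, ← lintegral_const_mul _ (by fun_prop)]
  have h1 : ∀ t, ∫⁻ T, ({T : ℕ → ℝ | a < T 0}.indicator Ψ) (seqCons t (delay t T)) ∂μ =
      (Set.Ioi a).indicator (fun t => ∫⁻ T, Ψ (seqCons t (delay t T)) ∂μ) t := by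
    intro t
    by_cases h : a < t
    · simp [Set.indicator, h]
    · simp [Set.indicator, h]
  simp_rw [h1]
  have h2 : ∀ t, nexp (.ofReal t) *
      (Set.Ioi a).indicator (fun t => ∫⁻ T, Ψ (seqCons t (delay t T)) ∂μ) t =
      (Set.Ioi a).indicator (fun t => nexp (.ofReal t) *
        ∫⁻ T, Ψ (seqCons t (delay t T)) ∂μ) t := by
    intro t; by_cases h : a < t <;> simp [Set.indicator, h]
  simp_rw [h2]
  rw [lintegral_indicator measurableSet_Ioi, Measure.restrict_restrict measurableSet_Ioi,
    Set.inter_eq_left.2 (Set.Ioi_subset_Ioi ha)]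
  refine setLIntegral_congr_fun measurableSet_Ioi fun t ht => ?_
  have : ENNReal.ofReal t = .ofReal a + .ofReal (t - a) := by
    rw [← ENNReal.ofReal_add ha (sub_nonneg.2 (Set.mem_Ioi.1 ht).le)]; simp
  rw [this, nexp_add, mul_assoc]

lemma measure_lt (hμ : IsUnitPoisson μ) {a : ℝ} (ha : 0 ≤ a) :
    μ {T | a < T 0} = nexp (.ofReal a) := by
  have := hμ.isProbabilityMeasure
  simpa using hμ.setLIntegral_lt (Ψ := fun _ => 1) measurable_const ha

/-- Increasing functions of the arrival times are positively correlated, if one of them depends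
on finitely many of these times. -/
theorem lintegral_mul_lintegral_le (hμ : IsUnitPoisson μ) (k : ℕ) {A B : (ℕ → ℝ) → ℝ≥0∞}
    (hA : Measurable A) (hB : Measurable B) (hAm : Monotone A) (hBm : Monotone B)
    (hAk : ∀ T T', (∀ j < k, T j = T' j) → A T = A T') (a : ℝ) :
    (∫⁻ T, A (delay a T) ∂μ) * ∫⁻ T, B (delay a T) ∂μ ≤
      ∫⁻ T, A (delay a T) * B (delay a T) ∂μ := by
  have := hμ.isProbabilityMeasure
  have hcons : ∀ t, Measurable (seqCons t) := fun t =>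
    measurable_seqCons.comp measurable_prodMk_left
  have hdel : ∀ t, Measurable (delay t) := fun t => measurable_delay.comp measurable_prodMk_left
  have hcons_mono : ∀ {s t : ℝ} {T T' : ℕ → ℝ}, s ≤ t → T ≤ T' → seqCons s T ≤ seqCons t T' := by
    intro s t T T' hst hT j
    cases j with
    | zero => exact hst
    | succ j => exact hT j
  -- Condition on the first arrival `t`. Given `t`, the induction hypothesis applies to the rest,
  -- delayed by `a + t`, since `A` now depends on one time fewer. The conditional expectations
  -- increase with `t`, so Chebyshev's inequality for one variable finishes. For `k = 0` the
  -- function `A` is constant.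
  induction k generalizing A B a with
  | zero =>
    have hc : ∀ T, A T = A 0 := fun T => hAk _ _ (by simp)
    simp_rw [hc]
    rw [lintegral_const_mul (A 0) (f := fun T => B (delay a T)) (hB.comp (hdel a))]
    simp
  | succ k ih =>
    rw [hμ.lintegral_delay_expLaw hA, hμ.lintegral_delay_expLaw hB,
      hμ.lintegral_delay_expLaw (Ψ := fun T => A T * B T) (hA.mul hB)]
    have hmono : ∀ {C : (ℕ → ℝ) → ℝ≥0∞}, Monotone C →
        Monotone fun t => ∫⁻ T, C (seqCons (a + t) (delay (a + t) T)) ∂μ := by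
      intro C hC s t hst
      refine lintegral_mono fun T => hC (hcons_mono (by linarith) fun j => ?_)
      simp only [delay]; linarith
    refine (lintegral_mul_lintegral_le_of_monotone (hmono hAm) (hmono hBm)).trans
      (lintegral_mono fun t => ?_)
    refine ih (A := fun T => A (seqCons (a + t) T)) (B := fun T => B (seqCons (a + t) T))
      (hA.comp (hcons _)) (hB.comp (hcons _)) (fun T T' h => hAm (hcons_mono le_rfl h))
      (fun T T' h => hBm (hcons_mono le_rfl h)) (fun T T' h => hAk _ _ fun j hj => ?_) (a + t)
    cases j with
    | zero => rfl
    | succ j => exact h j (by omega)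

/-- One renewal step, in terms of the radius `r` with `b * r ^ 2 = t`. -/
lemma lintegral_delay_radius (hμ : IsUnitPoisson μ) (hΨ : Measurable Ψ) {b a : ℝ} (hb : 0 < b)
    (ha : 0 ≤ a) :
    ∫⁻ T, Ψ (delay (b * a ^ 2) T) ∂μ = ∫⁻ r in Set.Ioi a, .ofReal (2 * b * r) *
      (nexp (.ofReal (b * (r ^ 2 - a ^ 2))) *
        ∫⁻ T, Ψ (seqCons (b * r ^ 2) (delay (b * r ^ 2) T)) ∂μ) := by
  rw [hμ.lintegral_delay hΨ, lintegral_Ioi_mul_sq hb ha]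
  simp_rw [mul_sub]

/-- The joint law of the first `k` arrivals, expressed by radii, and of the arrivals after them. -/
theorem lintegral_delay_radii (hμ : IsUnitPoisson μ) {b : ℝ} (hb : 0 < b) (k : ℕ)
    (hΨ : Measurable Ψ) {a : ℝ} (ha : 0 ≤ a) :
    ∫⁻ T, Ψ (delay (b * a ^ 2) T) ∂μ = ∫⁻ r : Fin k → ℝ,
      {r : Fin k → ℝ | StrictMono (Fin.cons a r : Fin (k + 1) → ℝ)}.indicator (fun r =>
        (∏ j, .ofReal (2 * b * r j)) *
        (nexp (.ofReal (b * ((Fin.cons a r : Fin (k + 1) → ℝ) (Fin.last k) ^ 2 - a ^ 2))) *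
        ∫⁻ T, Ψ (seqPrepend (fun j => b * r j ^ 2)
          (delay (b * (Fin.cons a r : Fin (k + 1) → ℝ) (Fin.last k) ^ 2) T)) ∂μ)) r := by
  have := hμ.isProbabilityMeasure
  have hconsm : ∀ {n : ℕ} (a : ℝ), Measurable fun r : Fin n → ℝ => (Fin.cons a r : Fin (n + 1) → ℝ) :=
    fun {n} a => measurable_pi_lambda _ fun j => by
      refine Fin.cases ?_ (fun i => ?_) j
      · exact measurable_const
      · exact measurable_pi_apply i
  induction k generalizing Ψ a with
  | zero =>
    have : ∀ r : Fin 0 → ℝ, StrictMono (Fin.cons a r : Fin 1 → ℝ) := fun r i j hij => by omega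
    simp [this, seqPrepend_zero, nexp_zero, volume_pi, Measure.pi_empty_univ]
  | succ k ih =>
    rw [hμ.lintegral_delay_radius hΨ hb ha]
    -- The first radius is split off, to be matched with the single renewal step; the induction
    -- hypothesis then starts from this radius instead of `a`.
    rw [← (volume_preserving_piFinSuccAbove (fun _ : Fin (k + 1) => ℝ) 0).symm.lintegral_comp_emb
      (MeasurableEquiv.measurableEmbedding _)]
    let S : Set (Fin (k + 1) → ℝ) := {r | StrictMono (Fin.cons a r : Fin (k + 2) → ℝ)}
    let G₀ : (Fin (k + 1) → ℝ) → ℝ≥0∞ := fun r =>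
      (∏ j, .ofReal (2 * b * r j)) *
        (nexp (.ofReal (b * ((Fin.cons a r : Fin (k + 2) → ℝ) (Fin.last (k + 1)) ^ 2 - a ^ 2))) *
        ∫⁻ T, Ψ (seqPrepend (fun j => b * r j ^ 2)
          (delay (b * (Fin.cons a r : Fin (k + 2) → ℝ) (Fin.last (k + 1)) ^ 2) T)) ∂μ)
    have hG : Measurable (S.indicator G₀) := by
      have hl : Measurable fun r : Fin (k + 1) → ℝ =>
          (Fin.cons a r : Fin (k + 2) → ℝ) (Fin.last (k + 1)) :=
        (measurable_pi_apply (Fin.last (k + 1))).comp (hconsm a)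
      have hsq : Measurable fun (r : Fin (k + 1) → ℝ) (j : Fin (k + 1)) => b * r j ^ 2 :=
        measurable_pi_lambda _ fun j => by fun_prop
      have hi : Measurable fun r : Fin (k + 1) → ℝ => ∫⁻ T, Ψ (seqPrepend (fun j => b * r j ^ 2)
          (delay (b * (Fin.cons a r : Fin (k + 2) → ℝ) (Fin.last (k + 1)) ^ 2) T)) ∂μ := by
        refine Measurable.lintegral_prod_right' (f := fun p : (Fin (k + 1) → ℝ) × (ℕ → ℝ) =>
          Ψ (seqPrepend (fun j => b * p.1 j ^ 2)
          (delay (b * (Fin.cons a p.1 : Fin (k + 2) → ℝ) (Fin.last (k + 1)) ^ 2) p.2))) ?_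
        refine hΨ.comp (measurable_seqPrepend.comp (Measurable.prodMk (hsq.comp measurable_fst)
          (measurable_delay.comp (Measurable.prodMk ?_ measurable_snd))))
        exact (hl.comp measurable_fst).pow_const 2 |>.const_mul b
      have hp : Measurable fun r : Fin (k + 1) → ℝ => ∏ j, ENNReal.ofReal (2 * b * r j) :=
        Finset.measurable_prod _ fun j _ => by fun_prop
      have hn : Measurable fun r : Fin (k + 1) → ℝ => nexp (.ofReal (b *
          ((Fin.cons a r : Fin (k + 2) → ℝ) (Fin.last (k + 1)) ^ 2 - a ^ 2))) :=
        measurable_nexp.comp (((hl.pow_const 2).sub_const _).const_mul b).ennreal_ofReal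
      refine Measurable.indicator (hp.mul (hn.mul hi)) ?_
      simp only [S]
      simp only [Fin.strictMono_iff_lt_succ, Set.ofPred_forall]
      exact MeasurableSet.iInter fun i => measurableSet_lt
        ((measurable_pi_apply _).comp (hconsm a)) ((measurable_pi_apply _).comp (hconsm a))
    change _ = ∫⁻ p, S.indicator G₀ ((MeasurableEquiv.piFinSuccAbove
      (fun _ : Fin (k + 1) => ℝ) 0).symm p) ∂(volume.prod volume)
    rw [lintegral_prod (fun p => S.indicator G₀ ((MeasurableEquiv.piFinSuccAbove
      (fun _ : Fin (k + 1) => ℝ) 0).symm p)) (hG.comp (MeasurableEquiv.measurable _)).aemeasurable,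
      ← lintegral_indicator measurableSet_Ioi]
    refine lintegral_congr fun x => ?_
    have hsymm : ∀ y : Fin k → ℝ, (MeasurableEquiv.piFinSuccAbove (fun _ : Fin (k + 1) => ℝ) 0).symm
        (x, y) = Fin.cons x y := fun y => Fin.insertNth_zero' x y
    simp only [hsymm]
    have hsm : ∀ y : Fin k → ℝ, StrictMono (Fin.cons a (Fin.cons x y : Fin (k + 1) → ℝ) :
        Fin (k + 2) → ℝ) ↔ a < x ∧ StrictMono (Fin.cons x y : Fin (k + 1) → ℝ) := by
      intro y
      rw [Fin.strictMono_cons]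
      refine ⟨fun h => ⟨h.1 0, h.2⟩, fun h => ⟨fun i => h.1.trans_le ?_, h.2⟩⟩
      exact h.2.monotone (Fin.zero_le i)
    by_cases hx : a < x
    · have hx0 : 0 ≤ x := ha.trans hx.le
      rw [Set.indicator_of_mem (Set.mem_Ioi.2 hx),
        ih (Ψ := fun T => Ψ (seqCons (b * x ^ 2) T))
          (hΨ.comp (measurable_seqCons.comp measurable_prodMk_left)) hx0, ← mul_assoc,
        ← lintegral_const_mul']
      · refine lintegral_congr fun y => ?_
        by_cases hy : StrictMono (Fin.cons x y : Fin (k + 1) → ℝ)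
        · rw [Set.indicator_of_mem hy, Set.indicator_of_mem (show _ ∈ S from (hsm y).2 ⟨hx, hy⟩)]
          simp only [G₀]
          rw [Fin.prod_univ_succ]
          have hlast : (Fin.cons a (Fin.cons x y : Fin (k + 1) → ℝ) : Fin (k + 2) → ℝ)
              (Fin.last (k + 1)) = (Fin.cons x y : Fin (k + 1) → ℝ) (Fin.last k) := by
            rw [← Fin.succ_last, Fin.cons_succ]
          set l := (Fin.cons x y : Fin (k + 1) → ℝ) (Fin.last k) with hl
          have hxl : x ≤ l := hy.monotone (Fin.zero_le (Fin.last k))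
          have hfun : (fun j => b * (Fin.cons x y : Fin (k + 1) → ℝ) j ^ 2) =
              Fin.cons (b * x ^ 2) fun j => b * y j ^ 2 := by
            ext j; refine Fin.cases ?_ (fun i => ?_) j <;> simp
          -- The exponents of successive gaps telescope, so only the last radius survives in the
          -- density.
          have hadd : ENNReal.ofReal (b * (l ^ 2 - a ^ 2)) =
              .ofReal (b * (x ^ 2 - a ^ 2)) + .ofReal (b * (l ^ 2 - x ^ 2)) := by
            rw [← ENNReal.ofReal_add]
            · congr 1; ring
            · have : a ^ 2 ≤ x ^ 2 := by gcongr
              exact mul_nonneg hb.le (sub_nonneg.2 this)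
            · have : x ^ 2 ≤ l ^ 2 := by gcongr
              exact mul_nonneg hb.le (sub_nonneg.2 this)
          rw [hlast, hadd, nexp_add, hfun]
          simp only [seqPrepend_cons, Fin.cons_zero, Fin.cons_succ]
          ring
        · rw [Set.indicator_of_notMem hy, Set.indicator_of_notMem fun h => hy ((hsm y).1 h).2,
            mul_zero]
      · exact ENNReal.mul_ne_top ENNReal.ofReal_ne_top (nexp_ne_top _)
    · rw [Set.indicator_of_notMem (by simpa using hx), eq_comm, lintegral_eq_zero_of_ae_eq_zero]
      exact ae_of_all _ fun y => Set.indicator_of_notMem (fun h => hx ((hsm y).1 h).1) _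

end IsUnitPoisson

/-! ### Rayleigh fading and coverage for fixed positions -/

/-- The Gaussian density is π⁻¹ exp(-‖z‖²), and Lebesgue measure with density 1/π is mapped by ‖z‖²
to Lebesgue measure on the positive half-line (`map_const_mul_norm_sq` with `lam = 1/π`). -/
lemma lintegral_complexGaussian_norm_sq {f : ℝ → ℝ≥0∞} (hf : Measurable f) :
    ∫⁻ z, f (‖z‖ ^ 2) ∂complexGaussian = ∫⁻ t, f t ∂expLaw := by
  have hm : Measurable fun p : ℝ × ℝ => (p.1 : ℂ) + (p.2 : ℂ) * Complex.I := by fun_prop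
  have hfm : Measurable fun z : ℂ => f (‖z‖ ^ 2) := by fun_prop
  have hv : (1 / 2 : ℝ≥0) ≠ 0 := by simp
  have hpm : Measurable fun p : ℝ × ℝ => gaussianPDF 0 (1 / 2) p.1 * gaussianPDF 0 (1 / 2) p.2 :=
    ((measurable_gaussianPDF _ _).comp measurable_fst).mul
      ((measurable_gaussianPDF _ _).comp measurable_snd)
  have hpdf : ∀ z : ℂ, gaussianPDF 0 (1 / 2) z.re * gaussianPDF 0 (1 / 2) z.im =
      .ofReal (1 / Real.pi) * nexp (.ofReal (Real.pi * (1 / Real.pi) * ‖z‖ ^ 2)) := by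
    intro z
    have hpi : Real.pi * (1 / Real.pi) = 1 := by field_simp
    rw [hpi, one_mul, nexp_ofReal (sq_nonneg _), gaussianPDF, gaussianPDF,
      ← ENNReal.ofReal_mul (gaussianPDFReal_nonneg _ _ _), ← ENNReal.ofReal_mul (by positivity)]
    congr 1
    have h2 : (2 * Real.pi * ((1 / 2 : ℝ≥0) : ℝ)) = Real.pi := by push_cast; ring
    have h3 : (2 * ((1 / 2 : ℝ≥0) : ℝ)) = 1 := by push_cast; ring
    rw [gaussianPDFReal, gaussianPDFReal, h2, h3, mul_mul_mul_comm, ← Real.exp_add,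
      ← mul_inv, Real.mul_self_sqrt Real.pi_pos.le, ← Complex.normSq_eq_norm_sq,
      Complex.normSq_apply]
    congr 2
    · simp
    · ring
  rw [complexGaussian, lintegral_map hfm hm, gaussianReal_of_var_ne_zero _ hv,
    prod_withDensity (measurable_gaussianPDF _ _) (measurable_gaussianPDF _ _),
    ← Measure.volume_eq_prod, lintegral_withDensity_eq_lintegral_mul _ hpm
      (g := fun p : ℝ × ℝ => f (‖(p.1 : ℂ) + (p.2 : ℂ) * Complex.I‖ ^ 2)) (hfm.comp hm),
    ← Complex.volume_preserving_equiv_real_prod.lintegral_comp_emb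
      (MeasurableEquiv.measurableEmbedding _)]
  have e : ∀ z : ℂ, ((fun p : ℝ × ℝ => gaussianPDF 0 (1 / 2) p.1 * gaussianPDF 0 (1 / 2) p.2) *
      ((fun z : ℂ => f (‖z‖ ^ 2)) ∘ fun p : ℝ × ℝ => (p.1 : ℂ) + (p.2 : ℂ) * Complex.I))
        (Complex.measurableEquivRealProd z) = .ofReal (1 / Real.pi) *
      (fun t => nexp (.ofReal t) * f t) (Real.pi * (1 / Real.pi) * ‖z‖ ^ 2) := by
    intro z
    have hpi : Real.pi * (1 / Real.pi) = 1 := by field_simp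
    simp only [Pi.mul_apply, Function.comp_apply, Complex.measurableEquivRealProd_apply,
      Complex.re_add_im]
    rw [hpdf, mul_assoc, hpi, one_mul]
  refine (lintegral_congr e).trans ?_
  rw [lintegral_expLaw hf, ← map_const_mul_norm_sq volume_closedBall_complex
    (show 0 < 1 / Real.pi by positivity), lintegral_map (by fun_prop) (by fun_prop),
    lintegral_smul_measure, lintegral_const_mul _ (by fun_prop), smul_eq_mul]

instance : IsProbabilityMeasure complexGaussian :=
  Measure.isProbabilityMeasure_map (by fun_prop)

lemma charFun_complexGaussian (t : ℂ) :
    charFun complexGaussian t = Complex.exp (-(‖t‖ ^ 2 / 4 : ℝ)) := by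
  have hm : Measurable fun p : ℝ × ℝ => (p.1 : ℂ) + (p.2 : ℂ) * Complex.I := by fun_prop
  rw [charFun_apply, complexGaussian, integral_map hm.aemeasurable (by fun_prop)]
  have e : ∀ p : ℝ × ℝ, Complex.exp ((inner ℝ ((p.1 : ℂ) + (p.2 : ℂ) * Complex.I) t : ℝ) *
      Complex.I) = Complex.exp (t.re * p.1 * Complex.I) * Complex.exp (t.im * p.2 * Complex.I) := by
    intro p
    rw [← Complex.exp_add, Complex.inner]
    congr 1
    simp
    ring
  simp_rw [e]
  rw [integral_prod_mul (fun x : ℝ => Complex.exp (t.re * x * Complex.I))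
    (fun x : ℝ => Complex.exp (t.im * x * Complex.I)), ← charFun_apply_real, ← charFun_apply_real,
    charFun_gaussianReal, charFun_gaussianReal, ← Complex.exp_add,
    ← Complex.normSq_eq_norm_sq, Complex.normSq_apply]
  congr 1
  push_cast
  ring

lemma expLaw_Ioi {a : ℝ} (ha : 0 ≤ a) : expLaw (Set.Ioi a) = nexp (.ofReal a) := by
  rw [expLaw, withDensity_apply _ measurableSet_Ioi,
    Measure.restrict_restrict measurableSet_Ioi, Set.inter_eq_left.2 (Set.Ioi_subset_Ioi ha),
    nexp_ofReal ha, ← integral_exp_neg_Ioi a, ofReal_integral_eq_lintegral_ofReal]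
  · exact setLIntegral_congr_fun measurableSet_Ioi fun t ht =>
      nexp_ofReal (ha.trans (Set.mem_Ioi.1 ht).le)
  · have := integrableOn_exp_mul_Ioi (a := -1) (by norm_num) a
    simpa [IntegrableOn] using this
  · exact ae_of_all _ fun t => (Real.exp_pos _).le

/-- The value 1/(1 + c) is written as the exponential of a logarithm, so that products over
interferers become sums to which the Laplace functional applies. -/
lemma lintegral_expLaw_nexp_mul {c : ℝ} (hc : 0 ≤ c) :
    ∫⁻ t, nexp (.ofReal (c * t)) ∂expLaw = nexp (.ofReal (Real.log (1 + c))) := by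
  have hc1 : 0 < 1 + c := by linarith
  rw [lintegral_expLaw (by fun_prop), nexp_ofReal (Real.log_nonneg (by linarith)), Real.exp_neg,
    Real.exp_log hc1]
  have h := integral_exp_mul_Ioi (a := -(1 + c)) (by linarith) 0
  rw [setLIntegral_congr_fun (g := fun t => .ofReal (Real.exp (-(1 + c) * t))) measurableSet_Ioi,
    ← ofReal_integral_eq_lintegral_ofReal, h]
  · rw [mul_zero, Real.exp_zero, neg_div_neg_eq, one_div]
  · exact integrableOn_exp_mul_Ioi (by linarith) 0
  · exact ae_of_all _ fun t => (Real.exp_pos _).le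
  · intro t ht
    have ht0 : 0 ≤ t := (Set.mem_Ioi.1 ht).le
    dsimp only
    rw [← nexp_add, ← ENNReal.ofReal_add ht0 (by positivity), nexp_ofReal (by positivity)]
    congr 2; ring

section Fading

variable {Ω : Type*} [MeasurableSpace Ω] {P : Measure Ω} [IsProbabilityMeasure P]

lemma measure_of_indepFun {E F : Type*} [MeasurableSpace E] [MeasurableSpace F]
    {U : Ω → E} {V : Ω → F} (hU : Measurable U) (hV : Measurable V) (h : IndepFun U V P)
    {S : Set (E × F)} (hS : MeasurableSet S) :
    P {ω | (U ω, V ω) ∈ S} = ∫⁻ ω, P {ω' | (U ω, V ω') ∈ S} ∂P := by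
  have := Measure.isProbabilityMeasure_map (μ := P) hV.aemeasurable
  have h1 := (indepFun_iff_map_prod_eq_prod_map_map hU.aemeasurable hV.aemeasurable).1 h
  have h2 : P {ω | (U ω, V ω) ∈ S} = P.map (fun ω => (U ω, V ω)) S :=
    (Measure.map_apply (hU.prodMk hV) hS).symm
  rw [h2, h1, Measure.prod_apply hS, lintegral_map (measurable_measure_prodMk_left hS) hU]
  refine lintegral_congr fun ω => ?_
  rw [Measure.map_apply hV (measurable_prodMk_left hS)]
  rfl

variable {ι : Type*} {G : ι → Ω → ℂ}

/-- The complement of `B` may be infinite. Each restricted family generates the supremum of the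
σ-algebras of its members, and disjoint index sets give independent suprema. -/
lemma indepFun_restrict_compl {P : Measure Ω} (hGm : ∀ x, Measurable (G x)) (hG : iIndepFun G P) (B : Finset ι) :
    IndepFun (fun ω (x : {x // x ∈ B}) => G x ω) (fun ω (x : {x // x ∉ B}) => G x ω) P := by
  have h := indep_iSup_of_disjoint (fun x => (hGm x).comap_le) hG
    (S := {x | x ∈ B}) (T := {x | x ∉ B}) (Set.disjoint_left.2 fun x hx hx' => hx' hx)
  have hle : ∀ p : ι → Prop, MeasurableSpace.comap (fun ω (x : {x // p x}) => G x ω)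
      MeasurableSpace.pi = ⨆ x ∈ {x | p x}, MeasurableSpace.comap (G x) inferInstance := by
    intro p
    rw [MeasurableSpace.pi, MeasurableSpace.comap_iSup, iSup_subtype']
    simp_rw [MeasurableSpace.comap_comp]
    rfl
  rw [IndepFun_iff_Indep, hle, hle]
  exact h

/-- Variances of independent centred Gaussians add; the circular symmetry makes the characteristic
function depend on `‖t‖` alone. -/
lemma map_sum_mul_fading (hGm : ∀ x, Measurable (G x)) (hG : iIndepFun G P)
    (hGl : ∀ x, HasLaw (G x) complexGaussian P) (B : Finset ι) (a : ι → ℝ) :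
    P.map (fun ω => ∑ x ∈ B, (a x : ℂ) * G x ω) =
      complexGaussian.map fun z => √(∑ x ∈ B, a x ^ 2) • z := by
  have hsm : Measurable fun ω => ∑ x ∈ B, (a x : ℂ) * G x ω :=
    Finset.measurable_sum _ fun x _ => (hGm x).const_mul _
  have := Measure.isProbabilityMeasure_map (μ := P) hsm.aemeasurable
  have := Measure.isProbabilityMeasure_map (μ := complexGaussian)
    (f := fun z : ℂ => √(∑ x ∈ B, a x ^ 2) • z) (by fun_prop)
  refine Measure.ext_of_charFun ?_
  have hind : iIndepFun (fun x ω => (a x : ℂ) * G x ω) P :=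
    hG.comp (fun x z => (a x : ℂ) * z) fun x => by fun_prop
  rw [iIndepFun.charFun_map_fun_finsetSum_eq_prod (X := fun x ω => (a x : ℂ) * G x ω)
    (fun x _ => ((hGm x).const_mul _).aemeasurable) (hind.restrict _)]
  ext t
  rw [charFun_map_smul, charFun_complexGaussian, Finset.prod_apply]
  have h1 : ∀ x, charFun (P.map fun ω => (a x : ℂ) * G x ω) t =
      Complex.exp (-(‖a x • t‖ ^ 2 / 4 : ℝ)) := by
    intro x
    have : P.map (fun ω => (a x : ℂ) * G x ω) = complexGaussian.map fun z => a x • z := by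
      rw [← (hGl x).map_eq, Measure.map_map (by fun_prop) (hGm x)]
      rfl
    rw [this, charFun_map_smul, charFun_complexGaussian]
  rw [Finset.prod_congr rfl fun x _ => h1 x, ← Complex.exp_sum]
  congr 1
  have h2 : 0 ≤ ∑ x ∈ B, a x ^ 2 := Finset.sum_nonneg fun _ _ => sq_nonneg _
  simp only [norm_smul, mul_pow, Real.norm_eq_abs, sq_abs, Real.sq_sqrt h2]
  rw [Finset.sum_neg_distrib, ← Complex.ofReal_sum, ← Finset.sum_div, ← Finset.sum_mul]

/-- After scaling by the square root of the total power, this is the exponential tail. It is stated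
for extended `y`, since the interference could be infinite. -/
lemma measure_lt_signal (hGm : ∀ x, Measurable (G x)) (hG : iIndepFun G P)
    (hGl : ∀ x, HasLaw (G x) complexGaussian P) (B : Finset ι) (a : ι → ℝ)
    (hC : 0 < ∑ x ∈ B, a x ^ 2) (y : ℝ≥0∞) :
    P {ω | y < .ofReal (‖∑ x ∈ B, (a x : ℂ) * G x ω‖ ^ 2)} =
      nexp (y / .ofReal (∑ x ∈ B, a x ^ 2)) := by
  set C := ∑ x ∈ B, a x ^ 2 with hCd
  rcases eq_or_ne y ∞ with rfl | hy
  · simp [nexp_top, ENNReal.top_div_of_ne_top]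
  lift y to ℝ≥0 using hy
  have hsm : Measurable fun ω => ∑ x ∈ B, (a x : ℂ) * G x ω :=
    Finset.measurable_sum _ fun x _ => (hGm x).const_mul _
  have hS : MeasurableSet {z : ℂ | (y : ℝ≥0∞) < .ofReal (‖z‖ ^ 2)} :=
    measurableSet_lt measurable_const (by fun_prop)
  have hS' : MeasurableSet (Set.Ioi ((y : ℝ) / C)) := measurableSet_Ioi
  have h1 : P {ω | (y : ℝ≥0∞) < .ofReal (‖∑ x ∈ B, (a x : ℂ) * G x ω‖ ^ 2)} =
      P.map (fun ω => ∑ x ∈ B, (a x : ℂ) * G x ω) {z : ℂ | (y : ℝ≥0∞) < .ofReal (‖z‖ ^ 2)} :=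
    (Measure.map_apply hsm hS).symm
  have h2 : (fun z : ℂ => √C • z) ⁻¹' {z : ℂ | (y : ℝ≥0∞) < .ofReal (‖z‖ ^ 2)} =
      {z : ℂ | ‖z‖ ^ 2 ∈ Set.Ioi ((y : ℝ) / C)} := by
    ext z
    simp only [Set.mem_preimage, Set.mem_ofPred_eq, Set.mem_Ioi]
    rw [norm_smul, mul_pow, Real.norm_eq_abs, sq_abs, Real.sq_sqrt hC.le, div_lt_iff₀ hC,
      ← ENNReal.ofReal_coe_nnreal, ENNReal.ofReal_lt_ofReal_iff_of_nonneg y.coe_nonneg, mul_comm C]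
  have h3 := lintegral_complexGaussian_norm_sq (f := (Set.Ioi ((y : ℝ) / C)).indicator 1)
    (measurable_one.indicator hS')
  rw [lintegral_indicator_one hS', expLaw_Ioi (by positivity)] at h3
  rw [h1, map_sum_mul_fading hGm hG hGl, Measure.map_apply (by fun_prop) hS, h2,
    ← ENNReal.ofReal_coe_nnreal, ← ENNReal.ofReal_div_of_pos hC, ← h3,
    ← lintegral_indicator_one (show MeasurableSet {z : ℂ | ‖z‖ ^ 2 ∈ Set.Ioi ((y : ℝ) / C)} from
      hS'.preimage (by fun_prop))]
  rfl

/-- Independence factorises every finite partial sum; dominated convergence with bound 1 passes to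
the infinite sum, with no convergence of the sum required. -/
lemma lintegral_nexp_interference [Countable ι] (hGm : ∀ x, Measurable (G x)) (hG : iIndepFun G P)
    (hGl : ∀ x, HasLaw (G x) complexGaussian P) {c : ι → ℝ} (hc : ∀ x, 0 ≤ c x) :
    ∫⁻ ω, nexp (∑' x, .ofReal (c x * ‖G x ω‖ ^ 2)) ∂P =
      nexp (∑' x, .ofReal (Real.log (1 + c x))) := by
  have hfin : ∀ s : Finset ι, ∫⁻ ω, nexp (∑ x ∈ s, .ofReal (c x * ‖G x ω‖ ^ 2)) ∂P =
      nexp (∑ x ∈ s, .ofReal (Real.log (1 + c x))) := by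
    intro s
    simp_rw [nexp_sum]
    have hm : ∀ x, Measurable fun z : ℂ => nexp (.ofReal (c x * ‖z‖ ^ 2)) := fun x => by fun_prop
    rw [lintegral_prod_eq_prod_lintegral_of_indepFun s
      (fun x ω => nexp (.ofReal (c x * ‖G x ω‖ ^ 2)))
      (hG.comp (fun x z => nexp (.ofReal (c x * ‖z‖ ^ 2))) hm) fun x => (hm x).comp (hGm x)]
    refine Finset.prod_congr rfl fun x _ => ?_
    rw [← lintegral_expLaw_nexp_mul (hc x), ← lintegral_complexGaussian_norm_sq (by fun_prop)]
    exact (hGl x).lintegral_comp (hm x).aemeasurable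
  have hL : Tendsto (fun s : Finset ι => ∫⁻ ω, nexp (∑ x ∈ s, .ofReal (c x * ‖G x ω‖ ^ 2)) ∂P)
      atTop (𝓝 (∫⁻ ω, nexp (∑' x, .ofReal (c x * ‖G x ω‖ ^ 2)) ∂P)) := by
    refine tendsto_lintegral_filter_of_dominated_convergence (fun _ => 1)
      (Eventually.of_forall fun s => ?_)
      (Eventually.of_forall fun s => ae_of_all _ fun ω => nexp_le_one _) (by simp)
      (ae_of_all _ fun ω => (continuous_nexp.tendsto _).comp ENNReal.summable.hasSum)
    exact measurable_nexp.comp (Finset.measurable_sum _ fun x _ => by have := hGm x; fun_prop)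
  have hR : Tendsto (fun s : Finset ι => nexp (∑ x ∈ s, .ofReal (Real.log (1 + c x))))
      atTop (𝓝 (nexp (∑' x, .ofReal (Real.log (1 + c x))))) :=
    (continuous_nexp.tendsto _).comp ENNReal.summable.hasSum
  exact tendsto_nhds_unique (by simpa only [hfin] using hL) hR

/-- The coverage probability for deterministic amplitudes `a` and interference powers `c`. -/
theorem measure_covered_fading [Countable ι] (hGm : ∀ x, Measurable (G x)) (hG : iIndepFun G P)
    (hGl : ∀ x, HasLaw (G x) complexGaussian P) (B : Finset ι) (a : ι → ℝ)
    (hC : 0 < ∑ x ∈ B, a x ^ 2) {c : ι → ℝ} (hc : ∀ x, 0 ≤ c x) {θ n : ℝ} (hθ : 0 < θ) :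
    P {ω | ENNReal.ofReal θ < .ofReal (‖∑ x ∈ B, (a x : ℂ) * G x ω‖ ^ 2) /
        ((∑' x : {x // x ∉ B}, .ofReal (c x * ‖G x ω‖ ^ 2)) + .ofReal n)} =
      nexp (.ofReal (θ / (∑ x ∈ B, a x ^ 2)) * .ofReal n + ∑' x : {x // x ∉ B},
        .ofReal (Real.log (1 + θ / (∑ x ∈ B, a x ^ 2) * c x))) := by
  set C := ∑ x ∈ B, a x ^ 2 with hCd
  set I : Ω → ℝ≥0∞ := fun ω => ∑' x : {x // x ∉ B}, .ofReal (c x * ‖G x ω‖ ^ 2) with hI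
  have hIm : Measurable I := Measurable.tsum fun x => by have := hGm x; fun_prop
  set Z : Ω → ℂ := fun ω => ∑ x ∈ B, (a x : ℂ) * G x ω with hZ
  have hZm : Measurable Z := Finset.measurable_sum _ fun x _ => (hGm x).const_mul _
  have hind : IndepFun I Z P := by
    have h := (indepFun_restrict_compl hGm hG B).symm
    have h2 := h.comp (φ := fun z : {x // x ∉ B} → ℂ => ∑' x : {x // x ∉ B}, ENNReal.ofReal (c x * ‖z x‖ ^ 2))
      (ψ := fun z : {x // x ∈ B} → ℂ => ∑ x : {x // x ∈ B}, (a x : ℂ) * z x)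
      (Measurable.tsum fun x => by fun_prop)
      (Finset.measurable_sum _ fun x _ => by fun_prop)
    have hZe : Z = (fun z : {x // x ∈ B} → ℂ => ∑ x : {x // x ∈ B}, (a x : ℂ) * z x) ∘
        fun ω x => G x ω :=
      funext fun ω => (Finset.sum_coe_sort B fun x => (a x : ℂ) * G x ω).symm
    rw [hZe]
    exact h2
  have hS : MeasurableSet {p : ℝ≥0∞ × ℂ | ENNReal.ofReal θ * (p.1 + .ofReal n) <
      .ofReal (‖p.2‖ ^ 2)} := measurableSet_lt (by fun_prop) (by fun_prop)
  have hset : {ω | ENNReal.ofReal θ < .ofReal (‖Z ω‖ ^ 2) / (I ω + .ofReal n)} =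
      {ω | (I ω, Z ω) ∈ {p : ℝ≥0∞ × ℂ | ENNReal.ofReal θ * (p.1 + .ofReal n) <
        .ofReal (‖p.2‖ ^ 2)}} := by
    ext ω
    simp only [Set.mem_ofPred_eq]
    exact ENNReal.lt_div_iff_mul_lt (.inr ENNReal.ofReal_ne_top) (.inr (by simpa using hθ))
  rw [hset, measure_of_indepFun hIm hZm hind hS]
  -- With the interference frozen, the signal has an exponential tail at θ(I + σ²), which splits
  -- into a noise factor and an interference factor.
  have h1 : ∀ ω, P {ω' | (I ω, Z ω') ∈ {p : ℝ≥0∞ × ℂ | ENNReal.ofReal θ * (p.1 + .ofReal n) <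
      .ofReal (‖p.2‖ ^ 2)}} = nexp (.ofReal (θ / C) * .ofReal n) *
      nexp (∑' x : {x // x ∉ B}, .ofReal (θ / C * c x * ‖G x ω‖ ^ 2)) := by
    intro ω
    have := measure_lt_signal hGm hG hGl B a hC (ENNReal.ofReal θ * (I ω + .ofReal n))
    rw [← hCd] at this
    refine this.trans ?_
    rw [← nexp_add]
    congr 1
    rw [ENNReal.mul_div_right_comm, ← ENNReal.ofReal_div_of_pos hC, mul_add, add_comm, hI,
      ← ENNReal.tsum_mul_left]
    congr 1
    refine tsum_congr fun x => ?_
    rw [← ENNReal.ofReal_mul (by positivity), mul_assoc]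
  simp_rw [h1]
  have hm : Measurable fun ω => nexp (∑' x : {x // x ∉ B},
      .ofReal (θ / C * c x * ‖G x ω‖ ^ 2)) :=
    measurable_nexp.comp (Measurable.tsum fun x => by have := hGm x; fun_prop)
  rw [lintegral_const_mul _ hm, nexp_add,
    lintegral_nexp_interference (G := fun x : {x // x ∉ B} => G x) (fun x => hGm x)
      (hG.precomp Subtype.val_injective) (fun x => hGl x)
      (c := fun x => θ / C * c x) fun x => mul_nonneg (by positivity) (hc x)]

end Fading

/-! ### The function `F` and its inverse -/

section FFunction

variable {α : ℝ}

lemma F_integrand_nonneg {x : ℝ} (hx : 0 ≤ x) : 0 ≤ x / (1 + x ^ α) := by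
  have := Real.rpow_nonneg hx α; positivity

lemma continuousOn_F_integrand (hα : 2 < α) :
    ContinuousOn (fun x : ℝ => x / (1 + x ^ α)) (Set.Ici 0) := by
  refine continuousOn_id.div (continuousOn_const.add
    (continuousOn_id.rpow_const fun x _ => .inr (by linarith))) fun x hx => ?_
  have := Real.rpow_nonneg (Set.mem_Ici.1 hx) α
  exact (show 0 < 1 + x ^ α by positivity).ne'

lemma integrableOn_F_integrand (hα : 2 < α) :
    IntegrableOn (fun x : ℝ => x / (1 + x ^ α)) (Set.Ioi 0) := by
  rw [← Set.Ioc_union_Ioi_eq_Ioi zero_le_one]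
  have hc := continuousOn_F_integrand hα
  refine IntegrableOn.union ?_ ?_
  · exact ((hc.mono Set.Icc_subset_Ici_self).integrableOn_Icc).mono_set Set.Ioc_subset_Icc_self
  · have h1 : IntegrableOn (fun x : ℝ => x ^ (1 - α)) (Set.Ioi 1) :=
      integrableOn_Ioi_rpow_of_lt (by linarith) one_pos
    refine h1.mono' ((hc.mono fun x hx => ?_).aestronglyMeasurable measurableSet_Ioi)
      ((ae_restrict_iff' measurableSet_Ioi).2 (ae_of_all _ fun x hx => ?_))
    · exact Set.mem_Ici.2 (zero_le_one.trans (Set.mem_Ioi.1 hx).le)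
    · have hx0 : 0 < x := one_pos.trans hx
      have := Real.rpow_pos_of_pos hx0 α
      rw [Real.norm_of_nonneg (F_integrand_nonneg hx0.le), Real.rpow_sub hx0, Real.rpow_one]
      gcongr
      linarith

lemma F_eq_sub (hα : 2 < α) {y : ℝ} (hy : 0 ≤ y) :
    F y α = F 0 α - ∫ x in (0 : ℝ)..y, x / (1 + x ^ α) := by
  have h := integrableOn_F_integrand hα
  have := intervalIntegral.integral_interval_add_Ioi h
    (h.mono_set (Set.Ioi_subset_Ioi hy))
  rw [F, F]; linarith

lemma continuousOn_F (hα : 2 < α) : ContinuousOn (fun y => F y α) (Set.Ici 0) := by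
  intro y hy
  have hc : ContinuousOn (fun y => F y α) (Set.Icc 0 (y + 1)) := by
    have hint : IntegrableOn (fun x : ℝ => x / (1 + x ^ α)) (Set.uIcc 0 (y + 1)) := by
      rw [Set.uIcc_of_le (by linarith [Set.mem_Ici.1 hy])]
      exact ((continuousOn_F_integrand hα).mono Set.Icc_subset_Ici_self).integrableOn_Icc
    have h2 := intervalIntegral.continuousOn_primitive_interval hint
    rw [Set.uIcc_of_le (by linarith [Set.mem_Ici.1 hy])] at h2
    exact (continuousOn_const.sub h2).congr fun z hz => F_eq_sub hα hz.1
  refine (hc y ⟨hy, by linarith⟩).mono_of_mem_nhdsWithin ?_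
  rw [mem_nhdsWithin]
  exact ⟨Set.Iio (y + 1), isOpen_Iio, by simp, fun z hz => ⟨hz.2, hz.1.le⟩⟩

lemma strictAntiOn_F (hα : 2 < α) : StrictAntiOn (fun y => F y α) (Set.Ici 0) := by
  intro y hy z hz hyz
  have hc := continuousOn_F_integrand hα
  have hi : ∀ a b : ℝ, 0 ≤ a → 0 ≤ b → IntervalIntegrable (fun x : ℝ => x / (1 + x ^ α)) volume a b :=
    fun a b ha hb => (hc.mono fun x hx =>
      (le_min ha hb).trans (Set.mem_Icc.1 hx).1).intervalIntegrable
  have h1 := intervalIntegral.integral_add_adjacent_intervals (hi 0 y le_rfl hy) (hi y z hy hz)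
  have h2 : 0 < ∫ x in y..z, x / (1 + x ^ α) := by
    refine intervalIntegral.intervalIntegral_pos_of_pos_on (hi y z hy hz) (fun x hx => ?_) hyz
    have hx0 : 0 < x := (Set.mem_Ici.1 hy).trans_lt hx.1
    have := Real.rpow_pos_of_pos hx0 α
    positivity
  dsimp only
  rw [F_eq_sub hα hy, F_eq_sub hα hz]
  linarith

lemma tendsto_F_atTop (hα : 2 < α) : Tendsto (fun y => F y α) atTop (𝓝 0) := by
  have h := intervalIntegral_tendsto_integral_Ioi 0 (integrableOn_F_integrand hα) tendsto_id
  have h2 : Tendsto (fun y => F 0 α - ∫ x in (0 : ℝ)..y, x / (1 + x ^ α)) atTop (𝓝 0) := by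
    have := (tendsto_const_nhds (x := F 0 α)).sub h
    simpa [F] using this
  refine h2.congr' ?_
  filter_upwards [eventually_ge_atTop 0] with y hy
  exact (F_eq_sub hα hy).symm

lemma F_pos (hα : 2 < α) {y : ℝ} (hy : 0 ≤ y) : 0 < F y α := by
  have h1 := strictAntiOn_F hα (Set.mem_Ici.2 hy) (Set.mem_Ici.2 (show 0 ≤ y + 1 by linarith))
    (by linarith)
  refine lt_of_le_of_lt (setIntegral_nonneg measurableSet_Ioi fun x hx => ?_) h1
  exact F_integrand_nonneg (by linarith [Set.mem_Ioi.1 hx])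

/-- The inverse of `F` in its first argument. -/
noncomputable def invF (z α : ℝ) : ℝ := sSup {y | 0 ≤ y ∧ z ≤ F y α}

lemma invF_F (hα : 2 < α) {y : ℝ} (hy : 0 ≤ y) : invF (F y α) α = y := by
  have : {y' | 0 ≤ y' ∧ F y α ≤ F y' α} = Set.Icc 0 y := by
    ext y'
    constructor
    · rintro ⟨h0, h⟩
      exact ⟨h0, (strictAntiOn_F hα).le_iff_ge hy h0 |>.1 h⟩
    · rintro ⟨h0, h⟩
      exact ⟨h0, (strictAntiOn_F hα).le_iff_ge hy h0 |>.2 h⟩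
  rw [invF, this, csSup_Icc hy]

lemma exists_F_eq (hα : 2 < α) {y z : ℝ} (hy : 0 ≤ y) (hz : 0 < z) (hzy : z ≤ F y α) :
    ∃ d, y ≤ d ∧ F d α = z := by
  obtain ⟨Y, hY, hyY⟩ := (((tendsto_F_atTop hα).eventually (gt_mem_nhds hz)).and
    (eventually_ge_atTop y)).exists
  have := intermediate_value_Icc' hyY ((continuousOn_F hα).mono fun x hx => hy.trans hx.1)
  obtain ⟨d, hd, hd'⟩ := this ⟨hY.le, hzy⟩
  exact ⟨d, hd.1, hd'⟩

/-- The inverse is antitone on positive arguments. For nonpositive ones the set in `invF` is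
unbounded and the supremum takes its default value 0, so the exponential is used to stay among
positive arguments. -/
lemma measurable_invF_exp (hα : 2 < α) : Measurable fun x => invF (Real.exp x) α := by
  refine Antitone.measurable fun x y hxy => ?_
  simp only [invF]
  rcases Set.eq_empty_or_nonempty {y' | 0 ≤ y' ∧ Real.exp y ≤ F y' α} with h | h
  · rw [h, Real.sSup_empty]
    exact Real.sSup_nonneg fun z hz => hz.1
  · refine csSup_le_csSup ?_ h fun z hz => ⟨hz.1, (Real.exp_le_exp.2 hxy).trans hz.2⟩
    obtain ⟨Y, hY, hY0⟩ := (((tendsto_F_atTop hα).eventually (gt_mem_nhds (Real.exp_pos x))).and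
      (eventually_ge_atTop 0)).exists
    refine ⟨Y, fun z hz => ?_⟩
    by_contra! hlt
    have := strictAntiOn_F hα hY0 hz.1 hlt
    dsimp only at this
    linarith [hz.2]

end FFunction

/-! ### The Laplace factor of a tier and the splitting of the interference -/

/-- The exponent by which an interferer of power `p` at distance `x` reduces the Laplace transform
of the interference at `s`. -/
noncomputable def fadingLoss (p α s x : ℝ) : ℝ≥0∞ := .ofReal (Real.log (1 + s * (p * x ^ (-α))))

lemma one_sub_nexp_fadingLoss {p α s x : ℝ} (hp : 0 < p) (hs : 0 < s) (hx : 0 < x) :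
    1 - nexp (fadingLoss p α s x) = .ofReal (1 / (1 + x ^ α / (s * p))) := by
  have h1 : 0 < x ^ α := Real.rpow_pos_of_pos hx α
  have h2 : 0 < s * (p * x ^ (-α)) := by
    have := Real.rpow_pos_of_pos hx (-α); positivity
  rw [fadingLoss, nexp_ofReal (Real.log_nonneg (by linarith)), Real.exp_neg,
    Real.exp_log (by linarith), ← ENNReal.ofReal_one, ← ENNReal.ofReal_sub _ (by positivity)]
  congr 1
  rw [Real.rpow_neg hx.le]
  field_simp
  ring

variable (N : Params)

/-- `π λ`: the mean number of stations of tier `i` per squared radius. -/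
noncomputable def rate (i : Tier) : ℝ := Real.pi * N.lam i

lemma rate_pos (i : Tier) : 0 < rate N i := mul_pos Real.pi_pos (N.lam_pos i)

lemma α_pos : 0 < N.α := by linarith [N.two_lt_α]

/-- Measuring distances in units of (sP)^(1/α), the substitution t = πλ (sP)^(2/α) x² turns the
Laplace exponent of the arrivals beyond radius `d` into the integral defining `F`. -/
lemma nexp_lintegral_fadingLoss (i : Tier) {d s : ℝ} (hd : 0 ≤ d) (hs : 0 < s) :
    nexp (∫⁻ t in Set.Ioi (rate N i * d ^ 2),
      (1 - nexp (fadingLoss (N.pow i) N.α s (√(t / rate N i))))) =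
      .ofReal (tierLaplace N i d s) := by
  have hb := rate_pos N i
  have hp := N.pow_pos i
  have hα := N.two_lt_α
  have hα0 := α_pos N
  -- The distance at which s P c^(-α) = 1.
  set c := (s * N.pow i) ^ (1 / N.α) with hc
  have hsp : 0 < s * N.pow i := mul_pos hs hp
  have hc0 : 0 < c := Real.rpow_pos_of_pos hsp _
  have hcα : c ^ N.α = s * N.pow i := by
    rw [hc, ← Real.rpow_mul hsp.le, one_div_mul_cancel hα0.ne', Real.rpow_one]
  have hc2 : (s * N.pow i) ^ (2 / N.α) = c ^ 2 := by
    rw [hc, ← Real.rpow_mul_natCast hsp.le]; congr 1; push_cast; ring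
  have hcinv : (s * N.pow i) ^ (-1 / N.α) = c⁻¹ := by
    rw [hc, ← Real.rpow_neg hsp.le]; congr 1; ring
  have hdc : 0 ≤ d / c := by positivity
  have hbc : 0 < rate N i * c ^ 2 := by positivity
  have e1 : rate N i * d ^ 2 = rate N i * c ^ 2 * (d / c) ^ 2 := by field_simp
  rw [e1, lintegral_Ioi_mul_sq hbc hdc]
  have e2 : ∀ x ∈ Set.Ioi (d / c), ENNReal.ofReal (2 * (rate N i * c ^ 2) * x) *
      (1 - nexp (fadingLoss (N.pow i) N.α s (√(rate N i * c ^ 2 * x ^ 2 / rate N i)))) =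
      .ofReal (2 * (rate N i * c ^ 2) * (x / (1 + x ^ N.α))) := by
    intro x hx
    have hx0 : 0 < x := hdc.trans_lt hx
    have : √(rate N i * c ^ 2 * x ^ 2 / rate N i) = c * x := by
      rw [show rate N i * c ^ 2 * x ^ 2 / rate N i = (c * x) ^ 2 by field_simp,
        Real.sqrt_sq (by positivity)]
    have hxα := Real.rpow_pos_of_pos hx0 N.α
    rw [this, one_sub_nexp_fadingLoss hp hs (by positivity), ← ENNReal.ofReal_mul (by positivity),
      Real.mul_rpow hc0.le hx0.le, hcα]
    congr 1
    field_simp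
  rw [setLIntegral_congr_fun measurableSet_Ioi e2, ← ofReal_integral_eq_lintegral_ofReal]
  · rw [integral_const_mul, nexp_ofReal, tierLaplace, hc2, hcinv, F, inv_mul_eq_div]
    · congr 2; rw [rate]; ring
    · exact mul_nonneg (by positivity) (F_pos hα hdc).le
  · exact ((integrableOn_F_integrand hα).mono_set (Set.Ioi_subset_Ioi hdc)).const_mul _
  · refine (ae_restrict_iff' measurableSet_Ioi).2 (ae_of_all _ fun x hx => ?_)
    exact mul_nonneg (by positivity) (F_integrand_nonneg (hdc.trans (Set.mem_Ioi.1 hx).le))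

instance : Countable Tier :=
  ⟨fun i => Tier.casesOn i 0 1, fun i j => by cases i <;> cases j <;> simp⟩

lemma tsum_tier (f : Tier × ℕ → ℝ≥0∞) :
    ∑' x, f x = ∑' j, f (Tier.mbs, j) + ∑' j, f (Tier.sbs, j) := by
  classical
  rw [ENNReal.tsum_prod', tsum_eq_sum (s := {Tier.mbs, Tier.sbs}) fun i hi => ?_]
  · exact Finset.sum_pair (by simp)
  · cases i <;> simp at hi

lemma tsum_tier_notMem (B : Finset (Tier × ℕ)) (f : Tier × ℕ → ℝ≥0∞) :
    ∑' x : {x // x ∉ B}, f x = ∑' j, {x | x ∉ B}.indicator f (Tier.mbs, j) +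
      ∑' j, {x | x ∉ B}.indicator f (Tier.sbs, j) :=
  (tsum_subtype {x | x ∉ B} f).trans (tsum_tier _)

lemma sbs_mem_clusterSet (k j : ℕ) : (Tier.sbs, j) ∈ clusterSet k ↔ j < k := by
  simp [clusterSet]

lemma mbs_notMem_clusterSet (k j : ℕ) : (Tier.mbs, j) ∉ clusterSet k := by
  simp [clusterSet]

lemma tsum_notMem_clusterSet (k : ℕ) (f : Tier × ℕ → ℝ≥0∞) :
    ∑' x : {x // x ∉ clusterSet k}, f x = ∑' j, f (Tier.mbs, j) + ∑' j, f (Tier.sbs, j + k) := by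
  rw [tsum_tier_notMem]
  congr 1
  · exact tsum_congr fun j => Set.indicator_of_mem (mbs_notMem_clusterSet k j) _
  · have h := Summable.sum_add_tsum_nat_add' (k := k)
      (f := fun j => {x | x ∉ clusterSet k}.indicator f (Tier.sbs, j)) ENNReal.summable
    rw [← h, Finset.sum_eq_zero, zero_add]
    · refine tsum_congr fun j => Set.indicator_of_mem ?_ _
      exact mt (sbs_mem_clusterSet k (j + k)).1 (by lia)
    · intro j hj
      refine Set.indicator_of_notMem ?_ _
      exact not_not.2 ((sbs_mem_clusterSet k j).2 (Finset.mem_range.1 hj))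

lemma tsum_notMem_macroSet (f : Tier × ℕ → ℝ≥0∞) :
    ∑' x : {x // x ∉ macroSet}, f x = ∑' j, f (Tier.mbs, j + 1) + ∑' j, f (Tier.sbs, j) := by
  rw [tsum_tier_notMem]
  congr 1
  · rw [tsum_eq_zero_add' ENNReal.summable, Set.indicator_of_notMem (by simp [macroSet]), zero_add]
    refine tsum_congr fun j => Set.indicator_of_mem ?_ _
    simp [macroSet]
  · refine tsum_congr fun j => Set.indicator_of_mem ?_ _
    simp [macroSet]

/-! ### Coverage given the positions, and integration over the macro tier -/

section Network

variable {Ω : Type*} [MeasurableSpace Ω] {P : Measure Ω} [IsProbabilityMeasure P]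
  {N : Params} {X : Tier → ℕ → Ω → Plane} {g : Tier → ℕ → Ω → ℂ}

lemma lintegral_of_indepFun {E F : Type*} [MeasurableSpace E] [MeasurableSpace F]
    {U : Ω → E} {V : Ω → F} (hU : Measurable U) (hV : Measurable V) (h : IndepFun U V P)
    {H : E × F → ℝ≥0∞} (hH : Measurable H) :
    ∫⁻ ω, H (U ω, V ω) ∂P = ∫⁻ ω, ∫⁻ ω', H (U ω, V ω') ∂P ∂P := by
  have := Measure.isProbabilityMeasure_map (μ := P) hV.aemeasurable
  have h1 := (indepFun_iff_map_prod_eq_prod_map_map hU.aemeasurable hV.aemeasurable).1 h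
  rw [← lintegral_map hH (hU.prodMk hV), h1, lintegral_prod _ hH.aemeasurable,
    lintegral_map hH.lintegral_prod_right' hU]
  refine lintegral_congr fun ω => ?_
  exact lintegral_map (f := fun y => H (U ω, y)) (hH.comp measurable_prodMk_left) hV

lemma measurable_sinr (N : Params) (B : Finset (Tier × ℕ)) :
    Measurable (sinr N (fun i j (p : (Tier → ℕ → Plane) × (Tier → ℕ → ℂ)) => p.1 i j)
      (fun i j p => p.2 i j) B) := by
  have hX : ∀ i j, Measurable fun p : (Tier → ℕ → Plane) × (Tier → ℕ → ℂ) => p.1 i j :=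
    fun i j => by fun_prop
  have hg : ∀ i j, Measurable fun p : (Tier → ℕ → Plane) × (Tier → ℕ → ℂ) => p.2 i j :=
    fun i j => by fun_prop
  have h1 : Measurable (signalPower N (fun i j (p : (Tier → ℕ → Plane) × (Tier → ℕ → ℂ)) => p.1 i j)
      (fun i j p => p.2 i j) B) := by
    refine Measurable.pow_const (Measurable.norm ?_) 2
    refine Finset.measurable_sum _ fun x _ => ?_
    have := hX x.1 x.2
    have := hg x.1 x.2
    fun_prop
  have h2 : Measurable (interference N (fun i j (p : (Tier → ℕ → Plane) × (Tier → ℕ → ℂ)) => p.1 i j)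
      (fun i j p => p.2 i j) B) := by
    refine Measurable.tsum fun x => ?_
    have := hX x.1.1 x.1.2
    have := hg x.1.1 x.1.2
    fun_prop
  exact h1.ennreal_ofReal.div (h2.add_const _)

/-- The coverage probability, given the positions. -/
theorem IsNetwork.measure_inter_covered (hN : IsNetwork N X g P) (B : Finset (Tier × ℕ)) {θ : ℝ}
    (hθ : 0 < θ) {D : Set (Tier → ℕ → Plane)} (hD : MeasurableSet D) {C : Ω → ℝ}
    (hCd : ∀ ω, C ω = ∑ x ∈ B, N.pow x.1 * ‖X x.1 x.2 ω‖ ^ (-N.α)) (hC : ∀ᵐ ω ∂P, 0 < C ω) :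
    P ({ω | (fun i j => X i j ω) ∈ D} ∩ covered N θ X g B) =
      ∫⁻ ω in {ω | (fun i j => X i j ω) ∈ D}, nexp (.ofReal (θ / C ω) * .ofReal N.noise +
        ∑' x : {x // x ∉ B}, fadingLoss (N.pow x.1.1) N.α (θ / C ω) ‖X x.1.1 x.1.2 ω‖) ∂P := by
  have hU : Measurable fun ω (i : Tier) (j : ℕ) => X i j ω :=
    measurable_pi_lambda _ fun i => measurable_pi_lambda _ fun j => (hN.poisson i).measurable j
  have hV : Measurable fun ω (i : Tier) (j : ℕ) => g i j ω :=
    measurable_pi_lambda _ fun i => measurable_pi_lambda _ fun j => hN.fading_measurable i j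
  -- The SINR is evaluated on the canonical space of positions and fading coefficients, so that
  -- independence of the two reduces the probability to a Fubini integral.
  set S : Set ((Tier → ℕ → Plane) × (Tier → ℕ → ℂ)) := {p | p.1 ∈ D ∧ ENNReal.ofReal θ <
    sinr N (fun i j p => p.1 i j) (fun i j p => p.2 i j) B p} with hS
  have hSm : MeasurableSet S :=
    (hD.preimage measurable_fst).inter (measurableSet_lt measurable_const (measurable_sinr N B))
  have h1 := measure_of_indepFun hU hV hN.fading_indep_positions hSm
  refine Eq.trans (by rfl) (h1.trans ?_)
  have hDm : MeasurableSet {ω | (fun i j => X i j ω) ∈ D} := hD.preimage hU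
  rw [← lintegral_indicator hDm]
  refine lintegral_congr_ae ?_
  filter_upwards [hC] with ω hω
  by_cases hωD : (fun i j => X i j ω) ∈ D
  · rw [Set.indicator_of_mem (show ω ∈ {ω | (fun i j => X i j ω) ∈ D} from hωD)]
    have ha : ∀ x : Tier × ℕ, (√(N.pow x.1) * ‖X x.1 x.2 ω‖ ^ (-N.α / 2)) ^ 2 =
        N.pow x.1 * ‖X x.1 x.2 ω‖ ^ (-N.α) := by
      intro x
      rw [mul_pow, Real.sq_sqrt (N.pow_pos _).le, ← Real.rpow_mul_natCast (norm_nonneg _)]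
      congr 2; push_cast; ring
    have hsum : ∑ x ∈ B, (√(N.pow x.1) * ‖X x.1 x.2 ω‖ ^ (-N.α / 2)) ^ 2 = C ω := by
      rw [hCd]; exact Finset.sum_congr rfl fun x _ => ha x
    have h2 := measure_covered_fading (P := P) (G := fun x : Tier × ℕ => g x.1 x.2)
      (fun x => hN.fading_measurable _ _) hN.fading_indep (fun x => hN.fading_law _ _) B
      (fun x => √(N.pow x.1) * ‖X x.1 x.2 ω‖ ^ (-N.α / 2)) (by rw [hsum]; exact hω)
      (c := fun x => N.pow x.1 * ‖X x.1 x.2 ω‖ ^ (-N.α))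
      (fun x => mul_nonneg (N.pow_pos _).le (Real.rpow_nonneg (norm_nonneg _) _)) (n := N.noise) hθ
    rw [hsum] at h2
    refine Eq.trans ?_ h2
    congr 1
    ext ω'
    simp only [hS, Set.mem_ofPred_eq, hωD, true_and, sinr, signalPower, interference]
    rw [tsum_congr fun x : {x // x ∉ B} => congrArg ENNReal.ofReal
      (mul_right_comm (N.pow x.1.1) (‖g x.1.1 x.1.2 ω'‖ ^ 2) (‖X x.1.1 x.1.2 ω‖ ^ (-N.α)))]
  · rw [Set.indicator_of_notMem (show ω ∉ {ω | (fun i j => X i j ω) ∈ D} from hωD)]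
    simp [hS, hωD]

/-- The squared distances of tier `i`, in units in which they form a Poisson process of unit
rate. -/
noncomputable def arrivalTimes (N : Params) (X : Tier → ℕ → Ω → Plane) (i : Tier) (ω : Ω) (j : ℕ) :
    ℝ := rate N i * ‖X i j ω‖ ^ 2

lemma sqrt_arrivalTimes {Ω : Type*} {X : Tier → ℕ → Ω → Plane} (i : Tier) (ω : Ω) (j : ℕ) :
    √(arrivalTimes N X i ω j / rate N i) = ‖X i j ω‖ := by
  rw [arrivalTimes, mul_div_cancel_left₀ _ (rate_pos N i).ne', Real.sqrt_sq (norm_nonneg _)]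

namespace IsNetwork

lemma measurable_arrivalTimes {P : Measure Ω} (hN : IsNetwork N X g P) (i : Tier) :
    Measurable (arrivalTimes N X i) :=
  measurable_pi_lambda _ fun j => by
    have := (hN.poisson i).measurable j
    unfold arrivalTimes; fun_prop

lemma isUnitPoisson (hN : IsNetwork N X g P) (i : Tier) :
    IsUnitPoisson (P.map (arrivalTimes N X i)) :=
  (hN.poisson i).isUnitPoisson (N.lam_pos i) (hN.ordered i)

lemma indepFun_arrivalTimes {P : Measure Ω} (hN : IsNetwork N X g P) :
    IndepFun (arrivalTimes N X Tier.mbs) (arrivalTimes N X Tier.sbs) P := by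
  have h : ∀ i, Measurable fun (x : ℕ → Plane) (j : ℕ) => rate N i * ‖x j‖ ^ 2 := fun i =>
    measurable_pi_lambda _ fun j => by fun_prop
  exact hN.tiers_indep.comp (h Tier.mbs) (h Tier.sbs)

lemma ae_norm_pos (hN : IsNetwork N X g P) (i : Tier) : ∀ᵐ ω ∂P, ∀ j, 0 < ‖X i j ω‖ := by
  have := ae_of_ae_map (hN.measurable_arrivalTimes i).aemeasurable (hN.isUnitPoisson i).ae_pos
  filter_upwards [this] with ω hω j
  have h := hω j
  rw [← sqrt_arrivalTimes (N := N)]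
  exact Real.sqrt_pos.2 (div_pos h (rate_pos N i))

end IsNetwork

/-- The distances that correspond to the first `k` arrival times of tier `i`. -/
noncomputable def radii (N : Params) (i : Tier) (k : ℕ) (T : ℕ → ℝ) : Fin k → ℝ :=
  fun j => √(T j / rate N i)

lemma measurable_radii (i : Tier) (k : ℕ) : Measurable (radii N i k) :=
  measurable_pi_lambda _ fun j => by unfold radii; fun_prop

lemma radii_arrivalTimes {Ω : Type*} {X : Tier → ℕ → Ω → Plane} (i : Tier) (k : ℕ) (ω : Ω) :
    radii N i k (arrivalTimes N X i ω) = fun j : Fin k => ‖X i j ω‖ :=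
  funext fun j => sqrt_arrivalTimes i ω j

lemma measurable_clusterPower (N : Params) (k : ℕ) :
    Measurable fun r : Fin k → ℝ => clusterPower N r :=
  Finset.measurable_sum _ fun j _ => by fun_prop

lemma clusterRSS_eq {Ω : Type*} {X : Tier → ℕ → Ω → Plane} (k : ℕ) (ω : Ω) :
    clusterRSS N k X ω = clusterPower N fun j : Fin k => ‖X Tier.sbs j ω‖ := by
  rw [clusterRSS, Finset.sum_range, clusterPower]

lemma clusterPower_pos {k : ℕ} [NeZero k] {r : Fin k → ℝ} (hr : ∀ j, 0 < r j) :
    0 < clusterPower N r :=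
  Finset.sum_pos (fun j _ => mul_pos (N.pow_pos _) (Real.rpow_pos_of_pos (hr j) _))
    Finset.univ_nonempty

lemma eta_eq {k : ℕ} (r : Fin k → ℝ) : eta N r = N.pow Tier.mbs / clusterPower N r := by
  rw [eta, clusterPower, Finset.mul_sum]

lemma eta_pos {k : ℕ} [NeZero k] {r : Fin k → ℝ} (hr : ∀ j, 0 < r j) : 0 < eta N r := by
  rw [eta_eq]; exact div_pos (N.pow_pos _) (clusterPower_pos hr)

lemma mul_rpow_neg_lt_iff {p α C x : ℝ} (hp : 0 < p) (hα : 0 < α) (hC : 0 < C) (hx : 0 < x) :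
    p * x ^ (-α) < C ↔ (p / C) ^ (1 / α) < x := by
  have hxα := Real.rpow_pos_of_pos hx α
  rw [one_div, Real.rpow_inv_lt_iff_of_pos (by positivity) hx.le hα, Real.rpow_neg hx.le,
    div_lt_iff₀ hC, ← div_eq_mul_inv, div_lt_iff₀ hxα, mul_comm C]

lemma lt_mul_rpow_neg_iff {p α C x : ℝ} (hp : 0 < p) (hα : 0 < α) (hC : 0 < C) (hx : 0 < x) :
    C < p * x ^ (-α) ↔ x < (p / C) ^ (1 / α) := by
  have hxα := Real.rpow_pos_of_pos hx α
  rw [one_div, Real.lt_rpow_inv_iff_of_pos hx.le (by positivity) hα, Real.rpow_neg hx.le,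
    lt_div_iff₀ hC, ← div_eq_mul_inv, lt_div_iff₀ hxα, mul_comm C]

/-- Integration over the positions of the macro stations, on the event `B_s`. -/
theorem IsNetwork.setLIntegral_assocS (hN : IsNetwork N X g P) (k : ℕ) [NeZero k]
    {W : (ℕ → ℝ) → ℝ≥0∞} (hW : Measurable W) {u : ℝ → ℝ → ℝ≥0∞}
    (hu : Measurable (Function.uncurry u)) :
    ∫⁻ ω in assocS N k X, W (arrivalTimes N X Tier.sbs ω) *
        nexp (∑' j, u (clusterRSS N k X ω) ‖X Tier.mbs j ω‖) ∂P =
      ∫⁻ ω, W (arrivalTimes N X Tier.sbs ω) *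
        (nexp (.ofReal (rate N Tier.mbs *
          (eta N (fun j : Fin k => ‖X Tier.sbs j ω‖) ^ (1 / N.α)) ^ 2)) *
        nexp (∫⁻ t in Set.Ioi (rate N Tier.mbs *
          (eta N (fun j : Fin k => ‖X Tier.sbs j ω‖) ^ (1 / N.α)) ^ 2),
            (1 - nexp (u (clusterRSS N k X ω) √(t / rate N Tier.mbs))))) ∂P := by
  have hμ := hN.isUnitPoisson Tier.mbs
  set b := rate N Tier.mbs with hb
  have hb0 : 0 < b := rate_pos N Tier.mbs
  let C : (ℕ → ℝ) → ℝ := fun ts => clusterPower N (radii N Tier.sbs k ts)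
  have hCm : Measurable C := (measurable_clusterPower N k).comp (measurable_radii _ _)
  have hCω : ∀ ω, C (arrivalTimes N X Tier.sbs ω) = clusterRSS N k X ω := fun ω => by
    simp only [C]; rw [radii_arrivalTimes, clusterRSS_eq]
  let S : Set ((ℕ → ℝ) × (ℕ → ℝ)) := {p | N.pow Tier.mbs * √(p.2 0 / b) ^ (-N.α) < C p.1}
  have hS : MeasurableSet S :=
    measurableSet_lt (by fun_prop) (hCm.comp measurable_fst)
  let H₀ : (ℕ → ℝ) × (ℕ → ℝ) → ℝ≥0∞ := fun p => W p.1 * nexp (∑' j, u (C p.1) √(p.2 j / b))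
  have huj : ∀ j, Measurable fun p : (ℕ → ℝ) × (ℕ → ℝ) => u (C p.1) √(p.2 j / b) := fun j =>
    hu.comp ((hCm.comp measurable_fst).prodMk (by fun_prop))
  have hH₀ : Measurable H₀ :=
    (hW.comp measurable_fst).mul (measurable_nexp.comp (Measurable.tsum huj))
  have hTs := hN.measurable_arrivalTimes Tier.sbs
  have hTm := hN.measurable_arrivalTimes Tier.mbs
  have hset : assocS N k X = (fun ω => (arrivalTimes N X Tier.sbs ω,
      arrivalTimes N X Tier.mbs ω)) ⁻¹' S := by
    ext ω
    simp only [assocS, macroRSS, Set.mem_ofPred_eq, Set.mem_preimage, S, hCω, hb, sqrt_arrivalTimes]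
  have hAm : MeasurableSet (assocS N k X) := hset ▸ hS.preimage (hTs.prodMk hTm)
  rw [← lintegral_indicator hAm]
  have h1 : ∀ ω, (assocS N k X).indicator (fun ω => W (arrivalTimes N X Tier.sbs ω) *
        nexp (∑' j, u (clusterRSS N k X ω) ‖X Tier.mbs j ω‖)) ω =
      S.indicator H₀ (arrivalTimes N X Tier.sbs ω, arrivalTimes N X Tier.mbs ω) := by
    intro ω
    by_cases h : ω ∈ assocS N k X
    · rw [Set.indicator_of_mem h, Set.indicator_of_mem (by rw [hset] at h; exact h)]
      simp only [H₀, hCω, hb, sqrt_arrivalTimes]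
    · rw [Set.indicator_of_notMem h, Set.indicator_of_notMem (by rw [hset] at h; exact h)]
  simp_rw [h1]
  rw [lintegral_of_indepFun hTs hTm hN.indepFun_arrivalTimes.symm (hH₀.indicator hS)]
  refine lintegral_congr_ae ?_
  filter_upwards [hN.ae_norm_pos Tier.sbs] with ω hω
  have hpos : ∀ j : Fin k, 0 < ‖X Tier.sbs j ω‖ := fun j => hω j
  have hC0 : 0 < clusterRSS N k X ω := by rw [clusterRSS_eq]; exact clusterPower_pos hpos
  set d := eta N (fun j : Fin k => ‖X Tier.sbs j ω‖) ^ (1 / N.α) with hd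
  have hd0 : 0 ≤ d := Real.rpow_nonneg (eta_pos hpos).le _
  have hum : Measurable fun t => u (clusterRSS N k X ω) √(t / b) :=
    hu.comp (measurable_const.prodMk (by fun_prop))
  -- With the small cells fixed, the association event says that the first macro arrival exceeds `b
  -- * d ^ 2`. Read backwards, `laplace_delay` and `setLIntegral_lt` turn the claimed void
  -- probability and Laplace factor into one integral over macro arrivals on that event.
  rw [← lintegral_map (f := fun tm => S.indicator H₀ (arrivalTimes N X Tier.sbs ω, tm))
    ((hH₀.indicator hS).comp measurable_prodMk_left) hTm, ← hμ.laplace_delay hum,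
    ← hμ.setLIntegral_lt (measurable_nexp_tsum hum) (by positivity),
    ← lintegral_const_mul _ (measurable_nexp_tsum hum),
    ← lintegral_indicator (measurableSet_lt measurable_const (measurable_pi_apply 0))]
  refine lintegral_congr_ae ?_
  filter_upwards [hμ.ae_pos] with tm htm
  have hiff : (arrivalTimes N X Tier.sbs ω, tm) ∈ S ↔ b * d ^ 2 < tm 0 := by
    simp only [S, Set.mem_ofPred_eq, hCω]
    have hx : 0 < √(tm 0 / b) := Real.sqrt_pos.2 (div_pos (htm 0) hb0)
    rw [mul_rpow_neg_lt_iff (N.pow_pos _) (α_pos N) hC0 hx, clusterRSS_eq, ← eta_eq, ← hd,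
      Real.lt_sqrt hd0, lt_div_iff₀ hb0, mul_comm]
  by_cases h : b * d ^ 2 < tm 0
  · rw [Set.indicator_of_mem (hiff.2 h), Set.indicator_of_mem
      (show tm ∈ {T : ℕ → ℝ | b * d ^ 2 < T 0} from h)]
    simp only [H₀, hCω]
  · rw [Set.indicator_of_notMem (mt hiff.1 h), Set.indicator_of_notMem
      (show tm ∉ {T : ℕ → ℝ | b * d ^ 2 < T 0} from h)]

end Network

/-! ### The joint law of the `k` closest stations and the association probabilities -/

lemma measurable_comp_uncurry {A B E : Type*} [MeasurableSpace A] [MeasurableSpace B]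
    [MeasurableSpace E] {f : A → B → ℝ≥0∞} (hf : Measurable (Function.uncurry f)) {a : E → A}
    {b : E → B} (ha : Measurable a) (hb : Measurable b) : Measurable fun x => f (a x) (b x) :=
  hf.comp (ha.prodMk hb)

lemma measurable_nexp_lintegral_Ioi {E : Type*} [MeasurableSpace E] {u : ℝ → ℝ → ℝ≥0∞}
    (hu : Measurable (Function.uncurry u)) {c s : E → ℝ} (hc : Measurable c) (hs : Measurable s) :
    Measurable fun x => nexp (∫⁻ t in Set.Ioi (c x), (1 - nexp (u (s x) t))) := by
  refine measurable_nexp.comp ?_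
  simp_rw [← lintegral_indicator measurableSet_Ioi]
  let S : Set (E × ℝ) := {p | c p.1 < p.2}
  have hS : MeasurableSet S := measurableSet_lt (hc.comp measurable_fst) measurable_snd
  have hup : Measurable fun p : E × ℝ => u (s p.1) p.2 :=
    measurable_comp_uncurry hu (hs.comp measurable_fst) measurable_snd
  exact Measurable.lintegral_prod_right' (f := S.indicator fun p => 1 - nexp (u (s p.1) p.2))
    ((measurable_const.sub (measurable_nexp.comp hup)).indicator hS)

lemma measurableSet_orderedRadii (k : ℕ) : MeasurableSet (orderedRadii k) := by
  have : orderedRadii k = (⋂ j, {r | 0 < r j}) ∩ ⋂ i, ⋂ j, ⋂ (_ : i < j), {r | r i < r j} := by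
    ext r
    simp [orderedRadii, StrictMono]
  rw [this]
  refine (MeasurableSet.iInter fun j => measurableSet_lt measurable_const
    (measurable_pi_apply j)).inter (MeasurableSet.iInter fun i => MeasurableSet.iInter fun j =>
    MeasurableSet.iInter fun _ => measurableSet_lt (measurable_pi_apply i) (measurable_pi_apply j))

lemma measurable_uncurry_fadingLoss (p α : ℝ) : Measurable (Function.uncurry (fadingLoss p α)) := by
  have : Measurable fun q : ℝ × ℝ => ENNReal.ofReal (Real.log (1 + q.1 * (p * q.2 ^ (-α)))) := by
    fun_prop
  exact this

lemma measurable_uncurry_fadingLoss_div (p α θ b : ℝ) :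
    Measurable (Function.uncurry fun C t => fadingLoss p α (θ / C) √(t / b)) :=
  measurable_comp_uncurry (measurable_uncurry_fadingLoss p α)
    (a := fun q : ℝ × ℝ => θ / q.1) (b := fun q => √(q.2 / b)) (by fun_prop) (by fun_prop)

/-- The joint law of the `k` closest stations and of the stations beyond. -/
theorem IsUnitPoisson.lintegral_radii {μ : Measure (ℕ → ℝ)} (hμ : IsUnitPoisson μ) (N : Params)
    (k : ℕ) [NeZero k] {Φ : (Fin k → ℝ) → ℝ≥0∞} (hΦ : Measurable Φ) {v : ℝ → ℝ → ℝ≥0∞}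
    (hv : Measurable (Function.uncurry v)) {C : (Fin k → ℝ) → ℝ} (hC : Measurable C) :
    ∫⁻ T, Φ (radii N Tier.sbs k T) *
        nexp (∑' j, v (C (radii N Tier.sbs k T)) (T (j + k))) ∂μ =
      ∫⁻ r in orderedRadii k, .ofReal (fGamma N r) * (Φ r *
        nexp (∫⁻ t in Set.Ioi (rate N Tier.sbs * lastRadius r ^ 2), (1 - nexp (v (C r) t)))) := by
  set b := rate N Tier.sbs with hb
  have hb0 : 0 < b := rate_pos N Tier.sbs
  have hCm : Measurable fun T => C (radii N Tier.sbs k T) := hC.comp (measurable_radii _ _)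
  have hΨ : Measurable fun T : ℕ → ℝ => Φ (radii N Tier.sbs k T) *
        nexp (∑' j, v (C (radii N Tier.sbs k T)) (T (j + k))) :=
    (hΦ.comp (measurable_radii _ _)).mul (measurable_nexp.comp (Measurable.tsum fun j =>
      measurable_comp_uncurry hv hCm (measurable_pi_apply (j + k))))
  have h0 := hμ.lintegral_delay_radii hb0 k hΨ (a := 0) le_rfl
  have hd : ∀ T, delay (b * 0 ^ 2) T = T := fun T => by ext; simp [delay]
  simp only [hd] at h0
  rw [h0, ← lintegral_indicator (measurableSet_orderedRadii k)]
  have hset : {r : Fin k → ℝ | StrictMono (Fin.cons 0 r : Fin (k + 1) → ℝ)} = orderedRadii k := by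
    ext r
    simp only [Set.mem_ofPred_eq, Fin.strictMono_cons, orderedRadii]
  rw [hset]
  refine lintegral_congr fun r => ?_
  by_cases hr : r ∈ orderedRadii k
  swap
  · rw [Set.indicator_of_notMem hr, Set.indicator_of_notMem hr]
  rw [Set.indicator_of_mem hr, Set.indicator_of_mem hr]
  have hlast : (Fin.cons 0 r : Fin (k + 1) → ℝ) (Fin.last k) = lastRadius r := by
    have : Fin.last k = Fin.succ ⟨k - 1, Nat.sub_one_lt (NeZero.ne k)⟩ := by
      ext; simp; have := NeZero.pos k; lia
    rw [this, Fin.cons_succ, lastRadius]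
  have hrad : ∀ T, radii N Tier.sbs k (seqPrepend (fun j => b * r j ^ 2) T) = r := by
    intro T
    ext j
    rw [radii, seqPrepend_of_lt _ _ j.2, ← hb, mul_div_cancel_left₀ _ hb0.ne',
      Real.sqrt_sq (hr.1 j).le]
  simp only [hrad, seqPrepend_add, hlast]
  have hvr : Measurable (v (C r)) := hv.comp measurable_prodMk_left
  rw [lintegral_const_mul (Φ r) (f := fun T => nexp (∑' j, v (C r) (delay (b * lastRadius r ^ 2) T j)))
    ((measurable_nexp_tsum hvr).comp (measurable_delay.comp measurable_prodMk_left)),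
    hμ.laplace_delay hvr, ← mul_assoc]
  congr 1
  rw [nexp_ofReal (by have := sq_nonneg (lastRadius r); simp; positivity),
    ← ENNReal.ofReal_prod_of_nonneg (fun j _ => by have := (hr.1 j).le; positivity),
    ← ENNReal.ofReal_mul (Finset.prod_nonneg fun j _ => by have := (hr.1 j).le; positivity)]
  congr 1
  rw [fGamma, Finset.prod_mul_distrib, Finset.prod_const, Finset.card_univ, Fintype.card_fin, hb,
    rate, show 2 * (Real.pi * N.lam Tier.sbs) = 2 * Real.pi * N.lam Tier.sbs by ring,
    show -(Real.pi * N.lam Tier.sbs * (lastRadius r ^ 2 - 0 ^ 2)) =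
      -N.lam Tier.sbs * Real.pi * lastRadius r ^ 2 by ring]
  ring

/-- By renewal the first arrival has a density, so it has no atoms. -/
lemma IsUnitPoisson.measure_eq {μ : Measure (ℕ → ℝ)} (hμ : IsUnitPoisson μ) (a : ℝ) :
    μ {T | T 0 = a} = 0 := by
  have := hμ.isProbabilityMeasure
  have hS : MeasurableSet {T : ℕ → ℝ | T 0 = a} :=
    measurableSet_eq_fun (measurable_pi_apply 0) measurable_const
  rw [← lintegral_indicator_one hS, hμ.lintegral_eq_lintegral_Ioi (measurable_one.indicator hS)]
  refine lintegral_eq_zero_of_ae_eq_zero ?_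
  have : ∀ᵐ t ∂(volume.restrict (Set.Ioi (0 : ℝ))), t ≠ a := by
    refine ae_restrict_of_ae ?_
    simp [ae_iff]
  filter_upwards [this] with t ht
  simp [Set.indicator, ht]

section Measurable

variable {Ω : Type*} [MeasurableSpace Ω] {X : Tier → ℕ → Ω → Plane}

lemma measurable_clusterRSS (N : Params) (k : ℕ) (hX : ∀ i j, Measurable (X i j)) :
    Measurable (clusterRSS N k X) :=
  Finset.measurable_sum _ fun j _ => by
    have := hX Tier.sbs j
    fun_prop

lemma measurable_macroRSS (N : Params) (hX : ∀ i j, Measurable (X i j)) :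
    Measurable (macroRSS N X) := by
  have := hX Tier.mbs 0
  unfold macroRSS; fun_prop

lemma measurableSet_assocS (N : Params) (k : ℕ) (hX : ∀ i j, Measurable (X i j)) :
    MeasurableSet (assocS N k X) :=
  measurableSet_lt (measurable_macroRSS N hX) (measurable_clusterRSS N k hX)

lemma measurableSet_assocM (N : Params) (k : ℕ) (hX : ∀ i j, Measurable (X i j)) :
    MeasurableSet (assocM N k X) :=
  measurableSet_lt (measurable_clusterRSS N k hX) (measurable_macroRSS N hX)

end Measurable

section Network

variable {Ω : Type*} [MeasurableSpace Ω] {P : Measure Ω} [IsProbabilityMeasure P]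
  {N : Params} {X : Tier → ℕ → Ω → Plane} {g : Tier → ℕ → Ω → ℂ}

namespace IsNetwork

lemma measurable {P : Measure Ω} (hN : IsNetwork N X g P) (i : Tier) (j : ℕ) :
    Measurable (X i j) :=
  (hN.poisson i).measurable j

lemma ae_clusterRSS_pos (hN : IsNetwork N X g P) (k : ℕ) [NeZero k] :
    ∀ᵐ ω ∂P, 0 < clusterRSS N k X ω := by
  filter_upwards [hN.ae_norm_pos Tier.sbs] with ω hω
  rw [clusterRSS_eq]; exact clusterPower_pos fun j => hω j

/-- Given the small cells, a tie forces the first macro arrival to equal one prescribed number. -/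
lemma measure_tie (hN : IsNetwork N X g P) (k : ℕ) [NeZero k] :
    P {ω | macroRSS N X ω = clusterRSS N k X ω} = 0 := by
  have hμ := hN.isUnitPoisson Tier.mbs
  set b := rate N Tier.mbs with hb
  have hb0 : 0 < b := rate_pos N Tier.mbs
  have hTm := hN.measurable_arrivalTimes Tier.mbs
  have hTs := hN.measurable_arrivalTimes Tier.sbs
  let C : (ℕ → ℝ) → ℝ := fun ts => clusterPower N (radii N Tier.sbs k ts)
  have hCm : Measurable C := (measurable_clusterPower N k).comp (measurable_radii _ _)
  have hCω : ∀ ω, C (arrivalTimes N X Tier.sbs ω) = clusterRSS N k X ω := fun ω => by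
    simp only [C]; rw [radii_arrivalTimes, clusterRSS_eq]
  let S : Set ((ℕ → ℝ) × (ℕ → ℝ)) := {p | N.pow Tier.mbs * √(p.2 0 / b) ^ (-N.α) = C p.1}
  have hS : MeasurableSet S := measurableSet_eq_fun (by fun_prop) (hCm.comp measurable_fst)
  have h1 : {ω | macroRSS N X ω = clusterRSS N k X ω} = (fun ω => (arrivalTimes N X Tier.sbs ω,
      arrivalTimes N X Tier.mbs ω)) ⁻¹' S := by
    ext ω
    simp only [macroRSS, Set.mem_ofPred_eq, Set.mem_preimage, S, hCω, hb, sqrt_arrivalTimes]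
  have h2 := lintegral_of_indepFun hTs hTm hN.indepFun_arrivalTimes.symm
    (H := S.indicator 1) (measurable_one.indicator hS)
  rw [h1, ← lintegral_indicator_one (hS.preimage (hTs.prodMk hTm))]
  refine Eq.trans (by rfl) (h2.trans (lintegral_eq_zero_of_ae_eq_zero ?_))
  filter_upwards [hN.ae_clusterRSS_pos k] with ω hω
  rw [← lintegral_map (f := fun tm => S.indicator 1 (arrivalTimes N X Tier.sbs ω, tm))
    ((measurable_one.indicator hS).comp measurable_prodMk_left) hTm]
  refine lintegral_eq_zero_of_ae_eq_zero ?_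
  have h3 : ∀ᵐ tm ∂(P.map (arrivalTimes N X Tier.mbs)),
      tm 0 ≠ b * ((N.pow Tier.mbs / clusterRSS N k X ω) ^ (1 / N.α)) ^ 2 := by
    rw [ae_iff]; simpa using hμ.measure_eq _
  filter_upwards [hμ.ae_pos, h3] with tm htm hne
  refine Set.indicator_of_notMem (fun h => hne ?_) _
  simp only [S, Set.mem_ofPred_eq, hCω] at h
  have hx : 0 < √(tm 0 / b) := Real.sqrt_pos.2 (div_pos (htm 0) hb0)
  have e1 := (mul_rpow_neg_lt_iff (N.pow_pos Tier.mbs) (α_pos N) hω hx).not.1 h.not_lt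
  have e2 := (lt_mul_rpow_neg_iff (N.pow_pos Tier.mbs) (α_pos N) hω hx).not.1 h.not_gt
  have e3 := le_antisymm (not_lt.1 e1) (not_lt.1 e2)
  rw [← e3, Real.sq_sqrt (div_pos (htm 0) hb0).le]
  field_simp

/-- Averaged void probability of the disc of radius η^(1/α) for the macro tier. It is positive and
almost surely less than 1, whence the strict bounds on `probS`. -/
lemma measure_assocS (hN : IsNetwork N X g P) (k : ℕ) [NeZero k] :
    P (assocS N k X) = ∫⁻ ω, nexp (.ofReal (rate N Tier.mbs *
          (eta N (fun j : Fin k => ‖X Tier.sbs j ω‖) ^ (1 / N.α)) ^ 2)) ∂P := by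
  have := hN.setLIntegral_assocS k (W := fun _ => 1) measurable_const (u := fun _ _ => 0)
    measurable_const
  simpa [nexp_zero] using this

lemma probS_pos (hN : IsNetwork N X g P) (k : ℕ) [NeZero k] : 0 < probS N k X P := by
  refine ENNReal.toReal_pos (fun h => ?_) (measure_ne_top _ _)
  rw [hN.measure_assocS k] at h
  have hm : Measurable fun ω => nexp (.ofReal (rate N Tier.mbs *
          (eta N (fun j : Fin k => ‖X Tier.sbs j ω‖) ^ (1 / N.α)) ^ 2)) := by
    simp_rw [eta_eq, ← clusterRSS_eq]
    have := measurable_clusterRSS N k hN.measurable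
    fun_prop
  rw [lintegral_eq_zero_iff hm] at h
  obtain ⟨ω, hω⟩ := h.exists
  simp only [Pi.zero_apply] at hω
  rw [nexp_ofReal (by have := rate_pos N Tier.mbs; positivity)] at hω
  exact (ENNReal.ofReal_pos.2 (Real.exp_pos _)).ne' hω

lemma probS_lt_one (hN : IsNetwork N X g P) (k : ℕ) [NeZero k] : probS N k X P < 1 := by
  have h : P (assocS N k X) < 1 := by
    rw [hN.measure_assocS k]
    have : (1 : ℝ≥0∞) = ∫⁻ _, 1 ∂P := by simp
    conv_rhs => rw [this]
    refine lintegral_strict_mono (IsProbabilityMeasure.ne_zero P) aemeasurable_const ?_ ?_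
    · rw [← hN.measure_assocS k]; exact measure_ne_top _ _
    · filter_upwards [hN.ae_norm_pos Tier.sbs] with ω hω
      rw [← nexp_zero]
      refine strictAnti_nexp ?_
      have h1 := eta_pos (N := N) (r := fun j : Fin k => ‖X Tier.sbs j ω‖) fun j => hω j
      have h2 := rate_pos N Tier.mbs
      rw [ENNReal.ofReal_pos]; positivity
  simpa [probS, measureReal_def] using (ENNReal.toReal_lt_toReal (measure_ne_top _ _) (by simp)).2 h

lemma measureReal_assocM (hN : IsNetwork N X g P) (k : ℕ) [NeZero k] :
    P.real (assocM N k X) = 1 - probS N k X P := by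
  have h : P.real (assocM N k X) = P.real (assocS N k X)ᶜ := by
    refine measureReal_congr ?_
    have h1 : ∀ᵐ ω ∂P, macroRSS N X ω ≠ clusterRSS N k X ω := by
      rw [ae_iff]; simpa using hN.measure_tie k
    filter_upwards [h1] with ω hω
    refine propext ⟨fun h => ?_, fun h => ?_⟩
    · exact not_lt.2 (le_of_lt (show clusterRSS N k X ω < macroRSS N X ω from h))
    · exact lt_of_le_of_ne (not_lt.1 h) hω.symm
  rw [h, probReal_compl_eq_one_sub (measurableSet_assocS N k hN.measurable), probS]

end IsNetwork

end Network

/-! ### Coverage of a user of the small-cell cluster -/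

/-- Integrability needs no estimate: the integrand, multiplied by the probability `c` of the
conditioning event, has a finite integral because that integral is a probability. -/
lemma integrableOn_of_lintegral {E : Type*} [MeasurableSpace E] {ν : Measure E} {S : Set E}
    (hS : MeasurableSet S) {K : E → ℝ≥0∞} (hK : Measurable K) {f : E → ℝ} {c : ℝ} (hc : 0 < c)
    (h0 : ∀ x ∈ S, 0 ≤ f x) (h : ∀ x ∈ S, K x = .ofReal (c * f x)) (hfin : ∫⁻ x in S, K x ∂ν ≠ ∞) :
    IntegrableOn f S ν ∧ ∫ x in S, f x ∂ν = c⁻¹ * (∫⁻ x in S, K x ∂ν).toReal := by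
  have hf : ∀ x ∈ S, f x = c⁻¹ * (K x).toReal := fun x hx => by
    rw [h x hx, ENNReal.toReal_ofReal (mul_nonneg hc.le (h0 x hx))]; field_simp
  have hi := integrable_toReal_of_lintegral_ne_top hK.aemeasurable hfin
  refine ⟨(integrableOn_congr_fun hf hS).2 (hi.const_mul _), ?_⟩
  rw [setIntegral_congr_fun hS hf, integral_const_mul, integral_toReal hK.aemeasurable]
  exact ae_lt_top hK hfin

lemma tierLaplace_pos (N : Params) (i : Tier) (d s : ℝ) : 0 < tierLaplace N i d s := Real.exp_pos _

lemma fGamma_nonneg (N : Params) {k : ℕ} [NeZero k] {r : Fin k → ℝ} (hr : ∀ j, 0 < r j) :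
    0 ≤ fGamma N r := by
  have h1 := N.lam_pos Tier.sbs
  have h2 : 0 ≤ ∏ j, r j := Finset.prod_nonneg fun j _ => (hr j).le
  have := Real.pi_pos
  unfold fGamma; positivity

section Network

variable {Ω : Type*} [MeasurableSpace Ω] {P : Measure Ω} [IsProbabilityMeasure P]
  {N : Params} {X : Tier → ℕ → Ω → Plane} {g : Tier → ℕ → Ω → ℂ}

namespace IsNetwork

lemma ae_lastRadius_le {P : Measure Ω} (hN : IsNetwork N X g P) (k : ℕ) [NeZero k] :
    ∀ᵐ ω ∂P, ∀ j, k ≤ j → lastRadius (fun i : Fin k => ‖X Tier.sbs i ω‖) ≤ ‖X Tier.sbs j ω‖ := by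
  filter_upwards [hN.ordered Tier.sbs] with ω hω j hj
  exact hω ((Nat.sub_le k 1).trans hj)

lemma ae_eta_le (hN : IsNetwork N X g P) (k : ℕ) [NeZero k] :
    ∀ᵐ ω ∂P, ω ∈ assocS N k X →
      ∀ j, eta N (fun i : Fin k => ‖X Tier.sbs i ω‖) ^ (1 / N.α) ≤ ‖X Tier.mbs j ω‖ := by
  filter_upwards [hN.ordered Tier.mbs, hN.ae_norm_pos Tier.mbs, hN.ae_clusterRSS_pos k]
    with ω hm hpos hC hω j
  refine le_trans (le_of_lt ?_) (hm (Nat.zero_le j))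
  rw [eta_eq, ← clusterRSS_eq]
  exact (mul_rpow_neg_lt_iff (N.pow_pos _) (α_pos N) hC (hpos 0)).1 hω

/-- Coverage by the cluster, as an integral over the distances of its stations. -/
theorem measure_assocS_inter_covered (hN : IsNetwork N X g P) (k : ℕ) [NeZero k] {θ : ℝ}
    (hθ : 0 < θ) :
    ∃ K : (Fin k → ℝ) → ℝ≥0∞, Measurable K ∧
      P (assocS N k X ∩ covered N θ X g (clusterSet k)) = ∫⁻ r in orderedRadii k, K r ∧
      ∀ r ∈ orderedRadii k, K r = .ofReal (probS N k X P * integrandS N θ X P r) := by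
  set bm := rate N Tier.mbs with hbm
  set bs := rate N Tier.sbs with hbs
  let u : ℝ → ℝ → ℝ≥0∞ := fun C x => fadingLoss (N.pow Tier.mbs) N.α (θ / C) x
  have hu : Measurable (Function.uncurry u) :=
    measurable_comp_uncurry (measurable_uncurry_fadingLoss (N.pow Tier.mbs) N.α)
      (a := fun q : ℝ × ℝ => θ / q.1) (b := fun q => q.2) (by fun_prop) (by fun_prop)
  have hut : Measurable (Function.uncurry fun C t => u C √(t / bm)) :=
    measurable_uncurry_fadingLoss_div _ _ _ _
  let v : ℝ → ℝ → ℝ≥0∞ := fun C t => fadingLoss (N.pow Tier.sbs) N.α (θ / C) √(t / bs)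
  have hv : Measurable (Function.uncurry v) := measurable_uncurry_fadingLoss_div _ _ _ _
  have hcp := measurable_clusterPower N k
  have hlast : Measurable fun r : Fin k → ℝ => lastRadius r := measurable_pi_apply _
  have hη : Measurable fun r : Fin k → ℝ => bm * (eta N r ^ (1 / N.α)) ^ 2 := by
    simp_rw [eta_eq]; fun_prop
  let w : (Fin k → ℝ) → ℝ≥0∞ := fun r =>
    nexp (.ofReal (θ / clusterPower N r) * .ofReal N.noise)
  have hw : Measurable w := by fun_prop
  let Φ : (Fin k → ℝ) → ℝ≥0∞ := fun r => w r * (nexp (.ofReal (bm * (eta N r ^ (1 / N.α)) ^ 2)) *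
      nexp (∫⁻ t in Set.Ioi (bm * (eta N r ^ (1 / N.α)) ^ 2),
        (1 - nexp (u (clusterPower N r) √(t / bm)))))
  have hΦ : Measurable Φ :=
    hw.mul ((measurable_nexp.comp hη.ennreal_ofReal).mul (measurable_nexp_lintegral_Ioi hut hη hcp))
  have hCT : Measurable fun T : ℕ → ℝ => clusterPower N (radii N Tier.sbs k T) :=
    hcp.comp (measurable_radii Tier.sbs k)
  have hvj : ∀ j, Measurable fun T : ℕ → ℝ =>
      v (clusterPower N (radii N Tier.sbs k T)) (T (j + k)) := fun j =>
    measurable_comp_uncurry hv hCT (measurable_pi_apply (j + k))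
  have hvT : Measurable fun T : ℕ → ℝ =>
      nexp (∑' j, v (clusterPower N (radii N Tier.sbs k T)) (T (j + k))) :=
    measurable_nexp.comp (Measurable.tsum hvj)
  let W : (ℕ → ℝ) → ℝ≥0∞ := fun T => w (radii N Tier.sbs k T) *
    nexp (∑' j, v (clusterPower N (radii N Tier.sbs k T)) (T (j + k)))
  have hW : Measurable W := (hw.comp (measurable_radii _ _)).mul hvT
  refine ⟨fun r => .ofReal (fGamma N r) * (Φ r *
    nexp (∫⁻ t in Set.Ioi (bs * lastRadius r ^ 2), (1 - nexp (v (clusterPower N r) t)))), ?_, ?_, ?_⟩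
  · have h1 : Measurable fun r : Fin k → ℝ => fGamma N r := by
      unfold fGamma
      have : Measurable fun r : Fin k → ℝ => ∏ j, r j :=
        Finset.measurable_prod _ fun j _ => measurable_pi_apply j
      fun_prop
    exact h1.ennreal_ofReal.mul (hΦ.mul
      (measurable_nexp_lintegral_Ioi hv ((hlast.pow_const 2).const_mul bs) hcp))
  · have h1 := hN.measure_inter_covered (clusterSet k) hθ
      (D := assocS N k fun i j (x : Tier → ℕ → Plane) => x i j)
      (measurableSet_assocS N k fun i j => by fun_prop) (C := clusterRSS N k X)
      (fun ω => by rw [clusterSet, Finset.sum_product, Finset.sum_singleton]; rfl)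
      (hN.ae_clusterRSS_pos k)
    refine Eq.trans (by rfl) (h1.trans ?_)
    have h2 : ∀ ω, nexp (.ofReal (θ / clusterRSS N k X ω) * .ofReal N.noise +
        ∑' x : {x // x ∉ clusterSet k}, fadingLoss (N.pow x.1.1) N.α (θ / clusterRSS N k X ω)
          ‖X x.1.1 x.1.2 ω‖) = W (arrivalTimes N X Tier.sbs ω) *
            nexp (∑' j, u (clusterRSS N k X ω) ‖X Tier.mbs j ω‖) := by
      intro ω
      rw [tsum_notMem_clusterSet k (fun x : Tier × ℕ => fadingLoss (N.pow x.1) N.α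
        (θ / clusterRSS N k X ω) ‖X x.1 x.2 ω‖), nexp_add, nexp_add]
      simp only [W, w, u, v, radii_arrivalTimes, ← clusterRSS_eq, hbs, sqrt_arrivalTimes]
      ring
    simp_rw [h2]
    -- The macro tier is averaged out with the small cells fixed. What remains is a function of the
    -- `k` nearest radii and of the small cells beyond.
    refine (hN.setLIntegral_assocS k hW hu).trans ?_
    have h3 := (hN.isUnitPoisson Tier.sbs).lintegral_radii N k hΦ hv hcp
    refine Eq.trans ?_ h3
    have hΦT : Measurable fun T : ℕ → ℝ => Φ (radii N Tier.sbs k T) :=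
      hΦ.comp (measurable_radii Tier.sbs k)
    have hT : Measurable fun T : ℕ → ℝ => Φ (radii N Tier.sbs k T) *
        nexp (∑' j, v (clusterPower N (radii N Tier.sbs k T)) (T (j + k))) := hΦT.mul hvT
    rw [lintegral_map hT (hN.measurable_arrivalTimes Tier.sbs)]
    refine lintegral_congr fun ω => ?_
    simp only [W, Φ, radii_arrivalTimes, ← clusterRSS_eq]
    ring
  · intro r hr
    have hC := clusterPower_pos (N := N) hr.1
    have hη0 := eta_pos (N := N) hr.1
    have hs : 0 < θ / clusterPower N r := div_pos hθ hC
    have hbm0 : 0 < bm := rate_pos N _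
    have hp := hN.probS_pos k
    simp only [Φ, w, u, v, hbm, hbs]
    rw [nexp_lintegral_fadingLoss N Tier.mbs (Real.rpow_nonneg hη0.le _) hs,
      nexp_lintegral_fadingLoss N Tier.sbs (d := lastRadius r) (hr.1 _).le hs, nexp_ofReal (by positivity),
      ← ENNReal.ofReal_mul hs.le, nexp_ofReal (mul_nonneg hs.le N.noise_nonneg),
      ← ENNReal.ofReal_mul (Real.exp_pos _).le, ← ENNReal.ofReal_mul (Real.exp_pos _).le,
      ← ENNReal.ofReal_mul (by have := tierLaplace_pos N Tier.mbs (eta N r ^ (1 / N.α))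
                                  (θ / clusterPower N r); positivity),
      ← ENNReal.ofReal_mul (fGamma_nonneg N hr.1)]
    congr 1
    rw [integrandS, fRcs, laplaceI, ← Real.rpow_mul_natCast hη0.le,
      show 1 / N.α * ((2 : ℕ) : ℝ) = 2 / N.α by push_cast; ring,
      show -(θ / clusterPower N r * N.noise) = -θ * N.noise / clusterPower N r by ring,
      show -(rate N Tier.mbs * eta N r ^ (2 / N.α)) =
        -Real.pi * N.lam Tier.mbs * eta N r ^ (2 / N.α) by rw [rate]; ring]
    field_simp

lemma integrandS_nonneg (hN : IsNetwork N X g P) (k : ℕ) [NeZero k] (θ : ℝ) {r : Fin k → ℝ}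
    (hr : ∀ j, 0 < r j) : 0 ≤ integrandS N θ X P r := by
  have h1 := fGamma_nonneg N hr
  have h2 := hN.probS_pos k
  have h3 := tierLaplace_pos N
  unfold integrandS fRcs laplaceI
  have := (h3 Tier.mbs (eta N r ^ (1 / N.α)) (θ / clusterPower N r)).le
  have := (h3 Tier.sbs (lastRadius r) (θ / clusterPower N r)).le
  positivity

theorem coverageS_eq (hN : IsNetwork N X g P) (k : ℕ) [NeZero k] {θ : ℝ} (hθ : 0 < θ) :
    IntegrableOn (integrandS N θ (k := k) X P) (orderedRadii k) ∧
      coverageS N θ k X g P = ∫ r in orderedRadii k, integrandS N θ X P r := by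
  obtain ⟨K, hK, h1, h2⟩ := hN.measure_assocS_inter_covered k hθ
  have h3 := integrableOn_of_lintegral (measurableSet_orderedRadii k) hK (hN.probS_pos k)
    (fun r hr => hN.integrandS_nonneg k θ hr.1) h2 (by rw [← h1]; exact measure_ne_top _ _)
  refine ⟨h3.1, ?_⟩
  rw [h3.2, ← h1, coverageS, measureReal_def, cond_apply (measurableSet_assocS N k hN.measurable),
    ENNReal.toReal_mul, ENNReal.toReal_inv]
  rfl

end IsNetwork

end Network

/-! ### Coverage of an MBS user -/

/-- The event, for the arrival times of the small cells, that their cluster is received with less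
power than a macro station at distance `r`. -/
def weakCluster (N : Params) (k : ℕ) (r : ℝ) : Set (ℕ → ℝ) :=
  {T | clusterPower N (radii N Tier.sbs k T) < N.pow Tier.mbs * r ^ (-N.α)}

/-- The factor `exp (-s I)`, averaged over the fading, for the interference `I` of the small
cells. -/
noncomputable def sbsFactor (N : Params) (s : ℝ) (T : ℕ → ℝ) : ℝ≥0∞ :=
  nexp (∑' j, fadingLoss (N.pow Tier.sbs) N.α s √(T j / rate N Tier.sbs))

/-- The Laplace transform of the interference of the small cells on the event that their cluster
is received with less power than a macro station at distance `r`. -/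
noncomputable def weakLaplace (μ : Measure (ℕ → ℝ)) (N : Params) (k : ℕ) (s r : ℝ) : ℝ≥0∞ :=
  ∫⁻ T in weakCluster N k r, sbsFactor N s T ∂μ

lemma measurable_clusterPower_radii (N : Params) (k : ℕ) :
    Measurable fun T => clusterPower N (radii N Tier.sbs k T) :=
  (measurable_clusterPower N k).comp (measurable_radii Tier.sbs k)

lemma measurable_uncurry_sbsFactor (N : Params) : Measurable (Function.uncurry (sbsFactor N)) := by
  have h : ∀ j, Measurable fun q : ℝ × (ℕ → ℝ) =>
      fadingLoss (N.pow Tier.sbs) N.α q.1 √(q.2 j / rate N Tier.sbs) := fun j =>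
    measurable_comp_uncurry (measurable_uncurry_fadingLoss (N.pow Tier.sbs) N.α)
      (a := fun q : ℝ × (ℕ → ℝ) => q.1) (b := fun q => √(q.2 j / rate N Tier.sbs)) (by fun_prop)
      (by fun_prop)
  have h3 : Measurable fun q : ℝ × (ℕ → ℝ) => nexp (∑' j,
      fadingLoss (N.pow Tier.sbs) N.α q.1 √(q.2 j / rate N Tier.sbs)) := 
    measurable_nexp.comp (Measurable.tsum h)
  exact h3

lemma measurable_sbsFactor (N : Params) (s : ℝ) : Measurable (sbsFactor N s) :=
  measurable_comp_uncurry (measurable_uncurry_sbsFactor N) measurable_const measurable_id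

lemma measurableSet_weakCluster (N : Params) (k : ℕ) (r : ℝ) : MeasurableSet (weakCluster N k r) :=
  measurableSet_lt (measurable_clusterPower_radii N k) measurable_const

lemma measurableSet_prod_weakCluster (N : Params) (k : ℕ) :
    MeasurableSet {p : ℝ × (ℕ → ℝ) | p.2 ∈ weakCluster N k p.1} :=
  measurableSet_lt ((measurable_clusterPower_radii N k).comp measurable_snd) (by fun_prop)

lemma measurable_weakLaplace (μ : Measure (ℕ → ℝ)) [SFinite μ] (N : Params) (k : ℕ) {s : ℝ → ℝ}
    (hs : Measurable s) : Measurable fun r => weakLaplace μ N k (s r) r := by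
  have h : Measurable fun p : ℝ × (ℕ → ℝ) => sbsFactor N (s p.1) p.2 :=
    measurable_comp_uncurry (measurable_uncurry_sbsFactor N) (hs.comp measurable_fst) measurable_snd
  simp_rw [weakLaplace, ← lintegral_indicator (measurableSet_weakCluster N k _)]
  exact Measurable.lintegral_prod_right' (h.indicator (measurableSet_prod_weakCluster N k))

section Network

variable {Ω : Type*} [MeasurableSpace Ω] {P : Measure Ω} [IsProbabilityMeasure P]
  {N : Params} {X : Tier → ℕ → Ω → Plane} {g : Tier → ℕ → Ω → ℂ}

namespace IsNetwork

/-- Coverage by the closest macro station, as an integral over its distance. -/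
theorem measure_assocM_inter_covered (hN : IsNetwork N X g P) (k : ℕ) {θ : ℝ} (hθ : 0 < θ) :
    ∃ K : ℝ → ℝ≥0∞, Measurable K ∧
      (∀ A, MeasurableSet A → P (assocM N k X ∩ (covered N θ X g macroSet ∩
        {ω | ‖X Tier.mbs 0 ω‖ ∈ A})) = ∫⁻ r in A ∩ Set.Ioi 0, K r) ∧
      ∀ r, 0 < r → K r = .ofReal (macroPDF N r *
        (Real.exp (-((N.pow Tier.mbs)⁻¹ * θ * r ^ N.α * N.noise)) *
          tierLaplace N Tier.mbs r ((N.pow Tier.mbs)⁻¹ * θ * r ^ N.α))) *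
        weakLaplace (P.map (arrivalTimes N X Tier.sbs)) N k
          ((N.pow Tier.mbs)⁻¹ * θ * r ^ N.α) r := by
  set b := rate N Tier.mbs with hb
  have hb0 : 0 < b := rate_pos N Tier.mbs
  have hμ := hN.isUnitPoisson Tier.mbs
  have hμs := hN.isUnitPoisson Tier.sbs
  have hTm := hN.measurable_arrivalTimes Tier.mbs
  have hTs := hN.measurable_arrivalTimes Tier.sbs
  set μs := P.map (arrivalTimes N X Tier.sbs) with hμs_def
  have := hμs.isProbabilityMeasure
  let p := N.pow Tier.mbs
  have hp : 0 < p := N.pow_pos _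
  -- The value θ/C for an MBS at distance `r`, written as it comes from the received power; it
  -- agrees with P_m⁻¹ θ r^α for positive `r`.
  let s : ℝ → ℝ := fun r => θ / (p * r ^ (-N.α))
  have hs : Measurable s := by fun_prop
  have hs_eq : ∀ r, 0 < r → s r = p⁻¹ * θ * r ^ N.α := fun r hr => by
    simp only [s]
    rw [Real.rpow_neg hr.le]
    have := Real.rpow_pos_of_pos hr N.α
    field_simp
  let v : ℝ → ℝ → ℝ≥0∞ := fun r t => fadingLoss p N.α (s r) √(t / b)
  have hv : Measurable (Function.uncurry v) :=
    measurable_comp_uncurry (measurable_uncurry_fadingLoss p N.α)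
      (a := fun q : ℝ × ℝ => s q.1) (b := fun q => √(q.2 / b)) (by fun_prop) (by fun_prop)
  let n : ℝ → ℝ≥0∞ := fun r => nexp (.ofReal (s r) * .ofReal N.noise)
  have hn : Measurable n := by fun_prop
  let Q : ℝ → ℝ≥0∞ := fun r => weakLaplace μs N k (s r) r
  have hQ : Measurable Q := measurable_weakLaplace μs N k hs
  let K : ℝ → ℝ≥0∞ := fun r => .ofReal (2 * b * r) * (nexp (.ofReal (b * r ^ 2)) *
    (n r * Q r * nexp (∫⁻ t in Set.Ioi (b * r ^ 2), (1 - nexp (v r t)))))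
  have hK : Measurable K := by
    have h1 : Measurable fun r : ℝ => nexp (∫⁻ t in Set.Ioi (b * r ^ 2), (1 - nexp (v r t))) :=
      measurable_nexp_lintegral_Ioi hv (by fun_prop) measurable_id
    fun_prop
  refine ⟨K, hK, ?_, ?_⟩
  · intro A hA
    let D : Set (Tier → ℕ → Plane) := assocM N k (fun i j (x : Tier → ℕ → Plane) => x i j) ∩
      {x | ‖x Tier.mbs 0‖ ∈ A}
    have hD : MeasurableSet D :=
      (measurableSet_assocM N k fun i j => by fun_prop).inter
        ((by fun_prop : Measurable fun x : Tier → ℕ → Plane => ‖x Tier.mbs 0‖) hA)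
    have hpos := hN.ae_norm_pos Tier.mbs
    have h1 := hN.measure_inter_covered macroSet hθ hD (C := macroRSS N X)
      (fun ω => by rw [macroSet, Finset.sum_singleton]; rfl)
      (by filter_upwards [hpos] with ω hω
          exact mul_pos hp (Real.rpow_pos_of_pos (hω 0) _))
    have hset : assocM N k X ∩ (covered N θ X g macroSet ∩ {ω | ‖X Tier.mbs 0 ω‖ ∈ A}) =
        {ω | (fun i j => X i j ω) ∈ D} ∩ covered N θ X g macroSet := by
      rw [Set.inter_comm (covered N θ X g macroSet), ← Set.inter_assoc]; rfl
    rw [hset, h1]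
    let R : (ℕ → ℝ) → ℝ := fun T => √(T 0 / b)
    have hR : Measurable R := by fun_prop
    let S : Set ((ℕ → ℝ) × (ℕ → ℝ)) := {q | R q.1 ∈ A ∧ q.2 ∈ weakCluster N k (R q.1)}
    have hS : MeasurableSet S := ((hR.comp measurable_fst) hA).inter
      (((hR.comp measurable_fst).prodMk measurable_snd) (measurableSet_prod_weakCluster N k))
    let V : (ℕ → ℝ) → ℝ≥0∞ := fun T => n (R T) * nexp (∑' j, v (R T) (T (j + 1)))
    have hV : Measurable V := by
      have h2 : ∀ j, Measurable fun T : ℕ → ℝ => v (R T) (T (j + 1)) := fun j =>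
        measurable_comp_uncurry hv hR (measurable_pi_apply (j + 1))
      exact (hn.comp hR).mul (measurable_nexp.comp (Measurable.tsum h2))
    let H : (ℕ → ℝ) × (ℕ → ℝ) → ℝ≥0∞ := fun q => V q.1 * sbsFactor N (s (R q.1)) q.2
    have hH : Measurable H := (hV.comp measurable_fst).mul
      (measurable_comp_uncurry (measurable_uncurry_sbsFactor N)
        (hs.comp (hR.comp measurable_fst)) measurable_snd)
    have hDX : MeasurableSet {ω | (fun i j => X i j ω) ∈ D} :=
      hD.preimage (measurable_pi_lambda _ fun i => measurable_pi_lambda _ fun j => hN.measurable i j)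
    have hRω : ∀ ω, R (arrivalTimes N X Tier.mbs ω) = ‖X Tier.mbs 0 ω‖ := fun ω =>
      sqrt_arrivalTimes _ _ _
    have h2 : ∀ ω, {ω | (fun i j => X i j ω) ∈ D}.indicator (fun ω =>
        nexp (.ofReal (θ / macroRSS N X ω) * .ofReal N.noise +
        ∑' x : {x // x ∉ macroSet}, fadingLoss (N.pow x.1.1) N.α (θ / macroRSS N X ω)
          ‖X x.1.1 x.1.2 ω‖)) ω = S.indicator H (arrivalTimes N X Tier.mbs ω,
            arrivalTimes N X Tier.sbs ω) := by
      intro ω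
      have hiff : ω ∈ {ω | (fun i j => X i j ω) ∈ D} ↔ (arrivalTimes N X Tier.mbs ω,
            arrivalTimes N X Tier.sbs ω) ∈ S := by
        simp only [S, weakCluster, Set.mem_ofPred_eq, hRω, radii_arrivalTimes, ← clusterRSS_eq]
        exact and_comm
      by_cases h : ω ∈ {ω | (fun i j => X i j ω) ∈ D}
      · rw [Set.indicator_of_mem h, Set.indicator_of_mem (hiff.1 h),
          tsum_notMem_macroSet (fun x : Tier × ℕ => fadingLoss (N.pow x.1) N.α
          (θ / macroRSS N X ω) ‖X x.1 x.2 ω‖), nexp_add, nexp_add]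
        simp only [H, V, n, v, hRω, sbsFactor, hb, sqrt_arrivalTimes]
        exact (mul_assoc _ _ _).symm
      · rw [Set.indicator_of_notMem h, Set.indicator_of_notMem (mt hiff.2 h)]
    rw [← lintegral_indicator hDX]
    simp_rw [h2]
    -- Now the macro tier is the outer integral: given its nearest distance, the small cells
    -- contribute the factor `Q`, and the later macro arrivals an independent Laplace factor.
    rw [lintegral_of_indepFun hTm hTs hN.indepFun_arrivalTimes (hH.indicator hS)]
    have hRA : MeasurableSet {T | R T ∈ A} := hR hA
    have h3 : ∀ T, ∫⁻ ω', S.indicator H (T, arrivalTimes N X Tier.sbs ω') ∂P =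
        {T | R T ∈ A}.indicator (fun T => V T * Q (R T)) T := by
      intro T
      rw [← lintegral_map (f := fun ts => S.indicator H (T, ts))
        ((hH.indicator hS).comp measurable_prodMk_left) hTs]
      by_cases hT : R T ∈ A
      · rw [Set.indicator_of_mem (show T ∈ {T | R T ∈ A} from hT)]
        simp only [Q, weakLaplace]
        rw [← lintegral_const_mul _ (measurable_sbsFactor N _),
          ← lintegral_indicator (measurableSet_weakCluster N k _)]
        refine lintegral_congr fun ts => ?_
        by_cases hts : ts ∈ weakCluster N k (R T)
        · rw [Set.indicator_of_mem hts, Set.indicator_of_mem (show (T, ts) ∈ S from ⟨hT, hts⟩)]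
        · rw [Set.indicator_of_notMem hts, Set.indicator_of_notMem fun h => hts h.2]
      · rw [Set.indicator_of_notMem (show T ∉ {T | R T ∈ A} from hT)]
        refine lintegral_eq_zero_of_ae_eq_zero (ae_of_all _ fun ts => ?_)
        exact Set.indicator_of_notMem (fun h => hT h.1) _
    have hVQ : Measurable fun T => V T * Q (R T) := hV.mul (hQ.comp hR)
    simp_rw [h3]
    rw [← lintegral_map (hVQ.indicator hRA) hTm]
    -- One renewal step from radius 0 produces the density of the nearest MBS and leaves a delayed
    -- process of macro interferers.
    have h4 := hμ.lintegral_delay_radius (hVQ.indicator hRA) hb0 (a := 0) le_rfl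
    have hd : ∀ T, delay (b * 0 ^ 2) T = T := fun T => by ext; simp [delay]
    simp only [hd] at h4
    rw [h4, ← lintegral_indicator measurableSet_Ioi, ← lintegral_indicator
      (hA.inter measurableSet_Ioi)]
    refine lintegral_congr fun r => ?_
    by_cases hr : r ∈ Set.Ioi (0 : ℝ)
    swap
    · rw [Set.indicator_of_notMem hr, Set.indicator_of_notMem fun h => hr h.2]
    have hr0 : 0 < r := hr
    have hRr : ∀ T, R (seqCons (b * r ^ 2) T) = r := fun T => by
      simp only [R, seqCons_zero]
      rw [mul_div_cancel_left₀ _ hb0.ne', Real.sqrt_sq hr0.le]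
    rw [Set.indicator_of_mem hr]
    by_cases hrA : r ∈ A
    · rw [Set.indicator_of_mem (show r ∈ A ∩ Set.Ioi 0 from ⟨hrA, hr⟩)]
      have h5 : ∀ T, {T | R T ∈ A}.indicator (fun T => V T * Q (R T))
          (seqCons (b * r ^ 2) (delay (b * r ^ 2) T)) =
          n r * Q r * nexp (∑' j, v r (delay (b * r ^ 2) T j)) := by
        intro T
        rw [Set.indicator_of_mem (show _ ∈ {T | R T ∈ A} by
          rw [Set.mem_ofPred_eq, hRr]; exact hrA)]
        simp only [V, hRr, seqCons_succ]
        ring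
      have hvr : Measurable (v r) := measurable_comp_uncurry hv measurable_const measurable_id
      simp_rw [h5]
      rw [lintegral_const_mul (n r * Q r) (f := fun T => nexp (∑' j, v r (delay (b * r ^ 2) T j)))
        ((measurable_nexp_tsum hvr).comp (measurable_delay.comp measurable_prodMk_left)),
        hμ.laplace_delay hvr, show b * (r ^ 2 - 0 ^ 2) = b * r ^ 2 by ring]
    · rw [Set.indicator_of_notMem (fun h => hrA h.1)]
      have h5 : ∀ T, {T | R T ∈ A}.indicator (fun T => V T * Q (R T))
          (seqCons (b * r ^ 2) (delay (b * r ^ 2) T)) = 0 := fun T =>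
        Set.indicator_of_notMem (by rw [Set.mem_ofPred_eq, hRr]; exact hrA) _
      simp [h5]
  · intro r hr
    have hsr := hs_eq r hr
    have hs0 : 0 < s r := by
      rw [hsr]; have := Real.rpow_pos_of_pos hr N.α; positivity
    simp only [K, n, Q, v, hb]
    rw [nexp_lintegral_fadingLoss N Tier.mbs hr.le hs0, nexp_ofReal (by positivity),
      ← ENNReal.ofReal_mul hs0.le, nexp_ofReal (mul_nonneg hs0.le N.noise_nonneg), hsr]
    have e : macroPDF N r = 2 * rate N Tier.mbs * r * Real.exp (-(rate N Tier.mbs * r ^ 2)) := by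
      rw [macroPDF, rate, show -(Real.pi * N.lam Tier.mbs * r ^ 2) =
        -Real.pi * N.lam Tier.mbs * r ^ 2 by ring]
      ring
    have h1 : 0 ≤ 2 * rate N Tier.mbs * r := by positivity
    rw [e, ENNReal.ofReal_mul (mul_nonneg h1 (Real.exp_pos _).le), ENNReal.ofReal_mul h1,
      ENNReal.ofReal_mul (Real.exp_pos _).le]
    ring

lemma gFun_eq {P : Measure Ω} (hN : IsNetwork N X g P) (k : ℕ) (r : ℝ) :
    gFun N k X P r = (P.map (arrivalTimes N X Tier.sbs)).real (weakCluster N k r) := by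
  rw [measureReal_def, Measure.map_apply (hN.measurable_arrivalTimes _)
    (measurableSet_weakCluster N k r), gFun, measureReal_def]
  congr 2
  ext ω
  simp only [weakCluster, Set.mem_preimage, Set.mem_ofPred_eq, radii_arrivalTimes, ← clusterRSS_eq]
  rw [lt_div_iff₀ (N.pow_pos _), clusterRSS, ← Finset.mul_sum, mul_comm]

end IsNetwork

end Network

/-! ### The exclusion radius and the weak-cluster event -/

section ExclRadius

variable (N : Params) {r : ℝ}

lemma exclRadius_eq (r : ℝ) :
    exclRadius N r = (N.pow Tier.mbs / N.pow Tier.sbs) ^ (-1 / N.α) * r := by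
  have h : 0 ≤ N.pow Tier.mbs / N.pow Tier.sbs := (div_pos (N.pow_pos _) (N.pow_pos _)).le
  rw [exclRadius, omega, Real.sqrt_eq_rpow, ← Real.rpow_mul h]
  congr 2
  ring

lemma exclRadius_pos (hr : 0 < r) : 0 < exclRadius N r := by
  rw [exclRadius_eq]
  exact mul_pos (Real.rpow_pos_of_pos (div_pos (N.pow_pos _) (N.pow_pos _)) _) hr

lemma pow_mul_exclRadius_rpow (hr : 0 < r) :
    N.pow Tier.mbs * exclRadius N r ^ N.α = N.pow Tier.sbs * r ^ N.α := by
  have hm := N.pow_pos Tier.mbs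
  have hs := N.pow_pos Tier.sbs
  have hα := (α_pos N).ne'
  rw [exclRadius_eq, Real.mul_rpow (by positivity) hr.le, ← Real.rpow_mul (by positivity),
    show -1 / N.α * N.α = -1 by field_simp, Real.rpow_neg_one]
  field_simp

lemma pow_mul_exclRadius_rpow_neg (hr : 0 < r) :
    N.pow Tier.sbs * exclRadius N r ^ (-N.α) = N.pow Tier.mbs * r ^ (-N.α) := by
  have h := pow_mul_exclRadius_rpow N hr
  have h1 := Real.rpow_pos_of_pos (exclRadius_pos N hr) N.α
  have h2 := Real.rpow_pos_of_pos hr N.α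
  rw [Real.rpow_neg (exclRadius_pos N hr).le, Real.rpow_neg hr.le]
  field_simp
  linarith

/-- At distance `exclRadius N r` a single small cell is received as strongly as the MBS at `r`, so
the nearest cluster member alone would already prevent weakness. -/
lemma lt_of_mem_weakCluster {k : ℕ} [NeZero k] (hr : 0 < r) {T : ℕ → ℝ} (h0 : 0 < T 0)
    (hT : T ∈ weakCluster N k r) : rate N Tier.sbs * exclRadius N r ^ 2 < T 0 := by
  have hb := rate_pos N Tier.sbs
  have hs := N.pow_pos Tier.sbs
  have hρ := exclRadius_pos N hr
  have h1 : N.pow Tier.sbs * √(T 0 / rate N Tier.sbs) ^ (-N.α) ≤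
      clusterPower N (radii N Tier.sbs k T) := by
    refine Finset.single_le_sum (f := fun j : Fin k => N.pow Tier.sbs *
      radii N Tier.sbs k T j ^ (-N.α)) (fun j _ => ?_) (Finset.mem_univ (0 : Fin k))
    exact mul_nonneg hs.le (Real.rpow_nonneg (Real.sqrt_nonneg _) _)
  have h2 := h1.trans_lt hT
  rw [← pow_mul_exclRadius_rpow_neg N hr] at h2
  have hx : 0 < √(T 0 / rate N Tier.sbs) := Real.sqrt_pos.2 (div_pos h0 hb)
  have h3 := (Real.rpow_lt_rpow_iff_of_neg hx hρ (neg_lt_zero.2 (α_pos N))).1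
    (lt_of_mul_lt_mul_left h2 hs.le)
  rw [Real.lt_sqrt hρ.le, lt_div_iff₀ hb] at h3
  linarith

/-- Beyond k^(1/α) times the exclusion radius each member contributes less than the fraction 1/k of
the macro power. -/
lemma mem_weakCluster_of_lt {k : ℕ} [NeZero k] (hr : 0 < r) {T : ℕ → ℝ} (hT : Monotone T)
    (h : (k : ℝ) ^ (2 / N.α) * (rate N Tier.sbs * exclRadius N r ^ 2) < T 0) :
    T ∈ weakCluster N k r := by
  have hb := rate_pos N Tier.sbs
  have hs := N.pow_pos Tier.sbs
  have hρ := exclRadius_pos N hr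
  have hα := α_pos N
  have hk : (0 : ℝ) < k := Nat.cast_pos.2 (NeZero.pos k)
  have hkα := Real.rpow_pos_of_pos hk (1 / N.α)
  rw [weakCluster, Set.mem_ofPred_eq, ← pow_mul_exclRadius_rpow_neg N hr, clusterPower]
  have h1 : ∀ j : Fin k, N.pow Tier.sbs * radii N Tier.sbs k T j ^ (-N.α) <
      (k : ℝ)⁻¹ * (N.pow Tier.sbs * exclRadius N r ^ (-N.α)) := by
    intro j
    have h2 : (k : ℝ) ^ (1 / N.α) * exclRadius N r < radii N Tier.sbs k T j := by
      rw [radii, Real.lt_sqrt (by positivity), lt_div_iff₀ hb, mul_pow, ← Real.rpow_mul_natCast hk.le]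
      refine lt_of_eq_of_lt ?_ (h.trans_le (hT (Nat.zero_le j)))
      rw [show 1 / N.α * ((2 : ℕ) : ℝ) = 2 / N.α by push_cast; ring]
      ring
    have h3 := (Real.rpow_lt_rpow_iff_of_neg ((by positivity : (0:ℝ) < _).trans h2)
      (by positivity) (neg_lt_zero.2 hα)).2 h2
    rw [Real.mul_rpow hkα.le hρ.le, ← Real.rpow_mul hk.le,
      show 1 / N.α * -N.α = -1 by field_simp, Real.rpow_neg_one] at h3
    calc _ < N.pow Tier.sbs * ((k : ℝ)⁻¹ * exclRadius N r ^ (-N.α)) :=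
          mul_lt_mul_of_pos_left h3 hs
      _ = _ := by ring
  refine (Finset.sum_lt_sum_of_nonempty Finset.univ_nonempty fun j _ => h1 j).trans_eq ?_
  rw [Finset.sum_const, Finset.card_univ, Fintype.card_fin, nsmul_eq_mul, ← mul_assoc,
    mul_inv_cancel₀ hk.ne', one_mul]

end ExclRadius

/-- At nonpositive times the square root is 0 and a negative power of 0 has the default value 0,
which would spoil monotonicity on the line. The value ∞ there restores it, and changes nothing
almost surely. -/
lemma antitone_top_extension {f : ℝ → ℝ≥0∞} (h : AntitoneOn f (Set.Ioi 0)) :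
    Antitone fun t => if t ≤ 0 then ∞ else f t := by
  intro x y hxy
  by_cases hx : x ≤ 0
  · simp [hx]
  · have hy : ¬ y ≤ 0 := fun hy => hx (hxy.trans hy)
    simp only [hx, hy, if_false]
    exact h (not_le.1 hx) (not_le.1 hy) hxy

/-! ### Bounds for the Laplace transform on the weak-cluster event -/

namespace IsUnitPoisson

variable {μ : Measure (ℕ → ℝ)} {N : Params} {r s : ℝ}

/-- Weakness of the cluster entails that the disc of the exclusion radius is empty, and conditioning
on this emptiness is a delay. -/
lemma setLIntegral_weakCluster (hμ : IsUnitPoisson μ) (k : ℕ) [NeZero k] (hr : 0 < r)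
    {Ψ : (ℕ → ℝ) → ℝ≥0∞} (hΨ : Measurable Ψ) :
    ∫⁻ T in weakCluster N k r, Ψ T ∂μ = nexp (.ofReal (rate N Tier.sbs * exclRadius N r ^ 2)) *
      ∫⁻ T, (weakCluster N k r).indicator Ψ
        (delay (rate N Tier.sbs * exclRadius N r ^ 2) T) ∂μ := by
  have hE := measurableSet_weakCluster N k r
  have hb := rate_pos N Tier.sbs
  rw [← hμ.setLIntegral_lt (hΨ.indicator hE) (by positivity), ← lintegral_indicator hE,
    ← lintegral_indicator (measurableSet_lt measurable_const (measurable_pi_apply 0))]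
  refine lintegral_congr_ae ?_
  filter_upwards [hμ.ae_pos] with T hT
  by_cases h : T ∈ weakCluster N k r
  · rw [Set.indicator_of_mem (s := {T : ℕ → ℝ | _ < T 0}) (lt_of_mem_weakCluster N hr (hT 0) h)]
  · by_cases h' : T ∈ {T : ℕ → ℝ | rate N Tier.sbs * exclRadius N r ^ 2 < T 0}
    · rw [Set.indicator_of_mem h']
    · rw [Set.indicator_of_notMem h', Set.indicator_of_notMem h]

lemma lintegral_delay_sbsFactor (hμ : IsUnitPoisson μ) (hs : 0 < s) {d : ℝ} (hd : 0 ≤ d) :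
    ∫⁻ T, sbsFactor N s (delay (rate N Tier.sbs * d ^ 2) T) ∂μ =
      .ofReal (tierLaplace N Tier.sbs d s) := by
  have hm : Measurable fun t => fadingLoss (N.pow Tier.sbs) N.α s √(t / rate N Tier.sbs) :=
    measurable_comp_uncurry (measurable_uncurry_fadingLoss _ _) measurable_const
      (b := fun t => √(t / rate N Tier.sbs)) (by fun_prop)
  exact (hμ.laplace_delay hm _).trans (nexp_lintegral_fadingLoss N Tier.sbs hd hs)

lemma le_measure_weakCluster (hμ : IsUnitPoisson μ) (k : ℕ) [NeZero k] (hr : 0 < r) :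
    nexp (.ofReal ((k : ℝ) ^ (2 / N.α) * (rate N Tier.sbs * exclRadius N r ^ 2))) ≤
      μ (weakCluster N k r) := by
  have hb := rate_pos N Tier.sbs
  rw [← hμ.measure_lt (by positivity)]
  refine measure_mono_ae ?_
  filter_upwards [hμ.monotone] with T hT h
  exact mem_weakCluster_of_lt N hr hT h

/-- Only the emptiness of the disc is kept; the further restriction to weak clusters is dropped. -/
lemma weakLaplace_le (hμ : IsUnitPoisson μ) (k : ℕ) [NeZero k] (hr : 0 < r) (hs : 0 < s) :
    weakLaplace μ N k s r ≤ nexp (.ofReal (rate N Tier.sbs * exclRadius N r ^ 2)) *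
      .ofReal (tierLaplace N Tier.sbs (exclRadius N r) s) := by
  rw [weakLaplace, hμ.setLIntegral_weakCluster k hr (measurable_sbsFactor N s),
    ← hμ.lintegral_delay_sbsFactor hs (exclRadius_pos N hr).le]
  gcongr
  exact Set.indicator_le_self _ _ _

/-- Conditioning on a weak cluster of small cells makes their interference smaller. -/
theorem measure_mul_tierLaplace_le (hμ : IsUnitPoisson μ) (k : ℕ) [NeZero k] (hr : 0 < r)
    (hs : 0 < s) :
    μ (weakCluster N k r) * .ofReal (tierLaplace N Tier.sbs (exclRadius N r) s) ≤
      weakLaplace μ N k s r := by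
  have hα := α_pos N
  have hb := rate_pos N Tier.sbs
  have hp := N.pow_pos Tier.sbs
  have hρ := exclRadius_pos N hr
  set b := rate N Tier.sbs with hb_def
  set a := b * exclRadius N r ^ 2 with ha
  have hrp : ∀ {x y : ℝ}, 0 < x → x ≤ y → √(y / b) ^ (-N.α) ≤ √(x / b) ^ (-N.α) := by
    intro x y hx hxy
    refine Real.rpow_le_rpow_of_nonpos (Real.sqrt_pos.2 (div_pos hx hb)) ?_ (neg_nonpos.2 hα.le)
    exact Real.sqrt_le_sqrt (by gcongr)
  let φ : ℝ → ℝ≥0∞ := fun t => if t ≤ 0 then ∞ else .ofReal (N.pow Tier.sbs * √(t / b) ^ (-N.α))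
  have hφ : Antitone φ := antitone_top_extension fun x hx y _ hxy => ENNReal.ofReal_le_ofReal
    (mul_le_mul_of_nonneg_left (hrp hx hxy) hp.le)
  let χ : ℝ → ℝ≥0∞ := fun t => if t ≤ 0 then ∞ else fadingLoss (N.pow Tier.sbs) N.α s √(t / b)
  have hχ : Antitone χ := antitone_top_extension fun x hx y _ hxy => by
    have h0 : 0 ≤ √(y / b) ^ (-N.α) := Real.rpow_nonneg (Real.sqrt_nonneg _) _
    refine ENNReal.ofReal_le_ofReal (Real.log_le_log (by positivity) ?_)
    have := hrp hx hxy
    gcongr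
  -- The weak-cluster event on positive times, modified so that its indicator is monotone on all
  -- real sequences.
  let D : Set (ℕ → ℝ) := {T | ∑ j ∈ Finset.range k, φ (T j) < .ofReal (N.pow Tier.mbs * r ^ (-N.α))}
  have hDm : MeasurableSet D := measurableSet_lt (Finset.measurable_sum _ fun j _ =>
    hφ.measurable.comp (measurable_pi_apply j)) measurable_const
  let A : (ℕ → ℝ) → ℝ≥0∞ := D.indicator 1
  let B : (ℕ → ℝ) → ℝ≥0∞ := fun T => nexp (∑' j, χ (T j))
  have hA : Measurable A := measurable_one.indicator hDm
  have hB : Measurable B := measurable_nexp_tsum hχ.measurable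
  have hAm : Monotone A := by
    intro T T' hT
    by_cases h : T ∈ D
    · have h' : T' ∈ D := lt_of_le_of_lt (Finset.sum_le_sum fun j _ => hφ (hT j)) h
      simp only [A]
      rw [Set.indicator_of_mem h, Set.indicator_of_mem h', Pi.one_apply, Pi.one_apply]
    · simp only [A]
      rw [Set.indicator_of_notMem h]
      exact bot_le
  have hBm : Monotone B := fun T T' hT => antitone_nexp (ENNReal.tsum_le_tsum fun j => hχ (hT j))
  have hAk : ∀ T T', (∀ j < k, T j = T' j) → A T = A T' := by
    intro T T' h
    have : T ∈ D ↔ T' ∈ D := by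
      simp only [D, Set.mem_ofPred_eq]
      rw [Finset.sum_congr rfl fun j hj => by rw [h j (Finset.mem_range.1 hj)]]
    simp only [A]
    by_cases hT : T ∈ D
    · rw [Set.indicator_of_mem hT, Set.indicator_of_mem (this.1 hT), Pi.one_apply, Pi.one_apply]
    · rw [Set.indicator_of_notMem hT, Set.indicator_of_notMem (mt this.2 hT)]
  have hD_iff : ∀ T : ℕ → ℝ, (∀ j, 0 < T j) → (T ∈ D ↔ T ∈ weakCluster N k r) := by
    intro T hT
    have h0 : 0 < N.pow Tier.mbs * r ^ (-N.α) :=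
      mul_pos (N.pow_pos _) (Real.rpow_pos_of_pos hr _)
    simp only [D, weakCluster, Set.mem_ofPred_eq, φ, (hT _).not_ge, if_false]
    rw [← ENNReal.ofReal_sum_of_nonneg fun j _ => mul_nonneg hp.le
      (Real.rpow_nonneg (Real.sqrt_nonneg _) _), ENNReal.ofReal_lt_ofReal_iff h0,
      Finset.sum_range, clusterPower]
    rfl
  have hB_eq : ∀ T : ℕ → ℝ, (∀ j, 0 < T j) → B T = sbsFactor N s T := by
    intro T hT
    simp only [B, χ, (hT _).not_ge, if_false, sbsFactor, hb_def]
  have hpos : ∀ᵐ T ∂μ, ∀ j, 0 < delay a T j := by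
    filter_upwards [hμ.ae_pos] with T hT j
    have := hT j
    simp only [delay]; positivity
  have hE := measurableSet_weakCluster N k r
  -- Positive association: later arrivals weaken both the cluster and the interference. Only the
  -- cluster event is restricted to the first `k` times.
  have key := hμ.lintegral_mul_lintegral_le k hA hB hAm hBm hAk a
  have e1 : ∫⁻ T, A (delay a T) ∂μ = ∫⁻ T, (weakCluster N k r).indicator 1 (delay a T) ∂μ := by
    refine lintegral_congr_ae ?_
    filter_upwards [hpos] with T hT
    simp only [A]
    by_cases h : delay a T ∈ weakCluster N k r
    · rw [Set.indicator_of_mem h, Set.indicator_of_mem ((hD_iff _ hT).2 h)]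
    · rw [Set.indicator_of_notMem h, Set.indicator_of_notMem (mt (hD_iff _ hT).1 h)]
  have e2 : ∫⁻ T, B (delay a T) ∂μ = .ofReal (tierLaplace N Tier.sbs (exclRadius N r) s) := by
    rw [← hμ.lintegral_delay_sbsFactor hs hρ.le]
    refine lintegral_congr_ae ?_
    filter_upwards [hpos] with T hT
    exact hB_eq _ hT
  have e3 : ∫⁻ T, A (delay a T) * B (delay a T) ∂μ =
      ∫⁻ T, (weakCluster N k r).indicator (sbsFactor N s) (delay a T) ∂μ := by
    refine lintegral_congr_ae ?_
    filter_upwards [hpos] with T hT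
    simp only [A]
    by_cases h : delay a T ∈ weakCluster N k r
    · rw [Set.indicator_of_mem h, Set.indicator_of_mem ((hD_iff _ hT).2 h), hB_eq _ hT,
        Pi.one_apply, one_mul]
    · rw [Set.indicator_of_notMem h, Set.indicator_of_notMem (mt (hD_iff _ hT).1 h), zero_mul]
  rw [e1, e2, e3] at key
  have e4 : μ (weakCluster N k r) = nexp (.ofReal a) *
      ∫⁻ T, (weakCluster N k r).indicator 1 (delay a T) ∂μ := by
    rw [← hμ.setLIntegral_weakCluster k hr measurable_one]
    simp
  rw [e4, weakLaplace, hμ.setLIntegral_weakCluster k hr (measurable_sbsFactor N s), mul_assoc]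
  gcongr

/-- A weak cluster has positive probability, and the interference of the nearest small cell alone
makes the factor less than 1 almost surely. -/
lemma weakLaplace_lt (hμ : IsUnitPoisson μ) (k : ℕ) [NeZero k] (hr : 0 < r) (hs : 0 < s) :
    weakLaplace μ N k s r < μ (weakCluster N k r) := by
  have := hμ.isProbabilityMeasure
  have h0 : μ (weakCluster N k r) ≠ 0 := fun h => by
    have := hμ.le_measure_weakCluster (N := N) k hr
    rw [h, nexp_ofReal (by have := rate_pos N Tier.sbs; positivity)] at this
    exact (ENNReal.ofReal_pos.2 (Real.exp_pos _)).not_ge this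
  rw [← setLIntegral_one, weakLaplace]
  refine lintegral_strict_mono (by rwa [Ne, Measure.restrict_eq_zero]) aemeasurable_const ?_ ?_
  · refine ne_top_of_le_ne_top (measure_ne_top μ (weakCluster N k r)) ?_
    rw [← setLIntegral_one]
    exact lintegral_mono fun T => nexp_le_one _
  · filter_upwards [ae_restrict_of_ae hμ.ae_pos] with T hT
    rw [← nexp_zero]
    refine strictAnti_nexp (lt_of_lt_of_le ?_ (ENNReal.le_tsum 0))
    have h1 : 0 < √(T 0 / rate N Tier.sbs) := Real.sqrt_pos.2 (div_pos (hT 0) (rate_pos N _))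
    have h2 := Real.rpow_pos_of_pos h1 (-N.α)
    have h3 := N.pow_pos Tier.sbs
    exact ENNReal.ofReal_pos.2 (Real.log_pos (by simp only [lt_add_iff_pos_right]; positivity))

end IsUnitPoisson

/-! ### The weak-cluster event for small distances -/

namespace IsUnitPoisson

variable {μ : Measure (ℕ → ℝ)} {N : Params} {r s : ℝ}

lemma measure_zero_lt_le (hμ : IsUnitPoisson μ) {c : ℝ} (hc : 0 ≤ c) :
    μ {T | T 0 < c} ≤ .ofReal c := by
  have := hμ.isProbabilityMeasure
  have hS : MeasurableSet {T : ℕ → ℝ | c < T 0} :=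
    measurableSet_lt measurable_const (measurable_pi_apply 0)
  have h1 : μ {T | T 0 < c} ≤ μ {T : ℕ → ℝ | c < T 0}ᶜ :=
    measure_mono fun T (hT : T 0 < c) => not_lt.2 hT.le
  refine h1.trans ?_
  rw [prob_compl_eq_one_sub hS, hμ.measure_lt hc, tsub_le_iff_right, nexp_ofReal hc,
    ← ENNReal.ofReal_add hc (Real.exp_pos _).le, ← ENNReal.ofReal_one]
  refine ENNReal.ofReal_le_ofReal ?_
  linarith [Real.add_one_le_exp (-c)]

/-- Two arrivals before `c` require a first arrival and then an independent gap, both shorter than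
`c`. -/
lemma measure_one_lt_le (hμ : IsUnitPoisson μ) {c : ℝ} (hc : 0 ≤ c) :
    μ {T | T 1 < c} ≤ .ofReal (c ^ 2) := by
  have := hμ.isProbabilityMeasure
  have hS : MeasurableSet {T : ℕ → ℝ | T 1 < c} :=
    measurableSet_lt (measurable_pi_apply 1) measurable_const
  rw [← lintegral_indicator_one hS, hμ.lintegral_eq_lintegral_Ioi (measurable_one.indicator hS)]
  have h1 : ∀ t ∈ Set.Ioi (0 : ℝ), nexp (.ofReal t) *
      ∫⁻ T, {T : ℕ → ℝ | T 1 < c}.indicator 1 (seqCons t (delay t T)) ∂μ ≤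
      (Set.Iio c).indicator (fun _ => .ofReal c) t := by
    intro t ht
    have ht0 : 0 < t := ht
    refine (mul_le_of_le_one_left' (nexp_le_one _)).trans ?_
    by_cases htc : t < c
    · rw [Set.indicator_of_mem (Set.mem_Iio.2 htc)]
      refine le_trans ?_ (hμ.measure_zero_lt_le hc)
      rw [← lintegral_indicator_one (measurableSet_lt (measurable_pi_apply 0) measurable_const)]
      refine lintegral_mono fun T => ?_
      by_cases h : t + T 0 < c
      · have h' : T 0 < c := by linarith
        simp [Set.indicator, delay, h, h']
      · simp [Set.indicator, delay, h]
    · rw [Set.indicator_of_notMem (by simpa using htc)]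
      refine le_of_eq (lintegral_eq_zero_of_ae_eq_zero ?_)
      filter_upwards [hμ.ae_pos] with T hT
      refine Set.indicator_of_notMem ?_ _
      have := hT 0
      simp only [Set.mem_ofPred_eq, seqCons_succ, delay]
      linarith
  refine (setLIntegral_mono' measurableSet_Ioi h1).trans ?_
  rw [lintegral_indicator measurableSet_Iio, Measure.restrict_restrict measurableSet_Iio,
    setLIntegral_const, Set.inter_comm, Set.Ioi_inter_Iio, Real.volume_Ioo, sub_zero,
    ← ENNReal.ofReal_mul hc, sq]

/-- Given an empty disc of radius ρ, weakness can fail only if the nearest small cell lies in a thin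
annulus around it, or if two small cells lie within a fixed multiple of ρ. The first probability is
an arbitrarily small multiple of a = πλ_s ρ², the second is of order a². -/
lemma exists_le_lintegral_delay (hμ : IsUnitPoisson μ) (N : Params) (k : ℕ) [NeZero k] {ε : ℝ}
    (hε : 0 < ε) : ∃ a₀ > 0, ∀ r, 0 < r → rate N Tier.sbs * exclRadius N r ^ 2 ≤ a₀ →
      1 ≤ ∫⁻ T, (weakCluster N k r).indicator 1
        (delay (rate N Tier.sbs * exclRadius N r ^ 2) T) ∂μ +
        .ofReal (ε * (rate N Tier.sbs * exclRadius N r ^ 2)) := by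
  have := hμ.isProbabilityMeasure
  have hα := α_pos N
  have hb := rate_pos N Tier.sbs
  have hp := N.pow_pos Tier.sbs
  have hk : (0 : ℝ) < k := Nat.cast_pos.2 (NeZero.pos k)
  set b := rate N Tier.sbs with hb_def
  -- The annulus between ρ and xρ has mean count (x² - 1) a = εa/2.
  set x := √(1 + ε / 2) with hx
  have hx1 : 1 < x := by rw [hx, Real.lt_sqrt (by norm_num)]; linarith
  have hx2 : x ^ 2 - 1 = ε / 2 := by rw [hx, Real.sq_sqrt (by positivity)]; ring
  have hc : 0 < 1 - x ^ (-N.α) := sub_pos.2 (Real.rpow_lt_one_of_one_lt_of_neg hx1 (by linarith))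
  -- `y` is so large that k y^(-α) < 1 - x^(-α): a nearest small cell beyond xρ and all others
  -- beyond yρ then form a weak cluster.
  obtain ⟨y, hy, hy1⟩ := (((tendsto_rpow_neg_atTop hα).eventually_lt_const
    (div_pos hc hk)).and (eventually_ge_atTop 1)).exists
  rw [lt_div_iff₀ hk] at hy
  -- Chosen to make the quadratic term (y² - 1)² a² at most εa/2; the `+ 1` avoids division by zero
  -- at `y = 1`.
  refine ⟨ε / 2 / ((y ^ 2 - 1) ^ 2 + 1), by positivity, fun r hr ha => ?_⟩
  have hρ := exclRadius_pos N hr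
  set ρ := exclRadius N r with hρ_def
  set a := b * ρ ^ 2 with ha_def
  have ha0 : 0 < a := by positivity
  have hE := measurableSet_weakCluster N k r
  have hlow : ∀ {z t : ℝ}, 1 ≤ z → (z ^ 2 - 1) * a ≤ t →
      N.pow Tier.sbs * √((a + t) / b) ^ (-N.α) ≤ N.pow Tier.sbs * ρ ^ (-N.α) * z ^ (-N.α) := by
    intro z t hz ht
    have hz0 : 0 < z := by linarith
    rw [mul_assoc, ← Real.mul_rpow hρ.le hz0.le]
    refine mul_le_mul_of_nonneg_left (Real.rpow_le_rpow_of_nonpos (by positivity) ?_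
      (by linarith)) hp.le
    refine Real.le_sqrt_of_sq_le ?_
    rw [le_div_iff₀ hb]
    calc (ρ * z) ^ 2 * b = a + (z ^ 2 - 1) * a := by rw [ha_def]; ring
      _ ≤ a + t := by linarith
  have hbad : ∀ᵐ T ∂μ, (1 : ℝ≥0∞) ≤ (weakCluster N k r).indicator 1 (delay a T) +
      ({T : ℕ → ℝ | T 0 < (x ^ 2 - 1) * a}.indicator 1 T +
        {T : ℕ → ℝ | T 1 < (y ^ 2 - 1) * a}.indicator 1 T) := by
    filter_upwards [hμ.monotone] with T hT
    by_cases h0 : T 0 < (x ^ 2 - 1) * a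
    · rw [Set.indicator_of_mem (s := {T : ℕ → ℝ | T 0 < (x ^ 2 - 1) * a}) h0, Pi.one_apply]
      exact le_add_left (le_add_right le_rfl)
    by_cases h1 : T 1 < (y ^ 2 - 1) * a
    · rw [Set.indicator_of_mem (s := {T : ℕ → ℝ | T 1 < (y ^ 2 - 1) * a}) h1, Pi.one_apply]
      exact le_add_left (le_add_left le_rfl)
    have hmem : delay a T ∈ weakCluster N k r := by
      rw [weakCluster, Set.mem_ofPred_eq, ← pow_mul_exclRadius_rpow_neg N hr, clusterPower]
      set q := N.pow Tier.sbs * ρ ^ (-N.α) with hq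
      have hq0 : 0 < q := mul_pos hp (Real.rpow_pos_of_pos hρ _)
      have hterm : ∀ j : Fin k, N.pow Tier.sbs * radii N Tier.sbs k (delay a T) j ^ (-N.α) ≤
          q * ((if j = 0 then x ^ (-N.α) else 0) + y ^ (-N.α)) := by
        intro j
        have hxp : 0 ≤ x ^ (-N.α) := Real.rpow_nonneg (by linarith) _
        have hyp : 0 ≤ y ^ (-N.α) := Real.rpow_nonneg (by linarith) _
        by_cases hj : j = 0
        · subst hj
          refine (hlow hx1.le (not_lt.1 h0)).trans ?_
          rw [if_pos rfl]
          exact mul_le_mul_of_nonneg_left (by linarith) hq0.le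
        · have hj1 : 1 ≤ (j : ℕ) := Nat.one_le_iff_ne_zero.2 fun h => hj (Fin.ext h)
          refine (hlow hy1 ((not_lt.1 h1).trans (hT hj1))).trans ?_
          rw [if_neg hj, zero_add]
      refine (Finset.sum_le_sum fun j _ => hterm j).trans_lt ?_
      rw [← Finset.mul_sum, Finset.sum_add_distrib, Finset.sum_ite_eq' Finset.univ (0 : Fin k),
        if_pos (Finset.mem_univ _), Finset.sum_const, Finset.card_univ, Fintype.card_fin,
        nsmul_eq_mul]
      exact mul_lt_of_lt_one_right hq0 (by linarith)
    rw [Set.indicator_of_mem hmem, Pi.one_apply]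
    exact le_add_right le_rfl
  have hS0 : MeasurableSet {T : ℕ → ℝ | T 0 < (x ^ 2 - 1) * a} :=
    measurableSet_lt (measurable_pi_apply 0) measurable_const
  have hS1 : MeasurableSet {T : ℕ → ℝ | T 1 < (y ^ 2 - 1) * a} :=
    measurableSet_lt (measurable_pi_apply 1) measurable_const
  have hdm : Measurable fun T => (weakCluster N k r).indicator (1 : (ℕ → ℝ) → ℝ≥0∞) (delay a T) :=
    (measurable_one.indicator hE).comp (measurable_delay.comp measurable_prodMk_left)
  have hint := lintegral_mono_ae (f := fun _ => 1) hbad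
  rw [lintegral_const, measure_univ, mul_one, lintegral_add_left hdm,
    lintegral_add_left (measurable_one.indicator hS0), lintegral_indicator_one hS0,
    lintegral_indicator_one hS1] at hint
  refine hint.trans (add_le_add le_rfl ?_)
  have hy2 : 0 ≤ y ^ 2 - 1 := by nlinarith
  refine (add_le_add (hμ.measure_zero_lt_le (by rw [hx2]; positivity))
    (hμ.measure_one_lt_le (by positivity))).trans ?_
  rw [← ENNReal.ofReal_add (by rw [hx2]; positivity) (by positivity)]
  refine ENNReal.ofReal_le_ofReal ?_
  rw [hx2, mul_pow]
  have h3 : (y ^ 2 - 1) ^ 2 * a ≤ ε / 2 := by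
    rw [le_div_iff₀ (by positivity)] at ha
    nlinarith
  nlinarith

/-- Sharp to first order in a, unlike `le_measure_weakCluster`, whose exponent is too large by the
factor k^(2/α). This sharpness is what the limit of `ds r / exclRadius N r` requires. -/
lemma eventually_le_measure_weakCluster (hμ : IsUnitPoisson μ) (N : Params) (k : ℕ) [NeZero k]
    {ε : ℝ} (hε : 0 < ε) : ∀ᶠ r in 𝓝[>] 0,
      nexp (.ofReal (rate N Tier.sbs * exclRadius N r ^ 2)) *
        .ofReal (1 - ε * (rate N Tier.sbs * exclRadius N r ^ 2)) ≤ μ (weakCluster N k r) := by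
  obtain ⟨a₀, ha₀, h⟩ := hμ.exists_le_lintegral_delay N k hε
  have ht : Tendsto (fun r => rate N Tier.sbs * exclRadius N r ^ 2) (𝓝[>] 0) (𝓝 0) := by
    have hc : Continuous fun r => rate N Tier.sbs * exclRadius N r ^ 2 := by
      unfold exclRadius; fun_prop
    have := hc.tendsto 0
    simp only [exclRadius, mul_zero, ne_eq, OfNat.ofNat_ne_zero, not_false_eq_true, zero_pow]
      at this
    exact this.mono_left nhdsWithin_le_nhds
  filter_upwards [ht.eventually_le_const ha₀, self_mem_nhdsWithin] with r hr hr0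
  have h1 : μ (weakCluster N k r) = nexp (.ofReal (rate N Tier.sbs * exclRadius N r ^ 2)) *
      ∫⁻ T, (weakCluster N k r).indicator 1
        (delay (rate N Tier.sbs * exclRadius N r ^ 2) T) ∂μ := by
    rw [← hμ.setLIntegral_weakCluster k hr0 measurable_one]
    simp
  rw [h1]
  gcongr
  have h2 := h r hr0 hr
  have hb := rate_pos N Tier.sbs
  rw [ENNReal.ofReal_sub _ (by positivity), ENNReal.ofReal_one]
  exact tsub_le_iff_right.2 h2

end IsUnitPoisson

/-! ### Construction of the radius `ds` -/

/-- Equality of the powers received from ρ and `r` gives s P_s = θρ^α. Hence only d/ρ and πλ_s ρ²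
enter, and the threshold fixes the scale. -/
lemma tierLaplace_sbs_eq (N : Params) {θ r : ℝ} (hθ : 0 < θ) (hr : 0 < r) (d : ℝ) :
    tierLaplace N Tier.sbs d ((N.pow Tier.mbs)⁻¹ * θ * r ^ N.α) =
      Real.exp (-(2 * θ ^ (2 / N.α) * (rate N Tier.sbs * exclRadius N r ^ 2) *
        F (θ ^ (-1 / N.α) * (d / exclRadius N r)) N.α)) := by
  have hρ := exclRadius_pos N hr
  have hα := (α_pos N).ne'
  have hm := (N.pow_pos Tier.mbs).ne'
  have h1 : (N.pow Tier.mbs)⁻¹ * θ * r ^ N.α * N.pow Tier.sbs = θ * exclRadius N r ^ N.α := by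
    have := pow_mul_exclRadius_rpow N hr
    field_simp
    linarith
  have h2 : (θ * exclRadius N r ^ N.α) ^ (2 / N.α) = θ ^ (2 / N.α) * exclRadius N r ^ 2 := by
    rw [Real.mul_rpow hθ.le (by positivity), ← Real.rpow_mul hρ.le,
      show N.α * (2 / N.α) = ((2 : ℕ) : ℝ) by push_cast; field_simp, Real.rpow_natCast]
  have h3 : (θ * exclRadius N r ^ N.α) ^ (-1 / N.α) = θ ^ (-1 / N.α) * (exclRadius N r)⁻¹ := by
    rw [Real.mul_rpow hθ.le (by positivity), ← Real.rpow_mul hρ.le,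
      show N.α * (-1 / N.α) = -1 by field_simp, Real.rpow_neg_one]
  rw [tierLaplace, h1, h2, h3, rate, mul_assoc (θ ^ (-1 / N.α)), inv_mul_eq_div]
  congr 1
  ring

/-- The ratio `ψ` of two measures, written as a Laplace factor with a modified exclusion radius. -/
theorem IsUnitPoisson.exists_exclusion_radius {μ : Measure (ℕ → ℝ)} (hμ : IsUnitPoisson μ)
    (N : Params) (k : ℕ) [NeZero k] {θ : ℝ} (hθ : 0 < θ) :
    ∃ ds : ℝ → ℝ, Measurable ds ∧
      (∀ r, 0 < r → weakLaplace μ N k ((N.pow Tier.mbs)⁻¹ * θ * r ^ N.α) r =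
        μ (weakCluster N k r) *
          .ofReal (tierLaplace N Tier.sbs (ds r) ((N.pow Tier.mbs)⁻¹ * θ * r ^ N.α))) ∧
      (∀ r, 0 < r → exclRadius N r ≤ ds r) ∧
      (k = 1 → ∀ r, 0 < r → ds r = exclRadius N r) ∧
      Tendsto (fun r => ds r / exclRadius N r) (𝓝[>] 0) (𝓝 1) ∧
      (∀ r, 0 < r →
        tierLaplace N Tier.sbs (ds r) ((N.pow Tier.mbs)⁻¹ * θ * r ^ N.α) ≤
          Real.exp (Real.pi * N.lam Tier.sbs * ((k : ℝ) ^ (2 / N.α) - 1) * exclRadius N r ^ 2) *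
            tierLaplace N Tier.sbs (exclRadius N r) ((N.pow Tier.mbs)⁻¹ * θ * r ^ N.α)) := by
  have := hμ.isProbabilityMeasure
  have hα := N.two_lt_α
  have hb := rate_pos N Tier.sbs
  set s : ℝ → ℝ := fun r => (N.pow Tier.mbs)⁻¹ * θ * r ^ N.α with hs_def
  have hs : Measurable s := by fun_prop
  have hs0 : ∀ r, 0 < r → 0 < s r := fun r hr => by
    have := N.pow_pos Tier.mbs
    have := Real.rpow_pos_of_pos hr N.α
    simp only [hs_def]; positivity
  set a : ℝ → ℝ := fun r => rate N Tier.sbs * exclRadius N r ^ 2 with ha_def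
  have ha : ∀ r, 0 < r → 0 < a r := fun r hr => by
    have := exclRadius_pos N hr
    simp only [ha_def]; positivity
  have hρm : Measurable (exclRadius N) := by unfold exclRadius; fun_prop
  -- The argument of `F` that corresponds to d = ρ.
  set y₀ := θ ^ (-1 / N.α) with hy₀_def
  have hy₀ : 0 < y₀ := Real.rpow_pos_of_pos hθ _
  set c := 2 * θ ^ (2 / N.α) with hc_def
  have hc : 0 < c := by have := Real.rpow_pos_of_pos hθ (2 / N.α); positivity
  -- The conditional Laplace transform of the small-cell interference, given a weak cluster.
  set ψ : ℝ → ℝ := fun r => (weakLaplace μ N k (s r) r / μ (weakCluster N k r)).toReal with hψ_def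
  have hψm : Measurable ψ :=
    ((measurable_weakLaplace μ N k hs).div
      (measurable_measure_prodMk_left (measurableSet_prod_weakCluster N k))).ennreal_toReal
  have hE0 : ∀ r, 0 < r → μ (weakCluster N k r) ≠ 0 := fun r hr =>
    (bot_lt_iff_ne_bot.1 (bot_le.trans_lt (hμ.weakLaplace_lt k hr (hs0 r hr))))
  have hψ : ∀ r, 0 < r → weakLaplace μ N k (s r) r = μ (weakCluster N k r) * .ofReal (ψ r) := by
    intro r hr
    have hne : weakLaplace μ N k (s r) r / μ (weakCluster N k r) ≠ ∞ :=
      ENNReal.div_ne_top ((hμ.weakLaplace_lt k hr (hs0 r hr)).trans_le prob_le_one).ne_top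
        (hE0 r hr)
    rw [hψ_def, ENNReal.ofReal_toReal hne, ENNReal.mul_div_cancel (hE0 r hr) (measure_ne_top _ _)]
  have hlap : ∀ r, 0 < r → ∀ d, tierLaplace N Tier.sbs d (s r) =
      Real.exp (-(c * a r * F (y₀ * (d / exclRadius N r)) N.α)) := fun r hr d =>
    tierLaplace_sbs_eq N hθ hr d
  have hlap₀ : ∀ r, 0 < r → tierLaplace N Tier.sbs (exclRadius N r) (s r) =
      Real.exp (-(c * a r * F y₀ N.α)) := fun r hr => by
    rw [hlap r hr, div_self (exclRadius_pos N hr).ne', mul_one]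
  have hψ_ge : ∀ r, 0 < r → Real.exp (-(c * a r * F y₀ N.α)) ≤ ψ r := by
    intro r hr
    have h := hμ.measure_mul_tierLaplace_le (N := N) k hr (hs0 r hr)
    rw [hψ r hr, hlap₀ r hr, ENNReal.mul_le_mul_iff_right (hE0 r hr) (measure_ne_top _ _)] at h
    exact (ENNReal.ofReal_le_ofReal_iff ENNReal.toReal_nonneg).1 h
  have hψ_pos : ∀ r, 0 < r → 0 < ψ r := fun r hr => (Real.exp_pos _).trans_le (hψ_ge r hr)
  have hψ_lt : ∀ r, 0 < r → ψ r < 1 := by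
    intro r hr
    have h := hμ.weakLaplace_lt (N := N) k hr (hs0 r hr)
    by_contra hle
    rw [hψ r hr] at h
    refine h.not_ge (le_mul_of_one_le_right' ?_)
    rw [← ENNReal.ofReal_one]
    exact ENNReal.ofReal_le_ofReal (not_lt.1 hle)
  -- In a lower bound e^(-a) w for the probability of a weak cluster, the void factor e^(-a) cancels
  -- against the one in `weakLaplace_le`. It is applied with w = exp(-(k^(2/α) - 1)a) for the
  -- uniform bound and with w = 1 - εa for the limit.
  have hψ_le : ∀ r, 0 < r → ∀ w : ℝ, 0 ≤ w →
      nexp (.ofReal (a r)) * .ofReal w ≤ μ (weakCluster N k r) →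
      w * ψ r ≤ Real.exp (-(c * a r * F y₀ N.α)) := by
    intro r hr w hw h
    have h1 := hμ.weakLaplace_le (N := N) k hr (hs0 r hr)
    rw [hψ r hr, hlap₀ r hr] at h1
    have h2 : nexp (.ofReal (a r)) * (.ofReal w * .ofReal (ψ r)) ≤
        nexp (.ofReal (a r)) * .ofReal (Real.exp (-(c * a r * F y₀ N.α))) := by
      rw [← mul_assoc]
      exact (mul_le_mul_left h _).trans h1
    have h3 : nexp (.ofReal (a r)) ≠ 0 := by
      rw [nexp_ofReal (ha r hr).le]
      exact (ENNReal.ofReal_pos.2 (Real.exp_pos _)).ne'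
    rw [ENNReal.mul_le_mul_iff_right h3 (nexp_ne_top _), ← ENNReal.ofReal_mul hw] at h2
    exact (ENNReal.ofReal_le_ofReal_iff (Real.exp_pos _).le).1 h2
  -- The value that `F` must take for the Laplace factor to equal ψ(r).
  set z : ℝ → ℝ := fun r => -Real.log (ψ r) / (c * a r) with hz_def
  have hzm : Measurable z := by fun_prop
  -- Taking exp of log changes nothing where z(r) > 0, and gives a measurable function everywhere.
  set y : ℝ → ℝ := fun r => invF (Real.exp (Real.log (z r))) N.α with hy_def
  have hym : Measurable y := (measurable_invF_exp hα).comp hzm.log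
  have hy : ∀ r, 0 < r → y₀ ≤ y r ∧ Real.exp (-(c * a r * F (y r) N.α)) = ψ r := by
    intro r hr
    have hca : 0 < c * a r := mul_pos hc (ha r hr)
    have hz : 0 < z r := div_pos (neg_pos.2 (Real.log_neg (hψ_pos r hr) (hψ_lt r hr))) hca
    have hz' : z r ≤ F y₀ N.α := by
      rw [hz_def, div_le_iff₀ hca]
      have := (Real.le_log_iff_exp_le (hψ_pos r hr)).2 (hψ_ge r hr)
      linarith
    obtain ⟨d, hd, hdz⟩ := exists_F_eq hα hy₀.le hz hz'
    have hyd : y r = d := by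
      simp only [hy_def]
      rw [Real.exp_log hz, ← hdz, invF_F hα (hy₀.le.trans hd)]
    rw [hyd]
    refine ⟨hd, ?_⟩
    rw [hdz, hz_def, mul_div_cancel₀ _ hca.ne', neg_neg, Real.exp_log (hψ_pos r hr)]
  have hds : ∀ r, 0 < r → tierLaplace N Tier.sbs (exclRadius N r / y₀ * y r) (s r) = ψ r := by
    intro r hr
    have hρ := exclRadius_pos N hr
    rw [hlap r hr, ← (hy r hr).2]
    congr 5
    field_simp
  have hbound : ∀ r, 0 < r → ψ r ≤ Real.exp (((k : ℝ) ^ (2 / N.α) - 1) * a r) *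
      Real.exp (-(c * a r * F y₀ N.α)) := by
    intro r hr
    have h := hψ_le r hr (Real.exp (-(((k : ℝ) ^ (2 / N.α) - 1) * a r))) (Real.exp_pos _).le ?_
    · calc ψ r = Real.exp (((k : ℝ) ^ (2 / N.α) - 1) * a r) *
            (Real.exp (-(((k : ℝ) ^ (2 / N.α) - 1) * a r)) * ψ r) := by
            rw [← mul_assoc, ← Real.exp_add, add_neg_cancel, Real.exp_zero, one_mul]
        _ ≤ _ := by gcongr
    · refine le_trans (le_of_eq ?_) (hμ.le_measure_weakCluster (N := N) k hr)
      have hk := Real.rpow_nonneg (Nat.cast_nonneg (α := ℝ) k) (2 / N.α)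
      rw [nexp_ofReal (ha r hr).le, nexp_ofReal (mul_nonneg hk (ha r hr).le),
        ← ENNReal.ofReal_mul (Real.exp_pos _).le, ← Real.exp_add]
      congr 2
      simp only [ha_def]
      ring
  have hanti := strictAntiOn_F hα
  refine ⟨fun r => exclRadius N r / y₀ * y r, by fun_prop, fun r hr => ?_, fun r hr => ?_,
    fun hk r hr => ?_, ?_, fun r hr => ?_⟩
  · rw [hds r hr]; exact hψ r hr
  · have := (hy r hr).1
    have hρ := exclRadius_pos N hr
    beta_reduce
    rw [div_mul_eq_mul_div, le_div_iff₀ hy₀]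
    gcongr
  · have h1 := hbound r hr
    rw [hk, Nat.cast_one, Real.one_rpow, sub_self, zero_mul, Real.exp_zero, one_mul,
      ← (hy r hr).2, Real.exp_le_exp, neg_le_neg_iff,
      mul_le_mul_iff_right₀ (mul_pos hc (ha r hr))] at h1
    have h2 : y r = y₀ := le_antisymm
      ((hanti.le_iff_ge hy₀.le (hy₀.le.trans (hy r hr).1)).1 h1) (hy r hr).1
    beta_reduce
    rw [h2]
    field_simp
  · have hratio : ∀ r, 0 < r → exclRadius N r / y₀ * y r / exclRadius N r = y r / y₀ :=
      fun r hr => by have := exclRadius_pos N hr; field_simp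
    refine tendsto_order.2 ⟨fun w hw => ?_, fun w hw => ?_⟩
    · filter_upwards [self_mem_nhdsWithin] with r hr
      rw [hratio r hr]
      exact hw.trans_le ((one_le_div hy₀).2 (hy r hr).1)
    · have hwy : y₀ < w * y₀ := by nlinarith
      set η := F y₀ N.α - F (w * y₀) N.α with hη_def
      have hη : 0 < η := sub_pos.2 (hanti hy₀.le (hy₀.le.trans hwy.le) hwy)
      -- If y(r) ≥ w y₀, comparing logarithms to first order in `a` gives c a η ≤ 2εa, which is
      -- cηa/2 for this ε: a contradiction.
      set ε := η * c / 4 with hε_def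
      have hε : 0 < ε := by positivity
      have hat : Tendsto a (𝓝[>] 0) (𝓝 0) := by
        have hcont : Continuous a := by simp only [ha_def]; unfold exclRadius; fun_prop
        have := hcont.tendsto 0
        simp only [ha_def, exclRadius, mul_zero, ne_eq, OfNat.ofNat_ne_zero, not_false_eq_true,
          zero_pow] at this
        exact this.mono_left nhdsWithin_le_nhds
      filter_upwards [self_mem_nhdsWithin, hμ.eventually_le_measure_weakCluster N k hε,
        hat.eventually_le_const (by positivity : (0 : ℝ) < 1 / (4 * ε))] with r hr hr1 hr2
      have har := ha r hr
      rw [hratio r hr, div_lt_iff₀ hy₀]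
      by_contra hle
      have hle' : w * y₀ ≤ y r := not_lt.1 hle
      have hx : ε * a r ≤ 1 / 4 := by
        rw [le_div_iff₀ (by positivity)] at hr2; linarith
      have h1 := hψ_le r hr (1 - ε * a r) (by linarith) hr1
      have h2 : Real.log (1 - ε * a r) + Real.log (ψ r) ≤ -(c * a r * F y₀ N.α) := by
        rw [← Real.log_mul (by linarith) (hψ_pos r hr).ne', ← Real.log_exp (-(c * a r * F y₀ N.α))]
        exact Real.log_le_log (mul_pos (by linarith) (hψ_pos r hr)) h1
      have h3 : Real.log (ψ r) = -(c * a r * F (y r) N.α) := by rw [← (hy r hr).2, Real.log_exp]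
      have h4 := Real.one_sub_inv_le_log_of_pos (by linarith : 0 < 1 - ε * a r)
      -- Valid as εa ≤ 1/4; this is why `a r` was taken at most 1/(4ε).
      have h5 : (1 - ε * a r)⁻¹ ≤ 1 + 2 * (ε * a r) := by
        rw [inv_le_iff_one_le_mul₀ (by linarith)]
        nlinarith [mul_pos hε har]
      have h6 : F (y r) N.α ≤ F (w * y₀) N.α :=
        hanti.antitoneOn (hy₀.le.trans hwy.le) (hy₀.le.trans (hy r hr).1) hle'
      have h7 : c * a r * η ≤ 2 * (ε * a r) := by
        have : c * a r * F (y r) N.α ≤ c * a r * F (w * y₀) N.α := by gcongr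
        rw [hη_def, mul_sub]
        linarith
      rw [hε_def] at h7
      nlinarith [mul_pos (mul_pos hc har) hη]
  · rw [hds r hr, hlap₀ r hr]
    refine (hbound r hr).trans_eq ?_
    congr 2
    simp only [ha_def, rate]
    ring

/-! ### The MBS user: sign of the integrand, exclusion radii, and the final assembly -/

lemma integrandM_nonneg {Ω : Type*} [MeasurableSpace Ω] {P : Measure Ω} [IsProbabilityMeasure P]
    {N : Params} {X : Tier → ℕ → Ω → Plane} {g : Tier → ℕ → Ω → ℂ} (hN : IsNetwork N X g P)
    (θ : ℝ) (k : ℕ) [NeZero k] (d : ℝ) {r : ℝ} (hr : 0 < r) :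
    0 ≤ integrandM N θ k X P d r := by
  have h1 := hN.probS_lt_one k
  have h2 := tierLaplace_pos N
  have h3 := N.lam_pos Tier.mbs
  have := Real.pi_pos
  have h4 : 0 ≤ gFun N k X P r := measureReal_nonneg
  have h5 : 0 ≤ macroPDF N r := by unfold macroPDF; positivity
  unfold integrandM laplaceI fRcm
  exact mul_nonneg (mul_nonneg (Real.exp_pos _).le (mul_pos (h2 _ _ _) (h2 _ _ _)).le)
    (div_nonneg (mul_nonneg h5 h4) (by linarith))

lemma ae_exclRadius_le {Ω : Type*} [MeasurableSpace Ω] {P : Measure Ω} [IsProbabilityMeasure P]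
    {N : Params} {X : Tier → ℕ → Ω → Plane} {g : Tier → ℕ → Ω → ℂ} (hN : IsNetwork N X g P)
    (k : ℕ) [NeZero k] :
    ∀ᵐ ω ∂P, ω ∈ assocM N k X → ∀ j, exclRadius N ‖X Tier.mbs 0 ω‖ ≤ ‖X Tier.sbs j ω‖ := by
  filter_upwards [hN.ordered Tier.sbs, hN.ae_norm_pos Tier.mbs, hN.ae_norm_pos Tier.sbs]
    with ω ho hm hs hω j
  have hb := rate_pos N Tier.sbs
  refine le_trans ?_ (ho (Nat.zero_le j))
  have hT : arrivalTimes N X Tier.sbs ω ∈ weakCluster N k ‖X Tier.mbs 0 ω‖ := by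
    rw [weakCluster, Set.mem_ofPred_eq, radii_arrivalTimes, ← clusterRSS_eq]
    exact hω
  have h := lt_of_mem_weakCluster N (hm 0)
    (show 0 < arrivalTimes N X Tier.sbs ω 0 from mul_pos hb (pow_pos (hs 0) 2)) hT
  exact le_of_lt (lt_of_pow_lt_pow_left₀ 2 (norm_nonneg _) (lt_of_mul_lt_mul_left h hb.le))

end CoopNet

open CoopNet in
theorem theorem2 {Ω : Type*} [MeasurableSpace Ω] (P : Measure Ω) [IsProbabilityMeasure P]
    (N : Params) (X : Tier → ℕ → Ω → Plane) (g : Tier → ℕ → Ω → ℂ) (hN : IsNetwork N X g P)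
    (k : ℕ) [NeZero k] (θ : ℝ) (hθ : 0 < θ) :
    -- both associations have positive probability, and one of them occurs almost surely
    (0 < probS N k X P ∧ probS N k X P < 1 ∧ P.real (assocM N k X) = 1 - probS N k X P) ∧
    -- a user of the SBS cluster
    (IntegrableOn (integrandS N θ (k := k) X P) (orderedRadii k) ∧
      coverageS N θ k X g P = ∫ r in orderedRadii k, integrandS N θ X P r) ∧
    -- its exclusion radii: given the distances of the cluster, no interfering MBS is closer than
    -- `η^(1/α)` and no interfering SBS is closer than `r_k`
    (∀ᵐ ω ∂P, ω ∈ assocS N k X →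
      (∀ j, eta N (fun i : Fin k => ‖X Tier.sbs i ω‖) ^ (1 / N.α) ≤ ‖X Tier.mbs j ω‖) ∧
      ∀ j, k ≤ j → lastRadius (fun i : Fin k => ‖X Tier.sbs i ω‖) ≤ ‖X Tier.sbs j ω‖) ∧
    -- exclusion radii of an MBS user at distance `r` of its MBS: no interfering MBS is closer than
    -- `r` and no interfering SBS is closer than `ω^(-2/α) r`
    (∀ᵐ ω ∂P, ω ∈ assocM N k X →
      (∀ j, ‖X Tier.mbs 0 ω‖ ≤ ‖X Tier.mbs j ω‖) ∧
      ∀ j, exclRadius N ‖X Tier.mbs 0 ω‖ ≤ ‖X Tier.sbs j ω‖) ∧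
    -- an MBS user: the formula holds with `d_m = r` and a radius `d_s = ds r ≈ ω^(-2/α) r`
    ∃ ds : ℝ → ℝ, Measurable ds ∧
      IntegrableOn (fun r => integrandM N θ k X P (ds r) r) (Set.Ioi 0) ∧
      coverageM N θ k X g P = ∫ r in Set.Ioi 0, integrandM N θ k X P (ds r) r ∧
      -- also locally in the distance `r` of the serving MBS
      (∀ A : Set ℝ, MeasurableSet A →
        (cond P (assocM N k X)).real
            (covered N θ X g macroSet ∩ {ω | ‖X Tier.mbs 0 ω‖ ∈ A}) =
          ∫ r in A ∩ Set.Ioi 0, integrandM N θ k X P (ds r) r) ∧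
      -- the sense of the approximation of `ds r` by `ω^(-2/α) r`
      (∀ r, 0 < r → exclRadius N r ≤ ds r) ∧
      (k = 1 → ∀ r, 0 < r → ds r = exclRadius N r) ∧
      Tendsto (fun r => ds r / exclRadius N r) (𝓝[>] 0) (𝓝 1) ∧
      (∀ r, 0 < r →
        tierLaplace N Tier.sbs (ds r) ((N.pow Tier.mbs)⁻¹ * θ * r ^ N.α) ≤
          Real.exp (Real.pi * N.lam Tier.sbs * ((k : ℝ) ^ (2 / N.α) - 1) * exclRadius N r ^ 2) *
            tierLaplace N Tier.sbs (exclRadius N r) ((N.pow Tier.mbs)⁻¹ * θ * r ^ N.α)) := by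
  have hpS := hN.probS_pos k
  have hpS1 := hN.probS_lt_one k
  refine ⟨⟨hpS, hpS1, hN.measureReal_assocM k⟩, hN.coverageS_eq k hθ, ?_, ?_, ?_⟩
  · filter_upwards [hN.ae_eta_le k, hN.ae_lastRadius_le k] with ω h1 h2 hω using ⟨h1 hω, h2⟩
  · filter_upwards [hN.ordered Tier.mbs, ae_exclRadius_le hN k] with ω h1 h2 hω
    exact ⟨fun j => h1 (Nat.zero_le j), h2 hω⟩
  have hμ := hN.isUnitPoisson Tier.sbs
  have := hμ.isProbabilityMeasure
  obtain ⟨ds, hdsm, hds, h1, h2, h3, h4⟩ := hμ.exists_exclusion_radius N k hθ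
  obtain ⟨K, hK, hKP, hKr⟩ := hN.measure_assocM_inter_covered k hθ
  have hq : 0 < 1 - probS N k X P := sub_pos.2 hpS1
  -- The weak-cluster Laplace transform splits as `gFun` times the factor with radius `ds r`. The
  -- former belongs to the density `fRcm`, the latter completes `laplaceI`.
  have hKeq : ∀ r, 0 < r →
      K r = .ofReal ((1 - probS N k X P) * integrandM N θ k X P (ds r) r) := by
    intro r hr
    have hm : 0 ≤ macroPDF N r := by
      have := N.lam_pos Tier.mbs
      have := Real.pi_pos
      unfold macroPDF; positivity
    rw [hKr r hr, hds r hr, ← ofReal_measureReal, ← hN.gFun_eq,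
      ← ENNReal.ofReal_mul (show 0 ≤ gFun N k X P r from measureReal_nonneg),
      ← ENNReal.ofReal_mul (mul_nonneg hm
        (mul_pos (Real.exp_pos _) (tierLaplace_pos _ _ _ _)).le)]
    congr 1
    rw [integrandM, fRcm, laplaceI]
    field_simp
  -- The local formula is proved for all Borel sets at once; the whole line gives integrability and
  -- the coverage probability.
  have hA : ∀ A : Set ℝ, MeasurableSet A →
      IntegrableOn (fun r => integrandM N θ k X P (ds r) r) (A ∩ Set.Ioi 0) ∧
      (cond P (assocM N k X)).real (covered N θ X g macroSet ∩ {ω | ‖X Tier.mbs 0 ω‖ ∈ A}) =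
          ∫ r in A ∩ Set.Ioi 0, integrandM N θ k X P (ds r) r := by
    intro A hA
    have h := integrableOn_of_lintegral (ν := volume) (hA.inter measurableSet_Ioi) hK hq
      (f := fun r => integrandM N θ k X P (ds r) r)
      (fun r hr => integrandM_nonneg hN θ k _ hr.2) (fun r hr => hKeq r hr.2)
      (by rw [← hKP A hA]; exact measure_ne_top _ _)
    refine ⟨h.1, ?_⟩
    rw [h.2, ← hKP A hA, measureReal_def, cond_apply (measurableSet_assocM N k hN.measurable),
      ENNReal.toReal_mul, ENNReal.toReal_inv, ← hN.measureReal_assocM k, measureReal_def]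
  have huniv := hA Set.univ MeasurableSet.univ
  rw [Set.univ_inter] at huniv
  refine ⟨ds, hdsm, huniv.1, ?_, fun A hAm => (hA A hAm).2, h1, h2, h3, h4⟩
  rw [← huniv.2, coverageM]
  congr 1
  simp
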